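/- Let $G=(V,E)$ be a finite simple undirected graph with $n=|V|$ nodes and $m=|E|$ links, where every link $e$ has a real capacity $c(e)\ge 0$ and a real weight $\omega(e)\ge 0$, and let $s,w,t\in V$ (not necessarily distinct). A \emph{route} from $s$ via $w$ to $t$ is a walk from $s$ to $w$ followed by a walk from $w$ to $t$. It is \emph{feasible} if, for every link $e$, the total number of times the two walks traverse $e$, in either direction, is at most $c(e)$. Its \emph{length} is the sum of the weights of the traversed links, counted with multiplicity. There is a deterministic algorithm that, given $G$ (as a list of its links with their capacities and weights) and $s,w,t$, outputs a feasible route from $s$ via $w$ to $t$ of minimum length among all feasible routes, or reports that no feasible route exists. For $m\ge 1$ its running time is \[ O\bigl(m \log_{1+m/n} n\bigr). \] Here running time is the number of steps on a random access machine with words of $O(\log(n+m))$ bits, on which addition, truncated subtraction, multiplication, integer division and comparison of words, addition, subtraction and comparison of real numbers, and (indirect) memory accesses take one step each. -/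

import Mathlib

open scoped NNReal

/-! ## Waypoint routing on undirected networks -/

/-- An undirected (simple) graph with non-negative link capacities and link weights.
Only the values on links of the graph matter. -/
structure Network (V : Type) where
  graph : SimpleGraph V
  cap : Sym2 V → ℝ≥0
  weight : Sym2 V → ℝ≥0

/-- A route from `s` via `w` to `t`: a walk from `s` to `w` followed by a walk from `w` to `t`.
Nodes and links may be repeated. -/
structure Route {V : Type} (N : Network V) (s w t : V) where
  first : N.graph.Walk s w
  second : N.graph.Walk w t

namespace Route

variable {V : Type} {N : Network V} {s w t : V}

/-- The links traversed by the route, with repetitions. -/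
def links (R : Route N s w t) : List (Sym2 V) :=
  R.first.edges ++ R.second.edges

/-- The flow has demand one: every traversal of a link, in either direction and on either segment,
uses one unit of the capacity of that link. -/
def Feasible [DecidableEq V] (R : Route N s w t) : Prop :=
  ∀ e ∈ N.graph.edgeSet, (R.links.count e : ℝ≥0) ≤ N.cap e

/-- The total weight of the route, repeated links being counted with repetition. -/
noncomputable def length (R : Route N s w t) : ℝ≥0 :=
  (R.links.map N.weight).sum

/-- A feasible route of minimum length among all feasible routes. -/
def IsShortest [DecidableEq V] (R : Route N s w t) : Prop :=
  R.Feasible ∧ ∀ R' : Route N s w t, R'.Feasible → R.length ≤ R'.length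

end Route

/-! ## The machine model

A random access machine with words (natural numbers below a bound `B`) and real numbers.
A program uses finitely many registers and arrays of each of the two kinds, and has indirect
addressing. Words can be added, subtracted (truncated at zero), multiplied, divided (rounding down,
with `x / 0 = 0`) and compared; real numbers can only be added, subtracted and compared, and there
is no conversion between words and reals. Every operation costs one step. If a word operation
yields a value that is not below `B`, the program has no execution. -/

namespace RAM

/-- The contents of the word registers, real registers, word arrays and real arrays. -/
structure State where
  nreg : ℕ → ℕ
  rreg : ℕ → ℝ
  narr : ℕ → ℕ → ℕ
  rarr : ℕ → ℕ → ℝ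

/-- Word expressions; `read a i` is the entry at index `i` of the word array number `a`. -/
inductive NExpr where
  | lit (k : ℕ)
  | reg (x : ℕ)
  | read (a : ℕ) (i : NExpr)
  | add (e f : NExpr)
  | sub (e f : NExpr)
  | mul (e f : NExpr)
  | div (e f : NExpr)

/-- Real expressions; `read a i` is the entry at index `i` of the real array number `a`. -/
inductive RExpr where
  | zero
  | one
  | reg (x : ℕ)
  | read (a : ℕ) (i : NExpr)
  | add (e f : RExpr)
  | sub (e f : RExpr)

/-- Tests. -/
inductive BExpr where
  | nle (e f : NExpr)
  | rle (e f : RExpr)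
  | not (b : BExpr)
  | and (b c : BExpr)

/-- Programs. -/
inductive Cmd where
  | skip
  | setN (x : ℕ) (e : NExpr)
  | setR (x : ℕ) (e : RExpr)
  | storeN (a : ℕ) (i e : NExpr)
  | storeR (a : ℕ) (i : NExpr) (e : RExpr)
  | seq (P Q : Cmd)
  | ite (b : BExpr) (P Q : Cmd)
  | loop (b : BExpr) (P : Cmd)

namespace NExpr

def eval (σ : State) : NExpr → ℕ
  | lit k => k
  | reg x => σ.nreg x
  | read a i => σ.narr a (i.eval σ)
  | add e f => e.eval σ + f.eval σ
  | sub e f => e.eval σ - f.eval σ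
  | mul e f => e.eval σ * f.eval σ
  | div e f => e.eval σ / f.eval σ

/-- The values of the expression and of all its subexpressions fit into a word. -/
def Fits (B : ℕ) (σ : State) : NExpr → Prop
  | lit k => k < B
  | reg x => σ.nreg x < B
  | read a i => i.Fits B σ ∧ σ.narr a (i.eval σ) < B
  | add e f => e.Fits B σ ∧ f.Fits B σ ∧ e.eval σ + f.eval σ < B
  | sub e f => e.Fits B σ ∧ f.Fits B σ
  | mul e f => e.Fits B σ ∧ f.Fits B σ ∧ e.eval σ * f.eval σ < B
  | div e f => e.Fits B σ ∧ f.Fits B σ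

def cost : NExpr → ℕ
  | lit _ => 1
  | reg _ => 1
  | read _ i => i.cost + 1
  | add e f => e.cost + f.cost + 1
  | sub e f => e.cost + f.cost + 1
  | mul e f => e.cost + f.cost + 1
  | div e f => e.cost + f.cost + 1

end NExpr

namespace RExpr

noncomputable def eval (σ : State) : RExpr → ℝ
  | zero => 0
  | one => 1
  | reg x => σ.rreg x
  | read a i => σ.rarr a (i.eval σ)
  | add e f => e.eval σ + f.eval σ
  | sub e f => e.eval σ - f.eval σ

def Fits (B : ℕ) (σ : State) : RExpr → Prop
  | zero => True
  | one => True
  | reg _ => True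
  | read _ i => i.Fits B σ
  | add e f => e.Fits B σ ∧ f.Fits B σ
  | sub e f => e.Fits B σ ∧ f.Fits B σ

def cost : RExpr → ℕ
  | zero => 1
  | one => 1
  | reg _ => 1
  | read _ i => i.cost + 1
  | add e f => e.cost + f.cost + 1
  | sub e f => e.cost + f.cost + 1

end RExpr

namespace BExpr

def Holds (σ : State) : BExpr → Prop
  | nle e f => e.eval σ ≤ f.eval σ
  | rle e f => e.eval σ ≤ f.eval σ
  | not b => ¬ b.Holds σ
  | and b c => b.Holds σ ∧ c.Holds σ

def Fits (B : ℕ) (σ : State) : BExpr → Prop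
  | nle e f => e.Fits B σ ∧ f.Fits B σ
  | rle e f => e.Fits B σ ∧ f.Fits B σ
  | not b => b.Fits B σ
  | and b c => b.Fits B σ ∧ c.Fits B σ

def cost : BExpr → ℕ
  | nle e f => e.cost + f.cost + 1
  | rle e f => e.cost + f.cost + 1
  | not b => b.cost + 1
  | and b c => b.cost + c.cost + 1

end BExpr

namespace State

def setN (σ : State) (x v : ℕ) : State :=
  { σ with nreg := Function.update σ.nreg x v }

noncomputable def setR (σ : State) (x : ℕ) (v : ℝ) : State :=
  { σ with rreg := Function.update σ.rreg x v }

def storeN (σ : State) (a i v : ℕ) : State :=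
  { σ with narr := Function.update σ.narr a (Function.update (σ.narr a) i v) }

noncomputable def storeR (σ : State) (a i : ℕ) (v : ℝ) : State :=
  { σ with rarr := Function.update σ.rarr a (Function.update (σ.rarr a) i v) }

end State

/-- `Exec B P σ T τ`: with words below `B`, the program `P` started in the state `σ` halts in the
state `τ` after exactly `T` steps. -/
inductive Exec (B : ℕ) : Cmd → State → ℕ → State → Prop where
  | skip (σ : State) : Exec B .skip σ 1 σ
  | setN (σ : State) (x : ℕ) (e : NExpr) (he : e.Fits B σ) :
      Exec B (.setN x e) σ (e.cost + 1) (σ.setN x (e.eval σ))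
  | setR (σ : State) (x : ℕ) (e : RExpr) (he : e.Fits B σ) :
      Exec B (.setR x e) σ (e.cost + 1) (σ.setR x (e.eval σ))
  | storeN (σ : State) (a : ℕ) (i e : NExpr) (hi : i.Fits B σ) (he : e.Fits B σ) :
      Exec B (.storeN a i e) σ (i.cost + e.cost + 1) (σ.storeN a (i.eval σ) (e.eval σ))
  | storeR (σ : State) (a : ℕ) (i : NExpr) (e : RExpr) (hi : i.Fits B σ) (he : e.Fits B σ) :
      Exec B (.storeR a i e) σ (i.cost + e.cost + 1) (σ.storeR a (i.eval σ) (e.eval σ))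
  | seq {P Q : Cmd} {σ τ υ : State} {T U : ℕ} (hP : Exec B P σ T τ) (hQ : Exec B Q τ U υ) :
      Exec B (.seq P Q) σ (T + U) υ
  | ite_true {b : BExpr} {P Q : Cmd} {σ τ : State} {T : ℕ} (hf : b.Fits B σ) (hb : b.Holds σ)
      (hP : Exec B P σ T τ) : Exec B (.ite b P Q) σ (b.cost + 1 + T) τ
  | ite_false {b : BExpr} {P Q : Cmd} {σ τ : State} {T : ℕ} (hf : b.Fits B σ) (hb : ¬ b.Holds σ)
      (hQ : Exec B Q σ T τ) : Exec B (.ite b P Q) σ (b.cost + 1 + T) τ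
  | loop_true {b : BExpr} {P : Cmd} {σ τ υ : State} {T U : ℕ} (hf : b.Fits B σ) (hb : b.Holds σ)
      (hP : Exec B P σ T τ) (hL : Exec B (.loop b P) τ U υ) :
      Exec B (.loop b P) σ (b.cost + 1 + T + U) υ
  | loop_false {b : BExpr} {P : Cmd} {σ : State} (hf : b.Fits B σ) (hb : ¬ b.Holds σ) :
      Exec B (.loop b P) σ (b.cost + 1) σ

end RAM

/-! ## Input and output conventions -/

/-- `ends` lists every link of the network exactly once, in an arbitrary order and with the two
ends of each link in an arbitrary order. In particular `m` is the number of links. -/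
structure IsLinkList {V : Type} (N : Network V) {m : ℕ} (ends : Fin m → V × V) : Prop where
  injective : Function.Injective fun i => s((ends i).1, (ends i).2)
  range_eq : Set.range (fun i => s((ends i).1, (ends i).2)) = N.graph.edgeSet

/-- The initial state. Word registers `0`-`4` hold `n`, `m`, `s`, `w`, `t`; at index `i < m` the
word arrays `0` and `1` hold the two ends, and the real arrays `0` and `1` the capacity and the
weight, of the `i`-th link. All the rest of the memory is zero. -/
noncomputable def inputState {n m : ℕ} (N : Network (Fin n)) (ends : Fin m → Fin n × Fin n)
    (s w t : Fin n) : RAM.State where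
  nreg x := match x with
    | 0 => n
    | 1 => m
    | 2 => s
    | 3 => w
    | 4 => t
    | _ => 0
  rreg _ := 0
  narr a i := if h : i < m then
      match a with
      | 0 => (ends ⟨i, h⟩).1
      | 1 => (ends ⟨i, h⟩).2
      | _ => 0
    else 0
  rarr a i := if h : i < m then
      match a with
      | 0 => N.cap s((ends ⟨i, h⟩).1, (ends ⟨i, h⟩).2)
      | 1 => N.weight s((ends ⟨i, h⟩).1, (ends ⟨i, h⟩).2)
      | _ => 0
    else 0

/-- The final state answers "no route": word register `5` holds `0`. -/
def ReportsInfeasible (σ : RAM.State) : Prop :=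
  σ.nreg 5 = 0

/-- The final state holds the route `R`: word register `5` holds `1`, word registers `6` and `7`
hold the numbers `p` and `q` of links of the two segments of `R`, and the word array `2` holds at
the indices `0, …, p + q` the nodes in the order in which `R` visits them. -/
def ReportsRoute {n : ℕ} {N : Network (Fin n)} {s w t : Fin n} (σ : RAM.State)
    (R : Route N s w t) : Prop :=
  σ.nreg 5 = 1 ∧ σ.nreg 6 = R.first.length ∧ σ.nreg 7 = R.second.length ∧
    (∀ i ≤ R.first.length, σ.narr 2 i = (R.first.getVert i : ℕ)) ∧
    ∀ i ≤ R.second.length, σ.narr 2 (R.first.length + i) = (R.second.getVert i : ℕ)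

/-- The answer to the shortest waypoint routing problem in the final state is correct. -/
def SolvesShortestRoute {n : ℕ} (N : Network (Fin n)) (s w t : Fin n) (σ : RAM.State) : Prop :=
  (∃ R : Route N s w t, R.IsShortest ∧ ReportsRoute σ R) ∨
    ((¬ ∃ R : Route N s w t, R.Feasible) ∧ ReportsInfeasible σ)

/-! A feasible route from `s` via `w` to `t` is a pair of paths from `w`, one to `s` and one to `t`,
that is, an integral flow which sends one unit from `w` to each of `s` and `t` on the network that
has two opposite arcs for each link. A flow that is of minimum cost can be decomposed into such a
pair, and it is found by two augmentations along shortest residual paths. Potentials keep the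
reduced costs of the residual arcs nonnegative, so that both paths can be found by Dijkstra's
algorithm, and they bound the cost of any flow from below link by link. If a search does not reach
its target, then the reached vertices form a cut with too little capacity for a feasible route.

The queue of Dijkstra's algorithm is a tournament tree of arity `d = m / n + 2`. Each of the `O(m)`
decreases of a key replays one game of constant cost on each of the `O(log_d n)` levels, while each
of the at most `n` deletions replays games of cost `O(d)`, and `n * d = O(n + m)`. -/

/-- The vertices on the way from `x` to the root `0` in the tree on the natural numbers in which
`y / d` is the parent of `y`. -/
def treePath (d x : ℕ) : Set ℕ :=
  Set.range fun j => x / d ^ j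

section treePath

variable {d x y : ℕ}

theorem self_mem_treePath (d x : ℕ) : x ∈ treePath d x :=
  ⟨0, by simp⟩

theorem div_mem_treePath (h : y ∈ treePath d x) : y / d ∈ treePath d x := by
  obtain ⟨j, rfl⟩ := h
  exact ⟨j + 1, by simp only [pow_succ, Nat.div_div_eq_div_mul]⟩

theorem le_of_mem_treePath (h : y ∈ treePath d x) : y ≤ x := by
  obtain ⟨j, rfl⟩ := h
  exact Nat.div_le_self _ _

theorem treePath_zero (d : ℕ) : treePath d 0 = {0} :=
  Set.eq_singleton_iff_unique_mem.2
    ⟨self_mem_treePath d 0, fun _ h => Nat.le_zero.1 (le_of_mem_treePath h)⟩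

theorem treePath_sdiff_self (hd : 2 ≤ d) (hx : x ≠ 0) :
    treePath d x \ {x} = treePath d (x / d) := by
  have hlt : x / d < x := Nat.div_lt_self (Nat.pos_of_ne_zero hx) hd
  refine Set.Subset.antisymm ?_ fun y hy => ⟨?_, ((le_of_mem_treePath hy).trans_lt hlt).ne⟩
  · rintro _ ⟨⟨_ | j, rfl⟩, hne⟩
    · exact absurd (by simp) hne
    · exact ⟨j, by simp only [pow_succ', Nat.div_div_eq_div_mul]⟩
  · obtain ⟨j, rfl⟩ := hy
    exact ⟨j + 1, by simp only [pow_succ', Nat.div_div_eq_div_mul]⟩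

end treePath

/-- A tournament of arity `d` between the players `0, …, n - 1`, arranged as a tree in which `x / d`
is the parent of `x`: the player `win x` comes from the subtree of `x`, and has least key `κ` in
it. The latter is expressed locally, and not required at the vertices in `X`. -/
structure IsTournament {α : Type*} [LE α] (n d : ℕ) (κ : ℕ → α) (win : ℕ → ℕ) (X : Set ℕ) :
    Prop where
  lt : ∀ x < n, win x < n
  mem : ∀ x < n, x ∈ treePath d (win x)
  le_self : ∀ x < n, x ∉ X → κ (win x) ≤ κ x
  le_child : ∀ c < n, c / d ∉ X → κ (win (c / d)) ≤ κ (win c)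

namespace IsTournament

open Function

variable {α : Type*} {n d : ℕ} {κ κ' : ℕ → α} {win : ℕ → ℕ} {X : Set ℕ} {v x b : ℕ}

theorem root_le [Preorder α] (hd : 2 ≤ d) (h : IsTournament n d κ win ∅) (hv : v < n) :
    κ (win 0) ≤ κ v := by
  refine le_trans ?_ (h.le_self v hv (Set.notMem_empty v))
  induction v using Nat.strong_induction_on with
  | _ v ih =>
    rcases Nat.eq_zero_or_pos v with rfl | hpos
    · exact le_rfl
    · have hlt : v / d < v := Nat.div_lt_self hpos hd
      exact (ih _ hlt (hlt.trans hv)).trans (h.le_child v hv (Set.notMem_empty _))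

theorem of_key_eq_off [LE α] (h : IsTournament n d κ win ∅) (hκ : ∀ x ≠ v, κ' x = κ x) :
    IsTournament n d κ' win (treePath d v) := by
  have hself : ∀ x, x ∉ treePath d v → x ≠ v := fun x hx e =>
    hx (e ▸ self_mem_treePath d v)
  have hwin : ∀ x < n, x ∉ treePath d v → win x ≠ v := fun x hx hX e =>
    hX (e ▸ h.mem x hx)
  refine ⟨h.lt, h.mem, fun x hx hX => ?_, fun c hc hX => ?_⟩
  · rw [hκ _ (hwin x hx hX), hκ x (hself x hX)]
    exact h.le_self x hx (Set.notMem_empty x)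
  · have hc' : c ∉ treePath d v := fun e => hX (div_mem_treePath e)
    rw [hκ _ (hwin c hc hc'), hκ _ (hwin _ ((Nat.div_le_self c d).trans_lt hc) hX)]
    exact h.le_child c hc (Set.notMem_empty _)

theorem update [Preorder α] (h : IsTournament n d κ win X) (hX : x / d ∈ X) (hb : b < n)
    (hxb : x ∈ treePath d b) (hself : κ b ≤ κ x)
    (hchild : ∀ c < n, c / d = x → κ b ≤ κ (win c)) :
    IsTournament n d κ (update win x b) (X \ {x}) := by
  have off : ∀ y, y ≠ x → y ∉ X \ {x} → y ∉ X := fun y hy hn hyX => hn ⟨hyX, hy⟩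
  refine ⟨fun y hy => ?_, fun y hy => ?_, fun y hy hn => ?_, fun c hc hn => ?_⟩
  · rcases eq_or_ne y x with rfl | e
    · simpa only [update_self] using hb
    · simpa only [update_of_ne e] using h.lt y hy
  · rcases eq_or_ne y x with rfl | e
    · simpa only [update_self] using hxb
    · simpa only [update_of_ne e] using h.mem y hy
  · rcases eq_or_ne y x with rfl | e
    · simpa only [update_self] using hself
    · simpa only [update_of_ne e] using h.le_self y hy (off y e hn)
  · rcases eq_or_ne c x with rfl | e
    · by_cases e' : c / d = c
      · rw [e']
      · exact absurd hX (off _ e' hn)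
    · rw [update_of_ne e]
      by_cases e' : c / d = x
      · simpa only [e', update_self] using hchild c hc e'
      · simpa only [update_of_ne e'] using h.le_child c hc (off _ e' hn)

end IsTournament

/-- The outcome of entering the player `v` into the tournament `win` at the vertices in `X`. -/
noncomputable def enterTournament {α : Type*} [LE α] (κ : ℕ → α) (win : ℕ → ℕ) (v : ℕ)
    (X : Set ℕ) (x : ℕ) : ℕ :=
  open Classical in if x ∈ X ∧ κ v ≤ κ (win x) then v else win x

section enterTournament

open Function

variable {α : Type*} {κ : ℕ → α} {win : ℕ → ℕ} {X : Set ℕ} {v x : ℕ}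

theorem enterTournament_empty [LE α] : enterTournament κ win v ∅ = win := by
  funext x
  simp [enterTournament]

theorem enterTournament_update [LE α] :
    enterTournament κ (update win x (enterTournament κ win v X x)) v (X \ {x}) =
      enterTournament κ win v X := by
  funext y
  rcases eq_or_ne y x with rfl | hy
  · simp [enterTournament]
  · by_cases hv : y ∈ X ∧ κ v ≤ κ (win y) <;> simp [enterTournament, hy, hv]

end enterTournament

theorem IsTournament.of_key_decrease {α : Type*} [LinearOrder α] {n d : ℕ} {κ κ' : ℕ → α}
    {win : ℕ → ℕ} {v : ℕ} (h : IsTournament n d κ win ∅) (hv : v < n)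
    (hκ : ∀ x ≠ v, κ' x = κ x) (hle : κ' v ≤ κ v) :
    IsTournament n d κ' (enterTournament κ' win v (treePath d v)) ∅ := by
  set win' := enterTournament κ' win v (treePath d v) with hwin'
  have hmono : ∀ x, κ' x ≤ κ x := fun x => by
    rcases eq_or_ne x v with rfl | e
    exacts [hle, (hκ x e).le]
  have hcases : ∀ x, win' x = v ∧ x ∈ treePath d v ∨ win' x = win x := fun x => by
    by_cases hx : x ∈ treePath d v ∧ κ' v ≤ κ' (win x)
    · exact .inl ⟨if_pos hx, hx.1⟩
    · exact .inr (if_neg hx)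
  have hle_old : ∀ x, κ' (win' x) ≤ κ' (win x) := fun x => by
    rw [hwin', enterTournament]
    split_ifs with hx
    exacts [hx.2, le_rfl]
  have hle_new : ∀ x ∈ treePath d v, κ' (win' x) ≤ κ' v := fun x hxv => by
    rw [hwin', enterTournament]
    split_ifs with hx
    exacts [le_rfl, (not_le.1 fun hlt => hx ⟨hxv, hlt⟩).le]
  refine ⟨fun x hx => ?_, fun x hx => ?_, fun x hx _ => ?_, fun c hc _ => ?_⟩
  · rcases hcases x with ⟨e, -⟩ | e <;> rw [e]
    exacts [hv, h.lt x hx]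
  · rcases hcases x with ⟨e, hxv⟩ | e <;> rw [e]
    exacts [hxv, h.mem x hx]
  · rcases eq_or_ne x v with rfl | hxv
    · exact hle_new x (self_mem_treePath d x)
    · exact ((hle_old x).trans (hmono _)).trans
        ((h.le_self x hx (Set.notMem_empty x)).trans (hκ x hxv).ge)
  · have hcv : κ' (win' (c / d)) ≤ κ' (win c) := by
      rcases eq_or_ne (win c) v with e | e
      · rw [e]
        exact hle_new _ (div_mem_treePath (e ▸ h.mem c hc))
      · exact ((hle_old _).trans (hmono _)).trans
          ((h.le_child c hc (Set.notMem_empty _)).trans (hκ _ e).ge)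
    rcases hcases c with ⟨e, hc'⟩ | e <;> rw [e]
    exacts [hle_new _ (div_mem_treePath hc'), hcv]

/-- A directed multigraph with lengths: only the arcs in `arcs` may be used. -/
structure ArcGraph (V α : Type*) where
  arcs : Set α
  tail : α → V
  head : α → V
  length : α → ℝ

/-- The labels of a search for shortest paths: the vertices reached so far, and for each of them
the last arc and the length of the best path found. -/
structure PathLabels (V α : Type*) where
  reached : Set V
  parent : V → α
  dist : V → ℝ

namespace ArcGraph

open Function

variable {V α : Type*} (G : ArcGraph V α)

/-- The outcome of a search for shortest paths from `r`: every vertex that can be reached has been,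
by an arc that continues a best path. The order in which vertices were settled is recorded in
`rank`, which hence increases along the tree of best paths. -/
structure IsShortestPathTree (r : V) (L : PathLabels V α) (rank : V → ℕ) : Prop where
  root_mem : r ∈ L.reached
  dist_root : L.dist r = 0
  parent_mem : ∀ v ∈ L.reached, v ≠ r → L.parent v ∈ G.arcs
  head_parent : ∀ v ∈ L.reached, v ≠ r → G.head (L.parent v) = v
  tail_mem : ∀ v ∈ L.reached, v ≠ r → G.tail (L.parent v) ∈ L.reached
  dist_eq : ∀ v ∈ L.reached, v ≠ r →
    L.dist v = L.dist (G.tail (L.parent v)) + G.length (L.parent v)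
  rank_lt : ∀ v ∈ L.reached, v ≠ r → rank (G.tail (L.parent v)) < rank v
  head_mem : ∀ a ∈ G.arcs, G.tail a ∈ L.reached → G.head a ∈ L.reached
  dist_head_le : ∀ a ∈ G.arcs, G.tail a ∈ L.reached →
    L.dist (G.head a) ≤ L.dist (G.tail a) + G.length a

/-- The invariant of Dijkstra's algorithm from `r`: the vertices in `S` have been settled, in the
order given by `rank`, the arcs in `D` have been scanned, and `μ` separates the distances of the
settled vertices from those of the other vertices. -/
structure DijkstraInvariant (r : V) (L : PathLabels V α) (S : Finset V) (D : Set α) (rank : V → ℕ)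
    (μ : ℝ) : Prop where
  root_mem : r ∈ L.reached
  dist_root : L.dist r = 0
  parent_mem : ∀ v ∈ L.reached, v ≠ r → L.parent v ∈ G.arcs
  head_parent : ∀ v ∈ L.reached, v ≠ r → G.head (L.parent v) = v
  tail_mem : ∀ v ∈ L.reached, v ≠ r → G.tail (L.parent v) ∈ S
  dist_eq : ∀ v ∈ L.reached, v ≠ r →
    L.dist v = L.dist (G.tail (L.parent v)) + G.length (L.parent v)
  rank_lt : ∀ v ∈ S, v ≠ r → rank (G.tail (L.parent v)) < rank v
  rank_lt_card : ∀ v ∈ S, rank v < S.card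
  settled_subset : ∀ v ∈ S, v ∈ L.reached
  scanned_tail_mem : ∀ a ∈ D, G.tail a ∈ S
  scanned_head_mem : ∀ a ∈ D, a ∈ G.arcs → G.head a ∈ L.reached
  dist_head_le : ∀ a ∈ D, a ∈ G.arcs → L.dist (G.head a) ≤ L.dist (G.tail a) + G.length a
  nonneg : 0 ≤ μ
  dist_le : ∀ v ∈ S, L.dist v ≤ μ
  le_dist : ∀ v ∈ L.reached, v ∉ S → μ ≤ L.dist v

/-- The labels after a better path to the head of the arc `a` has been found, ending with `a`. -/
def relax [DecidableEq V] (L : PathLabels V α) (a : α) : PathLabels V α where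
  reached := insert (G.head a) L.reached
  parent := update L.parent (G.head a) a
  dist := update L.dist (G.head a) (L.dist (G.tail a) + G.length a)

namespace DijkstraInvariant

variable {G} {r u : V} {L : PathLabels V α} {S : Finset V} {D : Set α} {rank : V → ℕ}
  {μ : ℝ} {a : α}

theorem initial (hr : L.reached = {r}) (h0 : L.dist r = 0) :
    G.DijkstraInvariant r L ∅ ∅ rank 0 where
  root_mem := by simp [hr]
  dist_root := h0
  parent_mem v hv hne := absurd (by simpa [hr] using hv) hne
  head_parent v hv hne := absurd (by simpa [hr] using hv) hne
  tail_mem v hv hne := absurd (by simpa [hr] using hv) hne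
  dist_eq v hv hne := absurd (by simpa [hr] using hv) hne
  rank_lt _ hv := absurd hv (Finset.notMem_empty _)
  rank_lt_card _ hv := absurd hv (Finset.notMem_empty _)
  settled_subset _ hv := absurd hv (Finset.notMem_empty _)
  scanned_tail_mem _ ha := absurd ha (Set.notMem_empty _)
  scanned_head_mem _ ha := absurd ha (Set.notMem_empty _)
  dist_head_le _ ha := absurd ha (Set.notMem_empty _)
  nonneg := le_rfl
  dist_le _ hv := absurd hv (Finset.notMem_empty _)
  le_dist v hv _ := by
    obtain rfl : v = r := by simpa [hr] using hv
    exact h0.ge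

theorem settle [DecidableEq V] (h : G.DijkstraInvariant r L S D rank μ) (hu : u ∈ L.reached)
    (huS : u ∉ S) (hmin : ∀ v ∈ L.reached, v ∉ S → L.dist u ≤ L.dist v) :
    G.DijkstraInvariant r L (insert u S) D (update rank u S.card) (L.dist u) := by
  have rank_old : ∀ v ∈ S, update rank u S.card v = rank v := fun v hv =>
    update_of_ne (ne_of_mem_of_not_mem hv huS) _ _
  exact
    { h with
      tail_mem := fun v hv hne => Finset.mem_insert_of_mem (h.tail_mem v hv hne)
      rank_lt := fun v hv hne => by
        rcases Finset.mem_insert.1 hv with rfl | hv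
        · rw [update_self, rank_old _ (h.tail_mem v hu hne)]
          exact h.rank_lt_card _ (h.tail_mem v hu hne)
        · rw [rank_old v hv, rank_old _ (h.tail_mem v (h.settled_subset v hv) hne)]
          exact h.rank_lt v hv hne
      rank_lt_card := fun v hv => by
        rw [Finset.card_insert_of_notMem huS, Nat.lt_succ_iff]
        rcases Finset.mem_insert.1 hv with rfl | hv
        · rw [update_self]
        · rw [rank_old v hv]
          exact (h.rank_lt_card v hv).le
      settled_subset := Finset.forall_mem_insert _ _ _ |>.2 ⟨hu, h.settled_subset⟩
      scanned_tail_mem := fun a ha => Finset.mem_insert_of_mem (h.scanned_tail_mem a ha)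
      nonneg := h.nonneg.trans (h.le_dist u hu huS)
      dist_le := Finset.forall_mem_insert _ _ _ |>.2
        ⟨le_rfl, fun v hv => (h.dist_le v hv).trans (h.le_dist u hu huS)⟩
      le_dist := fun v hv hvS => hmin v hv fun hv' => hvS (Finset.mem_insert_of_mem hv') }

theorem scan (h : G.DijkstraInvariant r L S D rank μ) (htail : G.tail a ∈ S)
    (hhead : a ∈ G.arcs → G.head a ∈ L.reached)
    (hle : a ∈ G.arcs → L.dist (G.head a) ≤ L.dist (G.tail a) + G.length a) :
    G.DijkstraInvariant r L S (insert a D) rank μ :=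
  { h with
    scanned_tail_mem := Set.forall_mem_insert.2 ⟨htail, h.scanned_tail_mem⟩
    scanned_head_mem := Set.forall_mem_insert.2 ⟨hhead, h.scanned_head_mem⟩
    dist_head_le := Set.forall_mem_insert.2 ⟨hle, h.dist_head_le⟩ }

theorem mono_scanned (h : G.DijkstraInvariant r L S D rank μ) {D' : Set α} (hD : D' ⊆ D) :
    G.DijkstraInvariant r L S D' rank μ :=
  { h with
    scanned_tail_mem := fun a ha => h.scanned_tail_mem a (hD ha)
    scanned_head_mem := fun a ha => h.scanned_head_mem a (hD ha)
    dist_head_le := fun a ha => h.dist_head_le a (hD ha) }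

theorem head_notMem_settled (h : G.DijkstraInvariant r L S D rank μ)
    (hμ : L.dist (G.tail a) = μ) (hlen : 0 ≤ G.length a)
    (hbetter : G.head a ∈ L.reached → L.dist (G.tail a) + G.length a < L.dist (G.head a)) :
    G.head a ∉ S := fun hS => by
  linarith [hbetter (h.settled_subset _ hS), h.dist_le _ hS]

theorem head_ne_root (h : G.DijkstraInvariant r L S D rank μ)
    (hμ : L.dist (G.tail a) = μ) (hlen : 0 ≤ G.length a)
    (hbetter : G.head a ∈ L.reached → L.dist (G.tail a) + G.length a < L.dist (G.head a)) :
    G.head a ≠ r := fun e => by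
  have hlt := hbetter (e ▸ h.root_mem)
  rw [e, h.dist_root] at hlt
  linarith [h.nonneg]

theorem relax [DecidableEq V] (h : G.DijkstraInvariant r L S D rank μ) (ha : a ∈ G.arcs)
    (htail : G.tail a ∈ S) (hμ : L.dist (G.tail a) = μ) (hlen : 0 ≤ G.length a)
    (hbetter : G.head a ∈ L.reached → L.dist (G.tail a) + G.length a < L.dist (G.head a)) :
    G.DijkstraInvariant r (G.relax L a) S D rank μ := by
  have hS := h.head_notMem_settled hμ hlen hbetter
  have hr := h.head_ne_root hμ hlen hbetter
  have dist_old : ∀ v, v ≠ G.head a → (G.relax L a).dist v = L.dist v := fun v hv =>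
    update_of_ne hv _ _
  have parent_old : ∀ v, v ≠ G.head a → (G.relax L a).parent v = L.parent v := fun v hv =>
    update_of_ne hv _ _
  have dist_new : (G.relax L a).dist (G.head a) = L.dist (G.tail a) + G.length a :=
    update_self _ _ _
  have parent_new : (G.relax L a).parent (G.head a) = a := update_self _ _ _
  have ne_of_mem : ∀ v ∈ S, v ≠ G.head a := fun v hv e => hS (e ▸ hv)
  have split : ∀ v ∈ (G.relax L a).reached, v = G.head a ∨ v ≠ G.head a ∧ v ∈ L.reached :=
    fun v hv => (eq_or_ne v _).imp_right fun hne => ⟨hne, hv.resolve_left hne⟩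
  refine ⟨.inr h.root_mem, (dist_old r hr.symm).trans h.dist_root, fun v hv hvr => ?_,
    fun v hv hvr => ?_, fun v hv hvr => ?_, fun v hv hvr => ?_, fun v hv hvr => ?_, h.rank_lt_card,
    fun v hv => .inr (h.settled_subset v hv), h.scanned_tail_mem,
    fun b hb hb' => .inr (h.scanned_head_mem b hb hb'), fun b hb hb' => ?_, h.nonneg,
    fun v hv => (dist_old v (ne_of_mem v hv)).trans_le (h.dist_le v hv), fun v hv hvS => ?_⟩
  · rcases split v hv with rfl | ⟨hne, hv⟩
    exacts [parent_new.symm ▸ ha, (parent_old v hne).symm ▸ h.parent_mem v hv hvr]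
  · rcases split v hv with rfl | ⟨hne, hv⟩
    exacts [congrArg G.head parent_new, (parent_old v hne).symm ▸ h.head_parent v hv hvr]
  · rcases split v hv with rfl | ⟨hne, hv⟩
    exacts [parent_new.symm ▸ htail, (parent_old v hne).symm ▸ h.tail_mem v hv hvr]
  · rcases split v hv with rfl | ⟨hne, hv⟩
    · rw [parent_new, dist_new, dist_old _ (ne_of_mem _ htail)]
    · rw [parent_old v hne, dist_old v hne, dist_old _ (ne_of_mem _ (h.tail_mem v hv hvr))]
      exact h.dist_eq v hv hvr
  · rw [parent_old v (ne_of_mem v hv)]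
    exact h.rank_lt v hv hvr
  · rw [dist_old _ (ne_of_mem _ (h.scanned_tail_mem b hb))]
    have hle := h.dist_head_le b hb hb'
    rcases eq_or_ne (G.head b) (G.head a) with e | e
    · rw [e, dist_new]
      exact (hbetter (e ▸ h.scanned_head_mem b hb hb')).le.trans (e ▸ hle)
    · rwa [dist_old _ e]
  · rcases split v hv with rfl | ⟨hne, hv⟩
    · rw [dist_new]
      linarith
    · exact (h.le_dist v hv hvS).trans_eq (dist_old v hne).symm

theorem isShortestPathTree (h : G.DijkstraInvariant r L S D rank μ)
    (hS : ∀ v ∈ L.reached, v ∈ S) (hD : ∀ a ∈ G.arcs, G.tail a ∈ S → a ∈ D) :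
    G.IsShortestPathTree r L rank where
  root_mem := h.root_mem
  dist_root := h.dist_root
  parent_mem := h.parent_mem
  head_parent := h.head_parent
  tail_mem v hv hne := h.settled_subset _ (h.tail_mem v hv hne)
  dist_eq := h.dist_eq
  rank_lt v hv := h.rank_lt v (hS v hv)
  head_mem a ha ht := h.scanned_head_mem a (hD a ha (hS _ ht)) ha
  dist_head_le a ha ht := h.dist_head_le a (hD a ha (hS _ ht)) ha

end DijkstraInvariant

end ArcGraph

/-- An undirected network in which each link is given by its two directions, which are arcs that
`rev` exchanges. -/
structure ArcNetwork (V α : Type*) where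
  arcs : Finset α
  tail : α → V
  head : α → V
  rev : α → α
  cap : α → ℝ
  weight : α → ℝ
  rev_mem : ∀ a ∈ arcs, rev a ∈ arcs
  rev_rev : ∀ a ∈ arcs, rev (rev a) = a
  rev_ne : ∀ a ∈ arcs, rev a ≠ a
  tail_rev : ∀ a ∈ arcs, tail (rev a) = head a
  cap_rev : ∀ a ∈ arcs, cap (rev a) = cap a
  weight_rev : ∀ a ∈ arcs, weight (rev a) = weight a
  weight_nonneg : ∀ a ∈ arcs, 0 ≤ weight a

/-- The cost of sending `x` units along a link of weight `W` and `y` units against it, reduced by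
the difference `δ` of the potentials of its ends. -/
def linkCost (W δ : ℝ) (x y : ℕ) : ℝ :=
  (W - δ) * x + (W + δ) * y

theorem linkCost_neg (W δ : ℝ) (x y : ℕ) : linkCost W (-δ) x y = linkCost W δ y x := by
  simp only [linkCost]
  ring

theorem linkCost_zero_le {W δ c : ℝ} {v x y : ℕ} (hW : 0 ≤ W) (hback : 1 ≤ v → W + δ ≤ 0)
    (hforth : v = 0 → 1 ≤ c → 0 ≤ W - δ) (hmore : (v : ℝ) + 1 ≤ c → 0 ≤ W + δ)
    (hxy : (x + y : ℝ) ≤ c) : linkCost W δ 0 v ≤ linkCost W δ x y := by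
  have hx : (0 : ℝ) ≤ x := x.cast_nonneg
  have hy : (0 : ℝ) ≤ y := y.cast_nonneg
  simp only [linkCost, Nat.cast_zero, mul_zero, zero_add]
  rcases v.eq_zero_or_pos with rfl | hv
  · rw [Nat.cast_zero, mul_zero]
    rcases le_or_gt 1 c with hc | hc
    · exact add_nonneg (mul_nonneg (hforth rfl hc) hx) (mul_nonneg (hmore (by simpa using hc)) hy)
    · have hlt : x + y < 1 := by exact_mod_cast hxy.trans_lt hc
      obtain ⟨rfl, rfl⟩ : x = 0 ∧ y = 0 := by omega
      simp
  · have hback := hback hv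
    have hp : 0 ≤ (W - δ) * x := mul_nonneg (by linarith) hx
    suffices (W + δ) * v ≤ (W + δ) * y by linarith
    rcases le_or_gt ((v : ℝ) + 1) c with hc | hc
    · simp [hback.antisymm (hmore hc)]
    · have hlt : y < v + 1 := by exact_mod_cast (by linarith : (y : ℝ) < v + 1)
      exact mul_le_mul_of_nonpos_left (by exact_mod_cast Nat.lt_succ_iff.1 hlt) hback

namespace ArcNetwork

open Function

variable {V α : Type*} (G : ArcNetwork V α)

/-- The flow `g`, which need not be conserved anywhere, respects the capacities of the links. -/
def IsFeasible (g : α → ℕ) : Prop :=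
  ∀ a ∈ G.arcs, (g a + g (G.rev a) : ℝ) ≤ G.cap a

/-- The total weight of the flow `g`. -/
def cost (g : α → ℕ) : ℝ :=
  ∑ a ∈ G.arcs, G.weight a * g a

/-- The change of the potential `φ` along the flow `g`, that is, the sum over the vertices of `φ`
times the excess of `g`. -/
def gain (g : α → ℕ) (φ : V → ℝ) : ℝ :=
  ∑ a ∈ G.arcs, (g a : ℝ) * (φ (G.head a) - φ (G.tail a))

/-- For the weights reduced by the potential `π`, the flow `g` is of minimum cost on every single
link. -/
def IsLinkOptimal (π : V → ℝ) (g : α → ℕ) : Prop :=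
  ∀ a ∈ G.arcs, ∀ x y : ℕ, (x + y : ℝ) ≤ G.cap a →
    linkCost (G.weight a) (π (G.head a) - π (G.tail a)) (g a) (g (G.rev a)) ≤
      linkCost (G.weight a) (π (G.head a) - π (G.tail a)) x y

/-- One more unit can be sent along the arc `a`, possibly by cancelling one that is sent along its
reverse. -/
def HasResidual (g : α → ℕ) (a : α) : Prop :=
  1 ≤ g (G.rev a) ∨ (g a : ℝ) + 1 ≤ G.cap a

/-- The cost of one more unit along the arc `a`, reduced by the potential `π`. -/
def reducedCost (π : V → ℝ) (g : α → ℕ) (a : α) : ℝ :=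
  (if 1 ≤ g (G.rev a) then -G.weight a else G.weight a) + π (G.tail a) - π (G.head a)

/-- The residual network of the flow `g`, with the costs reduced by the potential `π`. -/
def residual (π : V → ℝ) (g : α → ℕ) : ArcGraph V α where
  arcs := {a | a ∈ G.arcs ∧ G.HasResidual g a}
  tail := G.tail
  head := G.head
  length := G.reducedCost π g

/-- Sends one unit of flow along the residual arc `a`. -/
def push [DecidableEq α] (g : α → ℕ) (a : α) : α → ℕ :=
  if 1 ≤ g (G.rev a) then update g (G.rev a) (g (G.rev a) - 1) else update g a (g a + 1)

/-- The same network with all weights zero. -/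
def unweighted : ArcNetwork V α :=
  { G with
    weight := 0
    weight_rev := fun _ _ => rfl
    weight_nonneg := fun _ _ => le_rfl }

variable {G} {a : α} {g y : α → ℕ} {π : V → ℝ}

theorem head_rev (ha : a ∈ G.arcs) : G.head (G.rev a) = G.tail a := by
  rw [← G.tail_rev _ (G.rev_mem a ha), G.rev_rev a ha]

theorem sum_comp_rev {M : Type*} [AddCommMonoid M] (F : α → M) :
    ∑ a ∈ G.arcs, F (G.rev a) = ∑ a ∈ G.arcs, F a :=
  Finset.sum_nbij' G.rev G.rev G.rev_mem G.rev_mem G.rev_rev G.rev_rev fun _ _ => rfl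

theorem gain_comp_rev (φ : V → ℝ) : G.gain (g ∘ G.rev) φ = -G.gain g φ := by
  rw [gain, gain, ← sum_comp_rev, ← Finset.sum_neg_distrib]
  refine Finset.sum_congr rfl fun a ha => ?_
  rw [comp_apply, G.tail_rev a ha, head_rev ha, G.rev_rev a ha]
  ring

@[simp] theorem gain_zero (φ : V → ℝ) : G.gain 0 φ = 0 := by
  simp [gain]

theorem isLinkOptimal_zero : G.IsLinkOptimal 0 0 := by
  intro a ha x y _
  have hweight := G.weight_nonneg a ha
  simp only [linkCost, Pi.zero_apply, Nat.cast_zero, sub_zero, add_zero, mul_zero]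
  positivity

theorem gain_add (φ : V → ℝ) : G.gain (g + y) φ = G.gain g φ + G.gain y φ := by
  simp only [gain, Pi.add_apply, Nat.cast_add, add_mul, Finset.sum_add_distrib]

theorem gain_congr (h : ∀ a ∈ G.arcs, g a = y a) (φ : V → ℝ) : G.gain g φ = G.gain y φ :=
  Finset.sum_congr rfl fun a ha => by rw [h a ha]

theorem gain_update [DecidableEq α] (ha : a ∈ G.arcs) (x : ℕ) (φ : V → ℝ) :
    G.gain (update g a x) φ =
      G.gain g φ + ((x : ℝ) - g a) * (φ (G.head a) - φ (G.tail a)) := by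
  rw [← sub_eq_iff_eq_add', gain, gain, ← Finset.sum_sub_distrib,
    Finset.sum_eq_single_of_mem a ha fun b _ hb => by simp [hb], update_self, sub_mul]

theorem isLinkOptimal_of_reducedCost_nonneg
    (h : ∀ a ∈ G.arcs, G.HasResidual g a → 0 ≤ G.reducedCost π g a) : G.IsLinkOptimal π g := by
  intro a ha x y hxy
  have hfwd := h a ha
  have hbwd := h (G.rev a) (G.rev_mem a ha)
  have hW := G.weight_nonneg a ha
  simp only [HasResidual, reducedCost, G.rev_rev a ha, G.cap_rev a ha, G.weight_rev a ha,
    G.tail_rev a ha, head_rev ha] at hfwd hbwd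
  generalize hδ : π (G.head a) - π (G.tail a) = δ
  rcases (g a).eq_zero_or_pos with hu | hu
  · rw [hu] at hfwd hbwd ⊢
    refine linkCost_zero_le hW (fun hv => ?_) (fun hv hc => ?_) (fun hc => ?_) hxy
    · have := hfwd (.inl hv)
      rw [if_pos hv] at this
      linarith
    · have := hfwd (.inr (by simpa using hc))
      rw [if_neg (by omega)] at this
      linarith
    · have := hbwd (.inr hc)
      rw [if_neg (by omega)] at this
      linarith
  have hu' := hbwd (.inl hu)
  rw [if_pos (Nat.succ_le_of_lt hu)] at hu'
  rcases (g (G.rev a)).eq_zero_or_pos with hv | hv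
  · rw [hv] at hfwd ⊢
    rw [← linkCost_neg _ _ 0, ← linkCost_neg _ _ y]
    refine linkCost_zero_le (c := G.cap a) hW (fun _ => by linarith)
      (fun hu0 => absurd hu0 hu.ne') (fun hc => ?_) (by linarith)
    have := hfwd (.inr hc)
    rw [if_neg (by omega)] at this
    linarith
  · have hv' := hfwd (.inl hv)
    rw [if_pos (Nat.succ_le_of_lt hv)] at hv'
    have hW0 : G.weight a = 0 := by linarith
    have hδ0 : δ = 0 := by linarith
    simp [linkCost, hW0, hδ0]

theorem IsLinkOptimal.reducedCost_nonneg (h : G.IsLinkOptimal π g) (hg : G.IsFeasible g)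
    (ha : a ∈ G.arcs) (hres : G.HasResidual g a) : 0 ≤ G.reducedCost π g a := by
  rw [reducedCost]
  split_ifs with hr
  · have hcast : ((g (G.rev a) - 1 : ℕ) : ℝ) = g (G.rev a) - 1 := by simp [Nat.cast_sub hr]
    have hle := h a ha (g a) (g (G.rev a) - 1) (by rw [hcast]; linarith [hg a ha])
    simp only [linkCost, hcast] at hle
    linarith
  · have hr0 : g (G.rev a) = 0 := by omega
    have hle := h a ha (g a + 1) 0 (by simpa using hres.resolve_left hr)
    simp only [linkCost, hr0, Nat.cast_add, Nat.cast_one, Nat.cast_zero] at hle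
    linarith

theorem sum_linkCost (g : α → ℕ) (π : V → ℝ) :
    ∑ a ∈ G.arcs, linkCost (G.weight a) (π (G.head a) - π (G.tail a)) (g a) (g (G.rev a)) =
      2 * (G.cost g - G.gain g π) := by
  have hrev := sum_comp_rev (G := G) fun a =>
    G.weight a * g a - (g a : ℝ) * (π (G.head a) - π (G.tail a))
  rw [cost, gain, ← Finset.sum_sub_distrib, two_mul]
  nth_rewrite 2 [← hrev]
  rw [← Finset.sum_add_distrib]
  refine Finset.sum_congr rfl fun a ha => ?_
  rw [G.weight_rev a ha, G.tail_rev a ha, head_rev ha, linkCost]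
  ring

theorem IsLinkOptimal.cost_sub_gain_le (h : G.IsLinkOptimal π g) (hy : G.IsFeasible y) :
    G.cost g - G.gain g π ≤ G.cost y - G.gain y π := by
  have hle := Finset.sum_le_sum fun a ha => h a ha (y a) (y (G.rev a)) (hy a ha)
  rw [sum_linkCost, sum_linkCost] at hle
  linarith

/-- A set of vertices that no residual arc leaves is a cut saturated by `g`: with all weights zero
and the indicator function of the complement as potential, `g` is optimal. -/
theorem gain_indicator_le_of_closed {X : Set V}
    (hX : ∀ a ∈ G.arcs, G.HasResidual g a → G.tail a ∈ X → G.head a ∈ X) (hy : G.IsFeasible y) :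
    G.gain y (Xᶜ.indicator 1) ≤ G.gain g (Xᶜ.indicator 1) := by
  classical
  have hopt : G.unweighted.IsLinkOptimal (Xᶜ.indicator 1) g := by
    refine isLinkOptimal_of_reducedCost_nonneg fun a ha hres => ?_
    have hX := hX a ha hres
    simp only [reducedCost, unweighted, Pi.zero_apply, neg_zero, ite_self, zero_add, sub_nonneg,
      Set.indicator_apply, Set.mem_compl_iff, Pi.one_apply]
    split_ifs <;> first | tauto | norm_num
  have hcost : ∀ z, G.unweighted.cost z = 0 := fun z => Finset.sum_eq_zero fun a _ => zero_mul _
  have hle := hopt.cost_sub_gain_le (y := y) hy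
  rw [hcost, hcost, zero_sub, zero_sub] at hle
  exact neg_le_neg_iff.1 hle

section Push

variable [DecidableEq α]

theorem push_of_ne {b : α} (h : b ≠ a) (h' : b ≠ G.rev a) : G.push g a b = g b := by
  rw [push]
  split_ifs
  exacts [update_of_ne h' _ _, update_of_ne h _ _]

theorem push_le (a b : α) : G.push g a b ≤ g b + 1 := by
  rw [push]
  split_ifs <;> rw [update_apply] <;> split_ifs with e <;> subst_vars <;> omega

/-- Cancelling a unit on the reverse of `a` and sending one along `a` change the difference of the
two values in the same way. -/
theorem push_self_sub_push_rev (ha : a ∈ G.arcs) :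
    (G.push g a a : ℝ) - G.push g a (G.rev a) = g a - g (G.rev a) + 1 := by
  rw [push]
  split_ifs with hr
  · rw [update_self, update_of_ne (G.rev_ne a ha).symm, Nat.cast_sub hr]
    push_cast
    ring
  · rw [update_self, update_of_ne (G.rev_ne a ha)]
    push_cast
    ring

theorem push_self_add_push_rev (ha : a ∈ G.arcs) :
    (G.push g a a : ℝ) + G.push g a (G.rev a) =
      g a + g (G.rev a) + if 1 ≤ g (G.rev a) then -1 else 1 := by
  rw [push]
  split_ifs with hr
  · rw [update_self, update_of_ne (G.rev_ne a ha).symm, Nat.cast_sub hr]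
    push_cast
    ring
  · rw [update_self, update_of_ne (G.rev_ne a ha)]
    push_cast
    ring

theorem gain_push (ha : a ∈ G.arcs) (φ : V → ℝ) :
    G.gain (G.push g a) φ = G.gain g φ + (φ (G.head a) - φ (G.tail a)) := by
  rw [push]
  split_ifs with hr
  · rw [gain_update (G.rev_mem a ha), G.tail_rev a ha, head_rev ha, Nat.cast_sub hr]
    push_cast
    ring
  · rw [gain_update ha]
    push_cast
    ring

/-- A property of the flow on single links is preserved by `push` if it is preserved on the link
that changes. -/
theorem forall_push (ha : a ∈ G.arcs) {R : α → ℕ → ℕ → Prop}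
    (hsymm : ∀ b ∈ G.arcs, ∀ x y, R b x y → R (G.rev b) y x)
    (h : ∀ b ∈ G.arcs, R b (g b) (g (G.rev b)))
    (hpush : R a (G.push g a a) (G.push g a (G.rev a))) :
    ∀ b ∈ G.arcs, R b (G.push g a b) (G.push g a (G.rev b)) := by
  intro b hb
  by_cases hba : b = a
  · rwa [hba]
  by_cases hbr : b = G.rev a
  · rw [hbr, G.rev_rev a ha]
    exact hsymm a ha _ _ hpush
  rw [push_of_ne hba hbr, push_of_ne]
  · exact h b hb
  · exact fun e => hbr (by rw [← e, G.rev_rev b hb])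
  · exact fun e => hba (by rw [← G.rev_rev b hb, e, G.rev_rev a ha])

theorem IsFeasible.push (hg : G.IsFeasible g) (ha : a ∈ G.arcs) (hres : G.HasResidual g a) :
    G.IsFeasible (G.push g a) := by
  refine forall_push ha (R := fun b x y => (x + y : ℝ) ≤ G.cap b) (fun b hb x y hxy => ?_) hg ?_
  · rwa [G.cap_rev b hb, add_comm]
  · rw [push_self_add_push_rev ha]
    split_ifs with hr
    · linarith [hg a ha]
    · rw [show g (G.rev a) = 0 by omega]
      push_cast
      linarith [hres.resolve_left hr]

theorem IsLinkOptimal.push (hg : G.IsLinkOptimal π g) (ha : a ∈ G.arcs)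
    (hcost : G.reducedCost π g a = 0) : G.IsLinkOptimal π (G.push g a) := by
  refine forall_push ha (R := fun b u v => ∀ x y : ℕ, (x + y : ℝ) ≤ G.cap b →
    linkCost (G.weight b) (π (G.head b) - π (G.tail b)) u v ≤
      linkCost (G.weight b) (π (G.head b) - π (G.tail b)) x y)
    (fun b hb u v huv x y hxy => ?_) hg fun x y hxy => le_trans (le_of_eq ?_) (hg a ha x y hxy)
  · rw [G.weight_rev b hb, G.tail_rev b hb, head_rev hb, ← neg_sub, linkCost_neg, linkCost_neg]
    exact huv y x (by rwa [← G.cap_rev b hb, add_comm])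
  · have hsub := push_self_sub_push_rev (g := g) ha
    have hadd := push_self_add_push_rev (g := g) ha
    rw [reducedCost] at hcost
    simp only [linkCost]
    split_ifs at hadd hcost <;> linear_combination
      G.weight a * hadd - (π (G.head a) - π (G.tail a)) * hsub + hcost

end Push

/-- The potential `π` raised by the distances in `L`, capped at `D`. -/
noncomputable def raise (π : V → ℝ) (L : PathLabels V α) (D : ℝ) (v : V) : ℝ :=
  open Classical in π v + if v ∈ L.reached ∧ L.dist v ≤ D then L.dist v else D

theorem raise_le_add_cap (π : V → ℝ) (L : PathLabels V α) (D : ℝ) (v : V) :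
    raise π L D v ≤ π v + D := by
  rw [raise]
  split_ifs with h
  · linarith [h.2]
  · exact le_rfl

theorem raise_le_add_dist {L : PathLabels V α} {D : ℝ} {v : V} (hv : v ∈ L.reached) :
    raise π L D v ≤ π v + L.dist v := by
  rw [raise]
  split_ifs with h
  · exact le_rfl
  · have hlt : ¬ L.dist v ≤ D := fun hle => h ⟨hv, hle⟩
    linarith

theorem reducedCost_raise (L : PathLabels V α) (D : ℝ) (a : α) :
    G.reducedCost (raise π L D) g a = G.reducedCost π g a +
      (raise π L D (G.tail a) - π (G.tail a)) - (raise π L D (G.head a) - π (G.head a)) := by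
  simp only [reducedCost]
  ring

section Tree

variable {r v : V} {L : PathLabels V α} {rank : V → ℕ} {D : ℝ}

theorem _root_.ArcGraph.IsShortestPathTree.reducedCost_raise_nonneg
    (hT : (G.residual π g).IsShortestPathTree r L rank) (ha : a ∈ G.arcs)
    (hres : G.HasResidual g a) (hcost : 0 ≤ G.reducedCost π g a) :
    0 ≤ G.reducedCost (raise π L D) g a := by
  rw [reducedCost_raise]
  by_cases h : G.tail a ∈ L.reached ∧ L.dist (G.tail a) ≤ D
  · have htail : raise π L D (G.tail a) = π (G.tail a) + L.dist (G.tail a) := by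
      rw [raise, if_pos h]
    have hhead := raise_le_add_dist (π := π) (D := D) (hT.head_mem a ⟨ha, hres⟩ h.1)
    have hle : L.dist (G.head a) ≤ L.dist (G.tail a) + G.reducedCost π g a :=
      hT.dist_head_le a ⟨ha, hres⟩ h.1
    simp only [residual] at hhead
    linarith
  · have htail : raise π L D (G.tail a) = π (G.tail a) + D := by rw [raise, if_neg h]
    linarith [raise_le_add_cap π L D (G.head a)]

theorem reducedCost_raise_eq_zero (htail : G.tail a ∈ L.reached) (hhead : G.head a ∈ L.reached)
    (htight : L.dist (G.head a) = L.dist (G.tail a) + G.reducedCost π g a)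
    (hcost : 0 ≤ G.reducedCost π g a) (hD : L.dist (G.head a) ≤ D) :
    G.reducedCost (raise π L D) g a = 0 := by
  have etail : raise π L D (G.tail a) = π (G.tail a) + L.dist (G.tail a) := by
    rw [raise, if_pos ⟨htail, by linarith⟩]
  have ehead : raise π L D (G.head a) = π (G.head a) + L.dist (G.head a) := by
    rw [raise, if_pos ⟨hhead, hD⟩]
  rw [reducedCost_raise, etail, ehead]
  linarith

theorem _root_.ArcGraph.IsShortestPathTree.isLinkOptimal_raise
    (hT : (G.residual π g).IsShortestPathTree r L rank) (hg : G.IsFeasible g)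
    (hopt : G.IsLinkOptimal π g) (D : ℝ) : G.IsLinkOptimal (raise π L D) g :=
  isLinkOptimal_of_reducedCost_nonneg fun _ ha hres =>
    hT.reducedCost_raise_nonneg ha hres (hopt.reducedCost_nonneg hg ha hres)

/-- The flow `g` in the course of the augmentation of `g₀` along a path that ends in `x`, followed
backwards: one unit has been sent along the part of the path from `v` on. Since `rank` increases
along the path, `g` still agrees with `g₀` before `v`. -/
structure IsPartialAugmentation (G : ArcNetwork V α) (π : V → ℝ) (rank : V → ℕ) (g₀ : α → ℕ)
    (x v : V) (g : α → ℕ) : Prop where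
  isFeasible : G.IsFeasible g
  isLinkOptimal : G.IsLinkOptimal π g
  gain_eq : ∀ φ, G.gain g φ = G.gain g₀ φ + (φ x - φ v)
  eq_of_rank_le : ∀ a ∈ G.arcs, rank (G.tail a) ≤ rank v → rank (G.head a) ≤ rank v → g a = g₀ a
  le_add_one : ∀ a ∈ G.arcs, g a ≤ g₀ a + 1

theorem IsPartialAugmentation.refl (hg : G.IsFeasible g) (hopt : G.IsLinkOptimal π g)
    (rank : V → ℕ) (x : V) : G.IsPartialAugmentation π rank g x x g where
  isFeasible := hg
  isLinkOptimal := hopt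
  gain_eq _ := by simp
  eq_of_rank_le _ _ _ _ := rfl
  le_add_one a _ := (g a).le_succ

theorem IsPartialAugmentation.push [DecidableEq α] {g₀ : α → ℕ} {x : V}
    (h : G.IsPartialAugmentation π rank g₀ x (G.head a) g) (ha : a ∈ G.arcs)
    (hrank : rank (G.tail a) < rank (G.head a)) (hres : G.HasResidual g₀ a)
    (hcost : G.reducedCost π g₀ a = 0) :
    G.IsPartialAugmentation π rank g₀ x (G.tail a) (G.push g a) := by
  have hga : g a = g₀ a := h.eq_of_rank_le a ha hrank.le le_rfl
  have hgr : g (G.rev a) = g₀ (G.rev a) := h.eq_of_rank_le _ (G.rev_mem a ha)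
    (G.tail_rev a ha ▸ le_rfl) (head_rev ha ▸ hrank.le)
  refine ⟨h.isFeasible.push ha (by rwa [HasResidual, hga, hgr]),
    h.isLinkOptimal.push ha (by rwa [reducedCost, hgr]), fun φ => ?_, fun b hb htail hhead => ?_,
    fun b hb => ?_⟩
  · rw [gain_push ha, h.gain_eq]
    ring
  · rw [push_of_ne, h.eq_of_rank_le b hb (htail.trans hrank.le) (hhead.trans hrank.le)]
    · rintro rfl
      exact hrank.not_ge hhead
    · rintro rfl
      exact hrank.not_ge (G.tail_rev a ha ▸ htail)
  · by_cases hb' : b = a ∨ b = G.rev a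
    · refine (push_le a b).trans (Nat.succ_le_succ ?_)
      rcases hb' with rfl | rfl
      exacts [hga.le, hgr.le]
    · rw [push_of_ne (fun e => hb' (.inl e)) fun e => hb' (.inr e)]
      exact h.le_add_one b hb

theorem IsPartialAugmentation.push_parent [DecidableEq α] {g₀ : α → ℕ} {x : V}
    (h : G.IsPartialAugmentation (raise π L D) rank g₀ x v g)
    (hT : (G.residual π g₀).IsShortestPathTree r L rank)
    (hcost : 0 ≤ G.reducedCost π g₀ (L.parent v)) (hv : v ∈ L.reached) (hvr : v ≠ r)
    (hD : L.dist v ≤ D) : G.IsPartialAugmentation (raise π L D) rank g₀ x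
      (G.tail (L.parent v)) (G.push g (L.parent v)) := by
  obtain ⟨ha, hres⟩ := hT.parent_mem v hv hvr
  have hhead : G.head (L.parent v) = v := hT.head_parent v hv hvr
  have hzero : G.reducedCost (raise π L D) g₀ (L.parent v) = 0 := by
    refine reducedCost_raise_eq_zero (hT.tail_mem v hv hvr) ?_ ?_ hcost ?_ <;> rw [hhead]
    exacts [hv, hT.dist_eq v hv hvr, hD]
  exact IsPartialAugmentation.push (hhead.symm ▸ h) ha
    (by rw [hhead]; exact hT.rank_lt v hv hvr) hres hzero

end Tree

end ArcNetwork

namespace ArcNetwork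

variable {V α : Type*} (G : ArcNetwork V α)

/-- The undirected link underlying the arc `a`. -/
def link (a : α) : Sym2 V :=
  s(G.tail a, G.head a)

/-- The arcs of the list form a path from `x` to `v`, which may repeat vertices and arcs. -/
def IsPath : V → List α → V → Prop
  | x, [], v => x = v
  | x, a :: l, v => a ∈ G.arcs ∧ G.tail a = x ∧ IsPath (G.head a) l v

/-- The `i`-th vertex of a path from `x` along the arcs `l`, counted from `0`. -/
def pathVertex (x : V) (l : List α) (i : ℕ) : V :=
  (x :: l.map G.head).getD i x

variable {G} {x v : V} {a : α} {l : List α}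

theorem link_eq_link_iff (hinj : ∀ a ∈ G.arcs, ∀ b ∈ G.arcs,
    G.tail a = G.tail b → G.head a = G.head b → a = b) {b : α} (hb : b ∈ G.arcs)
    (ha : a ∈ G.arcs) : G.link b = G.link a ↔ b = a ∨ b = G.rev a := by
  rw [link, link, Sym2.eq_iff]
  refine or_congr ⟨fun h => hinj b hb a ha h.1 h.2, ?_⟩
    ⟨fun h => hinj b hb _ (G.rev_mem a ha) ?_ ?_, ?_⟩
  · rintro rfl
    exact ⟨rfl, rfl⟩
  · rw [h.1, G.tail_rev a ha]
  · rw [h.2, head_rev ha]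
  · rintro rfl
    exact ⟨G.tail_rev a ha, head_rev ha⟩

theorem count_map_link [DecidableEq α] [DecidableEq (Sym2 V)]
    (hinj : ∀ a ∈ G.arcs, ∀ b ∈ G.arcs, G.tail a = G.tail b → G.head a = G.head b → a = b)
    (ha : a ∈ G.arcs) (hl : ∀ b ∈ l, b ∈ G.arcs) :
    (l.map G.link).count (G.link a) = l.count a + l.count (G.rev a) := by
  induction l with
  | nil => rfl
  | cons b l ih =>
    rw [List.forall_mem_cons] at hl
    simp only [List.map_cons, List.count_cons, ih hl.2, beq_iff_eq, link_eq_link_iff hinj hl.1 ha]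
    have hne := G.rev_ne a ha
    grind

namespace IsPath

theorem mem_arcs (h : G.IsPath x l v) : ∀ a ∈ l, a ∈ G.arcs := by
  induction l generalizing x with
  | nil => exact fun a ha => absurd ha List.not_mem_nil
  | cons b l ih => exact List.forall_mem_cons.2 ⟨h.1, ih h.2.2⟩

theorem concat (h : G.IsPath x l v) (ha : a ∈ G.arcs) (htail : G.tail a = v) :
    G.IsPath x (l ++ [a]) (G.head a) := by
  induction l generalizing x with
  | nil => exact ⟨ha, htail.trans (Eq.symm h), rfl⟩
  | cons b l ih => exact ⟨h.1, h.2.1, ih h.2.2⟩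

theorem sum_sub (h : G.IsPath x l v) (φ : V → ℝ) :
    (l.map fun a => φ (G.head a) - φ (G.tail a)).sum = φ v - φ x := by
  induction l generalizing x with
  | nil => simp [show x = v from h]
  | cons b l ih => rw [List.map_cons, List.sum_cons, ih h.2.2, h.2.1, add_comm, sub_add_sub_cancel]

end IsPath

theorem pathVertex_concat_of_le {i : ℕ} (hi : i ≤ l.length) :
    G.pathVertex x (l ++ [a]) i = G.pathVertex x l i := by
  rw [pathVertex, pathVertex, List.map_append, ← List.cons_append, List.getD_append]
  simpa using Nat.lt_succ_of_le hi

theorem pathVertex_concat_length : G.pathVertex x (l ++ [a]) (l.length + 1) = G.head a := by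
  rw [pathVertex, List.map_append, ← List.cons_append, List.getD_append_right] <;> simp

theorem sum_count_mul [DecidableEq α] (hl : ∀ a ∈ l, a ∈ G.arcs) (F : α → ℝ) :
    ∑ a ∈ G.arcs, (l.count a : ℝ) * F a = (l.map F).sum := by
  simp only [Finset.sum_list_map_count, ← nsmul_eq_mul]
  refine (Finset.sum_subset (fun a ha => hl a (List.mem_toFinset.1 ha)) fun a _ ha => ?_).symm
  rw [List.count_eq_zero_of_not_mem (mt List.mem_toFinset.2 ha), zero_smul]

theorem IsPath.gain_count [DecidableEq α] (h : G.IsPath x l v) (φ : V → ℝ) :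
    G.gain (fun a => l.count a) φ = φ v - φ x := by
  rw [gain, sum_count_mul h.mem_arcs, h.sum_sub]

theorem gain_single_nonneg [DecidableEq V] {g : α → ℕ}
    (h : ∀ a ∈ G.arcs, G.tail a = v → g a = 0) : 0 ≤ G.gain g (Pi.single v 1) := by
  refine Finset.sum_nonneg fun a ha => ?_
  by_cases e : G.tail a = v
  · simp [h a ha e]
  · rw [Pi.single_eq_of_ne e, sub_zero, Pi.single_apply]
    split_ifs <;> simp

/-- The arcs of the list `l` form a path from `x` to `v` along the flow `g`, and `g'` is what
remains of `g` without that path. -/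
structure IsTrail [DecidableEq α] (G : ArcNetwork V α) (g : α → ℕ) (x : V) (l : List α) (v : V)
    (g' : α → ℕ) : Prop where
  isPath : G.IsPath x l v
  rest_add_count : ∀ a ∈ G.arcs, g' a + l.count a = g a

namespace IsTrail

variable [DecidableEq α] {g g' : α → ℕ}

theorem nil (g : α → ℕ) (x : V) : G.IsTrail g x [] x g :=
  ⟨rfl, fun _ _ => rfl⟩

theorem concat (h : G.IsTrail g x l v g') (ha : a ∈ G.arcs) (htail : G.tail a = v)
    (hpos : 1 ≤ g' a) :
    G.IsTrail g x (l ++ [a]) (G.head a) (Function.update g' a (g' a - 1)) := by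
  refine ⟨h.isPath.concat ha htail, fun b hb => ?_⟩
  rw [← h.rest_add_count b hb, List.count_append]
  rcases eq_or_ne b a with rfl | hba
  · rw [Function.update_self, List.count_singleton_self]
    omega
  · rw [Function.update_of_ne hba, List.count_singleton, if_neg (by simpa using hba.symm), add_zero]

theorem sum_rest_add_length (h : G.IsTrail g x l v g') :
    ∑ a ∈ G.arcs, g' a + l.length = ∑ a ∈ G.arcs, g a := by
  have hlen := sum_count_mul h.isPath.mem_arcs fun _ => 1
  simp only [mul_one, List.map_const', List.sum_replicate, nsmul_eq_mul] at hlen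
  rw [← Finset.sum_congr rfl h.rest_add_count, Finset.sum_add_distrib]
  exact congrArg _ (by exact_mod_cast hlen.symm)

theorem gain_rest (h : G.IsTrail g x l v g') (φ : V → ℝ) :
    G.gain g' φ = G.gain g φ - (φ v - φ x) := by
  rw [← gain_congr h.rest_add_count, ← h.isPath.gain_count]
  exact (add_sub_cancel_right _ _).symm.trans (congrArg (· - _) (gain_add φ).symm)

theorem eq_of_stuck [DecidableEq V] {u : V} (h : G.IsTrail g x l v g')
    (hstuck : ∀ a ∈ G.arcs, G.tail a = v → g' a = 0)
    (hg : v ≠ u → G.gain g (Pi.single v 1) ≤ -(Pi.single v 1 : V → ℝ) x) : v = u := by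
  by_contra hne
  have hpos := gain_single_nonneg hstuck
  have hle := hg hne
  rw [h.gain_rest, Pi.single_eq_same] at hpos
  linarith

end IsTrail

end ArcNetwork

section Routes

open ArcNetwork

variable {W : Type} {V α : Type*}

/-- The arcs of `G` are the two directions of the links of `N`, whose vertices are embedded into
those of `G` by `ι`. -/
structure ArcNetwork.Represents (G : ArcNetwork V α) (N : Network W) (ι : W ↪ V) : Prop where
  exists_adj : ∀ a ∈ G.arcs, ∃ u v, G.tail a = ι u ∧ G.head a = ι v ∧ N.graph.Adj u v ∧
    G.cap a = N.cap s(u, v) ∧ G.weight a = N.weight s(u, v)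
  exists_arc : ∀ u v, N.graph.Adj u v → ∃ a ∈ G.arcs, G.tail a = ι u ∧ G.head a = ι v
  eq_of_ends : ∀ a ∈ G.arcs, ∀ b ∈ G.arcs, G.tail a = G.tail b → G.head a = G.head b → a = b

/-- The list `l` consists of the arcs of `G` along the walk `p`. -/
structure ArcNetwork.Traces (G : ArcNetwork V α) {N : Network W} (ι : W ↪ V) (l : List α)
    {x v : W} (p : N.graph.Walk x v) : Prop where
  isPath : G.IsPath (ι x) l (ι v)
  links_eq : p.edges.map (Sym2.map ι) = l.map G.link
  sum_weight : ((p.edges.map N.weight).sum : ℝ) = (l.map G.weight).sum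
  getVert_eq : ∀ i ≤ l.length, ι (p.getVert i) = G.pathVertex (ι x) l i

variable {G : ArcNetwork V α} {N : Network W} {ι : W ↪ V} {x v u : W} {l l' : List α} {a : α}

namespace ArcNetwork.Traces

theorem nil : G.Traces (N := N) ι [] (.nil : N.graph.Walk x x) where
  isPath := rfl
  links_eq := rfl
  sum_weight := by simp
  getVert_eq i hi := by
    obtain rfl : i = 0 := by simpa using hi
    rfl

theorem cons (hG : G.Represents N ι) (ha : a ∈ G.arcs) (htail : G.tail a = ι x)
    (hhead : G.head a = ι v) (hadj : N.graph.Adj x v) {p : N.graph.Walk v u}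
    (h : G.Traces ι l p) : G.Traces ι (a :: l) (.cons hadj p) where
  isPath := ⟨ha, htail, hhead ▸ h.isPath⟩
  links_eq := by simp [h.links_eq, link, htail, hhead]
  sum_weight := by
    obtain ⟨x', v', etail, ehead, -, -, hweight⟩ := hG.exists_adj a ha
    obtain rfl := ι.injective (htail.symm.trans etail)
    obtain rfl := ι.injective (hhead.symm.trans ehead)
    simp [hweight, h.sum_weight]
  getVert_eq i hi := by
    cases i with
    | zero => rfl
    | succ i =>
      rw [SimpleGraph.Walk.getVert_cons_succ, h.getVert_eq i (by simpa using hi)]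
      have hi : i < (ι v :: l.map G.head).length := by simpa using hi
      rw [pathVertex, pathVertex, List.map_cons, List.getD_cons_succ, hhead,
        List.getD_eq_getElem _ _ hi, List.getD_eq_getElem _ _ hi]

theorem length_eq {p : N.graph.Walk x v} (h : G.Traces ι l p) : p.length = l.length := by
  simpa using congrArg List.length h.links_eq

theorem count_edges [DecidableEq W] [DecidableEq α] (hG : G.Represents N ι) (ha : a ∈ G.arcs)
    (htail : G.tail a = ι x) (hhead : G.head a = ι v) {u u' : W} {p : N.graph.Walk u u'}
    (h : G.Traces ι l p) : p.edges.count s(x, v) = l.count a + l.count (G.rev a) := by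
  classical
  have hlink : Sym2.map ι s(x, v) = G.link a := by rw [link, htail, hhead, Sym2.map_mk]
  rw [← List.count_map_of_injective _ _ (Sym2.map.injective ι.injective), h.links_eq, hlink,
    count_map_link hG.eq_of_ends ha h.isPath.mem_arcs]

end ArcNetwork.Traces

namespace ArcNetwork.Represents

theorem exists_traces_of_walk (hG : G.Represents N ι) (p : N.graph.Walk x v) :
    ∃ l, G.Traces ι l p := by
  induction p with
  | nil => exact ⟨[], .nil⟩
  | cons hadj p ih =>
    obtain ⟨l, hl⟩ := ih
    obtain ⟨a, ha, htail, hhead⟩ := hG.exists_arc _ _ hadj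
    exact ⟨a :: l, .cons hG ha htail hhead hadj hl⟩

theorem exists_traces_of_isPath (hG : G.Represents N ι) (h : G.IsPath (ι x) l (ι v)) :
    ∃ p : N.graph.Walk x v, G.Traces ι l p := by
  induction l generalizing x with
  | nil =>
    obtain rfl := ι.injective h
    exact ⟨.nil, .nil⟩
  | cons a l ih =>
    obtain ⟨ha, htail, h⟩ := h
    obtain ⟨u, v', etail, ehead, hadj, -, -⟩ := hG.exists_adj a ha
    obtain rfl := ι.injective (htail.symm.trans etail)
    obtain ⟨p, hp⟩ := ih (ehead ▸ h)
    exact ⟨.cons hadj p, .cons hG ha htail ehead hadj hp⟩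

theorem isFeasible_zero (hG : G.Represents N ι) : G.IsFeasible 0 := by
  intro a ha
  obtain ⟨u, v, -, -, -, hcap, -⟩ := hG.exists_adj a ha
  simp [hcap]

end ArcNetwork.Represents

/-- The flow of a route from `s` via `w` to `t`, given by the arcs of its segments: the first
segment is reversed, so that the flow sends one unit each from `w` to `s` and to `t`. -/
def ArcNetwork.routeFlow [DecidableEq α] (G : ArcNetwork V α) (l l' : List α) : α → ℕ :=
  (fun a => l.count a) ∘ G.rev + fun a => l'.count a

variable {s w t : W} {R : Route N s w t}

theorem ArcNetwork.IsPath.gain_routeFlow [DecidableEq α] {x w v : V} (h : G.IsPath x l w)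
    (h' : G.IsPath w l' v) (φ : V → ℝ) :
    G.gain (G.routeFlow l l') φ = (φ x - φ w) + (φ v - φ w) := by
  rw [routeFlow, gain_add, gain_comp_rev, h.gain_count, h'.gain_count, neg_sub]

namespace Route

theorem cost_routeFlow [DecidableEq α] (h : G.Traces ι l R.first) (h' : G.Traces ι l' R.second) :
    G.cost (G.routeFlow l l') = R.length := by
  have hsplit : ∀ a ∈ G.arcs, G.weight a * (G.routeFlow l l' a : ℝ) =
      l.count (G.rev a) * G.weight (G.rev a) + l'.count a * G.weight a := fun a ha => by
    rw [G.weight_rev a ha, routeFlow, Pi.add_apply, Function.comp_apply]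
    push_cast
    ring
  rw [cost, Finset.sum_congr rfl hsplit, Finset.sum_add_distrib,
    sum_comp_rev fun a => (l.count a : ℝ) * G.weight a, sum_count_mul h.isPath.mem_arcs,
    sum_count_mul h'.isPath.mem_arcs, ← h.sum_weight, ← h'.sum_weight, length, links,
    List.map_append, List.sum_append, NNReal.coe_add]

theorem exists_traces (hG : G.Represents N ι) (R : Route N s w t) :
    ∃ l l', G.Traces ι l R.first ∧ G.Traces ι l' R.second := by
  obtain ⟨l, hl⟩ := hG.exists_traces_of_walk R.first
  obtain ⟨l', hl'⟩ := hG.exists_traces_of_walk R.second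
  exact ⟨l, l', hl, hl'⟩

variable [DecidableEq W]

theorem count_links [DecidableEq α] (hG : G.Represents N ι) (h : G.Traces ι l R.first)
    (h' : G.Traces ι l' R.second) (ha : a ∈ G.arcs) (htail : G.tail a = ι x)
    (hhead : G.head a = ι v) :
    R.links.count s(x, v) = G.routeFlow l l' a + G.routeFlow l l' (G.rev a) := by
  rw [links, List.count_append, h.count_edges hG ha htail hhead, h'.count_edges hG ha htail hhead]
  simp only [routeFlow, Pi.add_apply, Function.comp_apply, G.rev_rev a ha]
  ring

theorem feasible_iff_isFeasible_routeFlow [DecidableEq α] (hG : G.Represents N ι)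
    (h : G.Traces ι l R.first) (h' : G.Traces ι l' R.second) :
    R.Feasible ↔ G.IsFeasible (G.routeFlow l l') := by
  constructor
  · intro hR a ha
    obtain ⟨u, v, htail, hhead, hadj, hcap, -⟩ := hG.exists_adj a ha
    rw [hcap, ← Nat.cast_add, ← count_links hG h h' ha htail hhead]
    exact_mod_cast hR s(u, v) hadj
  · intro hR e he
    induction e with
    | _ u v =>
      obtain ⟨a, ha, htail, hhead⟩ := hG.exists_arc u v he
      obtain ⟨u', v', etail, ehead, -, hcap, -⟩ := hG.exists_adj a ha
      obtain rfl := ι.injective (htail.symm.trans etail)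
      obtain rfl := ι.injective (hhead.symm.trans ehead)
      have hle := hR a ha
      rw [hcap, ← Nat.cast_add, ← count_links hG h h' ha htail hhead] at hle
      exact_mod_cast hle

theorem not_exists_feasible_of_closed (hG : G.Represents N ι) {X : Set V} {g : α → ℕ}
    (hX : ∀ a ∈ G.arcs, G.HasResidual g a → G.tail a ∈ X → G.head a ∈ X) (hw : ι w ∈ X)
    (hg : G.gain g (Xᶜ.indicator 1) < Xᶜ.indicator 1 (ι s) + Xᶜ.indicator 1 (ι t)) :
    ¬ ∃ R : Route N s w t, R.Feasible := by
  classical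
  rintro ⟨R, hR⟩
  obtain ⟨l, l', h, h'⟩ := exists_traces hG R
  have hle := gain_indicator_le_of_closed hX ((feasible_iff_isFeasible_routeFlow hG h h').1 hR)
  rw [h.isPath.gain_routeFlow h'.isPath, Set.indicator_of_notMem (a := ι w) (not_not.2 hw)] at hle
  linarith

theorem isShortest_of_le [DecidableEq α] (hG : G.Represents N ι) {g : α → ℕ} {π : V → ℝ}
    (hopt : G.IsLinkOptimal π g) (hcap : G.IsFeasible g)
    (hgain : ∀ φ, G.gain g φ = (φ (ι s) - φ (ι w)) + (φ (ι t) - φ (ι w)))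
    (h : G.Traces ι l R.first) (h' : G.Traces ι l' R.second)
    (hle : ∀ a ∈ G.arcs, G.routeFlow l l' a ≤ g a) : R.IsShortest := by
  refine ⟨(feasible_iff_isFeasible_routeFlow hG h h').2 fun a ha => le_trans ?_ (hcap a ha),
    fun R' hR' => ?_⟩
  · exact_mod_cast Nat.add_le_add (hle a ha) (hle _ (G.rev_mem a ha))
  · obtain ⟨k, k', hk, hk'⟩ := exists_traces hG R'
    have hcost := hopt.cost_sub_gain_le ((feasible_iff_isFeasible_routeFlow hG hk hk').1 hR')
    rw [hgain, hk.isPath.gain_routeFlow hk'.isPath, cost_routeFlow hk hk'] at hcost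
    have hroute : (R.length : ℝ) ≤ G.cost g := by
      rw [← cost_routeFlow h h']
      exact Finset.sum_le_sum fun a ha => mul_le_mul_of_nonneg_left
        (by exact_mod_cast hle a ha) (G.weight_nonneg a ha)
    exact_mod_cast (by linarith : (R.length : ℝ) ≤ R'.length)

end Route

namespace ArcNetwork.IsTrail

variable [DecidableEq α] {g g' g'' : α → ℕ} {x w t v : V}

theorem routeFlow_le (h : G.IsTrail (g ∘ G.rev) x l w g')
    (h' : G.IsTrail (g' ∘ G.rev) w l' t g'') (ha : a ∈ G.arcs) : G.routeFlow l l' a ≤ g a := by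
  have hrest := h.rest_add_count _ (G.rev_mem a ha)
  have hrest' := h'.rest_add_count a ha
  simp only [Function.comp_apply, G.rev_rev a ha] at hrest hrest'
  simp only [routeFlow, Pi.add_apply, Function.comp_apply]
  omega

theorem eq_of_stuck_of_comp_rev (h : G.IsTrail (g ∘ G.rev) x l v g')
    (hgain : ∀ φ, G.gain g φ = (φ x - φ w) + (φ t - φ w))
    (hstuck : ∀ a ∈ G.arcs, G.tail a = v → g' a = 0) : v = w := by
  classical
  refine h.eq_of_stuck hstuck fun hne => ?_
  have ht : 0 ≤ (Pi.single v 1 : V → ℝ) t :=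
    (Pi.single_nonneg.2 zero_le_one : (0 : V → ℝ) ≤ Pi.single v 1) t
  rw [gain_comp_rev, hgain, Pi.single_eq_of_ne' hne]
  linarith

theorem eq_of_stuck_of_rest (h : G.IsTrail (g ∘ G.rev) x l w g')
    (hgain : ∀ φ, G.gain g φ = (φ x - φ w) + (φ t - φ w))
    (h' : G.IsTrail (g' ∘ G.rev) w l' v g'')
    (hstuck : ∀ a ∈ G.arcs, G.tail a = v → g'' a = 0) : v = t := by
  classical
  refine h'.eq_of_stuck hstuck fun hne => ?_
  rw [gain_comp_rev, h.gain_rest, gain_comp_rev, hgain, Pi.single_eq_of_ne' hne]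
  linarith

end ArcNetwork.IsTrail

theorem Route.exists_isShortest_of_isTrail [DecidableEq W] [DecidableEq α] (hG : G.Represents N ι)
    {g g' g'' : α → ℕ} {π : V → ℝ} (hopt : G.IsLinkOptimal π g) (hcap : G.IsFeasible g)
    (hgain : ∀ φ, G.gain g φ = (φ (ι s) - φ (ι w)) + (φ (ι t) - φ (ι w)))
    (h : G.IsTrail (g ∘ G.rev) (ι s) l (ι w) g')
    (h' : G.IsTrail (g' ∘ G.rev) (ι w) l' (ι t) g'') :
    ∃ R : Route N s w t, R.IsShortest ∧ G.Traces ι l R.first ∧ G.Traces ι l' R.second := by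
  obtain ⟨p, hp⟩ := hG.exists_traces_of_isPath h.isPath
  obtain ⟨q, hq⟩ := hG.exists_traces_of_isPath h'.isPath
  exact ⟨⟨p, q⟩, isShortest_of_le hG hopt hcap hgain hp hq fun a ha => h.routeFlow_le h' ha, hp, hq⟩

end Routes

section RunningTime

variable {n m : ℕ}

theorem natLog_div_add_two_le_logb (hn : 1 ≤ n) (hm : 1 ≤ m) :
    (Nat.log (m / n + 2) n : ℝ) ≤ Real.logb (1 + m / n) n := by
  have hnR : (1 : ℝ) ≤ n := by exact_mod_cast hn
  have hx : (0 : ℝ) < m / n := by positivity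
  have hd : (1 + m / n : ℝ) ≤ ((m / n + 2 : ℕ) : ℝ) := by
    have hlt := (Nat.lt_floor_add_one (m / n : ℝ)).le
    rw [Nat.floor_div_natCast, Nat.floor_natCast] at hlt
    push_cast
    linarith
  refine (Real.natLog_le_logb n (m / n + 2)).trans ?_
  exact div_le_div_of_nonneg_left (Real.log_nonneg hnR) (Real.log_pos (by linarith))
    (Real.log_le_log (by linarith) hd)

theorem half_le_logb_one_add_div (hn : 2 ≤ n) (hm : 1 ≤ m) (hmn : m ≤ n * n) :
    1 / 2 ≤ Real.logb (1 + m / n) n := by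
  have hnR : (2 : ℝ) ≤ n := by exact_mod_cast hn
  have hx : (0 : ℝ) < m / n := by positivity
  have hle : (m / n : ℝ) ≤ n := by
    rw [div_le_iff₀ (by linarith)]
    exact_mod_cast hmn
  rw [Real.logb, div_le_div_iff₀ two_pos (Real.log_pos (by linarith)), one_mul, mul_comm]
  have hlog := Real.log_le_log (by linarith) (show (1 + m / n : ℝ) ≤ (n : ℝ) ^ 2 by nlinarith)
  rwa [Real.log_pow, Nat.cast_ofNat] at hlog

theorem mul_log_le_mul_logb (hn : 1 ≤ n) (hm : 1 ≤ m) :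
    n * Real.log n ≤ m * Real.logb (1 + m / n) n := by
  have hnR : (1 : ℝ) ≤ n := by exact_mod_cast hn
  have hx : (0 : ℝ) < m / n := by positivity
  have hle : Real.log (1 + m / n) ≤ m / n := by
    linarith [Real.log_le_sub_one_of_pos (show (0 : ℝ) < 1 + m / n by linarith)]
  rw [le_div_iff₀ (by linarith)] at hle
  rw [Real.logb, ← mul_div_assoc, le_div_iff₀ (Real.log_pos (by linarith))]
  nlinarith [Real.log_nonneg hnR]

theorem natLog_two_add_two_le (hn : 2 ≤ n) : (Nat.log 2 n + 2 : ℝ) ≤ 6 * Real.log n := by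
  have hlog_two : 1 / 2 < Real.log 2 := by linarith [Real.log_two_gt_d9]
  have hlog : Real.log 2 ≤ Real.log n := Real.log_le_log two_pos (by exact_mod_cast hn)
  have hle : (Nat.log 2 n : ℝ) ≤ 2 * Real.log n := by
    refine (Real.natLog_le_logb n 2).trans ?_
    rw [Nat.cast_ofNat, Real.logb, div_le_iff₀ (by linarith)]
    nlinarith
  linarith

theorem add_mul_natLog_add_two_le (hn : 2 ≤ n) (hm : 1 ≤ m) (hmn : m ≤ n * n) :
    (((n + m) * (Nat.log (m / n + 2) n + 2) : ℕ) : ℝ) ≤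
      12 * (m * Real.logb (1 + m / n) n) := by
  push_cast
  rcases le_or_gt n m with hdense | hsparse
  · have hlog := natLog_div_add_two_le_logb (n := n) (by omega) hm
    have hhalf := half_le_logb_one_add_div hn hm hmn
    have hnm : (n : ℝ) ≤ m := by exact_mod_cast hdense
    set L := Real.logb (1 + m / n) n
    calc ((n : ℝ) + m) * (Nat.log (m / n + 2) n + 2) ≤ (2 * m) * (6 * L) :=
          mul_le_mul (by linarith) (by linarith) (by positivity) (by positivity)
      _ = 12 * (m * L) := by ring
  · have hlog := natLog_two_add_two_le hn
    have hnm : (m : ℝ) ≤ n := by exact_mod_cast hsparse.le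
    rw [Nat.div_eq_of_lt hsparse, zero_add]
    calc ((n : ℝ) + m) * (Nat.log 2 n + 2) ≤ (2 * n) * (6 * Real.log n) :=
          mul_le_mul (by linarith) hlog (by positivity) (by positivity)
      _ = 12 * (n * Real.log n) := by ring
      _ ≤ 12 * (m * Real.logb (1 + m / n) n) :=
          mul_le_mul_of_nonneg_left (mul_log_le_mul_logb (by omega) hm) (by norm_num)

end RunningTime

namespace IsLinkList

variable {n m : ℕ} {N : Network (Fin n)} {ends : Fin m → Fin n × Fin n}

theorem adj (h : IsLinkList N ends) (i : Fin m) : N.graph.Adj (ends i).1 (ends i).2 := by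
  have hmem : s((ends i).1, (ends i).2) ∈ N.graph.edgeSet := h.range_eq ▸ ⟨i, rfl⟩
  simpa using hmem

theorem adj_of_eq (h : IsLinkList N ends) {u v : Fin n} {i : Fin m}
    (he : s(u, v) = s((ends i).1, (ends i).2)) : N.graph.Adj u v := by
  rw [← SimpleGraph.mem_edgeSet, he]
  exact h.adj i

theorem le_mul_self (h : IsLinkList N ends) : m ≤ n * n := by
  have hinj : Function.Injective ends := fun i j hij => h.injective (by simp only [hij])
  simpa using Fintype.card_le_of_injective ends hinj

theorem two_le (h : IsLinkList N ends) (hm : 1 ≤ m) : 2 ≤ n := by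
  have hne := (h.adj ⟨0, hm⟩).ne
  rw [Ne, Fin.ext_iff] at hne
  have := (ends ⟨0, hm⟩).1.isLt
  have := (ends ⟨0, hm⟩).2.isLt
  omega

end IsLinkList

namespace RAM

infixr:65 " ;; " => Cmd.seq

namespace Cmd

/-- Whether the program may write to the word register `x`. -/
def writesN (x : ℕ) : Cmd → Bool
  | setN y _ => x == y
  | seq P Q => P.writesN x || Q.writesN x
  | ite _ P Q => P.writesN x || Q.writesN x
  | loop _ P => P.writesN x
  | _ => false

/-- Whether the program may write to the word array `a`. -/
def storesN (a : ℕ) : Cmd → Bool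
  | storeN b _ _ => a == b
  | seq P Q => P.storesN a || Q.storesN a
  | ite _ P Q => P.storesN a || Q.storesN a
  | loop _ P => P.storesN a
  | _ => false

/-- Whether the program may write to the real array `a`. -/
def storesR (a : ℕ) : Cmd → Bool
  | storeR b _ _ => a == b
  | seq P Q => P.storesR a || Q.storesR a
  | ite _ P Q => P.storesR a || Q.storesR a
  | loop _ P => P.storesR a
  | _ => false

/-- An upper bound for the running time of a program without loops. -/
def maxCost : Cmd → ℕ
  | skip => 1
  | setN _ e => e.cost + 1
  | setR _ e => e.cost + 1
  | storeN _ i e => i.cost + e.cost + 1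
  | storeR _ i e => i.cost + e.cost + 1
  | seq P Q => P.maxCost + Q.maxCost
  | ite b P Q => b.cost + 1 + (P.maxCost + Q.maxCost)
  | loop _ _ => 0

/-- The weakest precondition for the program, which must be free of loops, to run without overflow
and to establish `Q`. -/
def wp (B : ℕ) : Cmd → (State → Prop) → State → Prop
  | skip, Q, σ => Q σ
  | setN x e, Q, σ => e.Fits B σ ∧ Q (σ.setN x (e.eval σ))
  | setR x e, Q, σ => e.Fits B σ ∧ Q (σ.setR x (e.eval σ))
  | storeN a i e, Q, σ => i.Fits B σ ∧ e.Fits B σ ∧ Q (σ.storeN a (i.eval σ) (e.eval σ))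
  | storeR a i e, Q, σ => i.Fits B σ ∧ e.Fits B σ ∧ Q (σ.storeR a (i.eval σ) (e.eval σ))
  | seq P R, Q, σ => P.wp B (fun τ => R.wp B Q τ) σ
  | ite b P R, Q, σ => b.Fits B σ ∧ (b.Holds σ → P.wp B Q σ) ∧ (¬ b.Holds σ → R.wp B Q σ)
  | loop _ _, _, _ => False

/-- Runs `P` for the values `0, 1, …` of the word register `x` which are less than the content of
the word register `y`. -/
def forBelow (x y : ℕ) (P : Cmd) : Cmd :=
  .setN x (.lit 0) ;; .loop (.not (.nle (.reg y) (.reg x))) (P ;; .setN x (.add (.reg x) (.lit 1)))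

end Cmd

/-- The memory which `P` does not write to is the same in `σ` and `τ`. -/
structure Frame (P : Cmd) (σ τ : State) : Prop where
  nreg : ∀ x, P.writesN x = false → τ.nreg x = σ.nreg x
  narr : ∀ a, P.storesN a = false → τ.narr a = σ.narr a
  rarr : ∀ a, P.storesR a = false → τ.rarr a = σ.rarr a

theorem Frame.refl (P : Cmd) (σ : State) : Frame P σ σ :=
  ⟨fun _ _ => rfl, fun _ _ => rfl, fun _ _ => rfl⟩

theorem Frame.trans {P : Cmd} {σ τ υ : State} (h : Frame P σ τ) (h' : Frame P τ υ) :
    Frame P σ υ :=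
  ⟨fun x hx => (h'.nreg x hx).trans (h.nreg x hx), fun x hx => (h'.narr x hx).trans (h.narr x hx),
    fun x hx => (h'.rarr x hx).trans (h.rarr x hx)⟩

theorem Frame.mono {P Q : Cmd} {σ τ : State} (h : Frame P σ τ)
    (hN : ∀ x, Q.writesN x = false → P.writesN x = false)
    (hA : ∀ x, Q.storesN x = false → P.storesN x = false)
    (hR : ∀ x, Q.storesR x = false → P.storesR x = false) : Frame Q σ τ :=
  ⟨fun x hx => h.nreg x (hN x hx), fun x hx => h.narr x (hA x hx), fun x hx => h.rarr x (hR x hx)⟩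

theorem Exec.frame {B : ℕ} {P : Cmd} {σ τ : State} {T : ℕ} (h : Exec B P σ T τ) :
    Frame P σ τ := by
  induction h with
  | skip σ => exact Frame.refl _ _
  | setN σ x e _ =>
    refine ⟨fun y hy => ?_, fun _ _ => rfl, fun _ _ => rfl⟩
    simp only [Cmd.writesN, beq_eq_false_iff_ne] at hy
    simp [State.setN, Function.update_of_ne hy]
  | setR σ x e _ => exact ⟨fun _ _ => rfl, fun _ _ => rfl, fun _ _ => rfl⟩
  | storeN σ a i e _ _ =>
    refine ⟨fun _ _ => rfl, fun y hy => ?_, fun _ _ => rfl⟩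
    simp only [Cmd.storesN, beq_eq_false_iff_ne] at hy
    simp [State.storeN, Function.update_of_ne hy]
  | storeR σ a i e _ _ =>
    refine ⟨fun _ _ => rfl, fun _ _ => rfl, fun y hy => ?_⟩
    simp only [Cmd.storesR, beq_eq_false_iff_ne] at hy
    simp [State.storeR, Function.update_of_ne hy]
  | seq _ _ ih ih' =>
    refine (ih.mono ?_ ?_ ?_).trans (ih'.mono ?_ ?_ ?_) <;>
      simp +contextual [Cmd.writesN, Cmd.storesN, Cmd.storesR]
  | ite_true _ _ _ ih =>
    refine ih.mono ?_ ?_ ?_ <;> simp +contextual [Cmd.writesN, Cmd.storesN, Cmd.storesR]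
  | ite_false _ _ _ ih =>
    refine ih.mono ?_ ?_ ?_ <;> simp +contextual [Cmd.writesN, Cmd.storesN, Cmd.storesR]
  | loop_true _ _ _ _ ih ih' =>
    refine (ih.mono ?_ ?_ ?_).trans ih' <;>
      simp +contextual [Cmd.writesN, Cmd.storesN, Cmd.storesR]
  | loop_false _ _ => exact Frame.refl _ _

/-- Started in `σ`, the program halts within `T` steps in a state which satisfies `Q`. -/
def Runs (B : ℕ) (P : Cmd) (σ : State) (T : ℕ) (Q : State → Prop) : Prop :=
  ∃ T' ≤ T, ∃ τ, Exec B P σ T' τ ∧ Q τ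

namespace Runs

variable {B : ℕ} {P P' : Cmd} {b : BExpr} {σ : State} {T T' : ℕ} {Q Q' : State → Prop}

theorem mono (h : Runs B P σ T Q) (hT : T ≤ T') (hQ : ∀ τ, Frame P σ τ → Q τ → Q' τ) :
    Runs B P σ T' Q' := by
  obtain ⟨U, hU, τ, he, hq⟩ := h
  exact ⟨U, hU.trans hT, τ, he, hQ τ he.frame hq⟩

theorem seq (h : Runs B P σ T Q) (h' : ∀ τ, Frame P σ τ → Q τ → Runs B P' τ T' Q') :
    Runs B (P ;; P') σ (T + T') Q' := by
  obtain ⟨U, hU, τ, he, hq⟩ := h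
  obtain ⟨U', hU', υ, he', hq'⟩ := h' τ he.frame hq
  exact ⟨U + U', add_le_add hU hU', υ, he.seq he', hq'⟩

theorem of_wp (h : P.wp B Q σ) : Runs B P σ P.maxCost Q := by
  induction P generalizing σ Q with
  | skip => exact ⟨_, le_rfl, _, .skip σ, h⟩
  | setN x e => exact ⟨_, le_rfl, _, .setN σ x e h.1, h.2⟩
  | setR x e => exact ⟨_, le_rfl, _, .setR σ x e h.1, h.2⟩
  | storeN a i e => exact ⟨_, le_rfl, _, .storeN σ a i e h.1 h.2.1, h.2.2⟩
  | storeR a i e => exact ⟨_, le_rfl, _, .storeR σ a i e h.1 h.2.1, h.2.2⟩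
  | seq P R ih ih' => exact (ih h).seq fun τ _ hτ => ih' hτ
  | ite b P R ih ih' =>
    by_cases hb : b.Holds σ
    · obtain ⟨U, hU, τ, he, hq⟩ := ih (h.2.1 hb)
      exact ⟨_, by simp only [Cmd.maxCost]; omega, τ, .ite_true h.1 hb he, hq⟩
    · obtain ⟨U, hU, τ, he, hq⟩ := ih' (h.2.2 hb)
      exact ⟨_, by simp only [Cmd.maxCost]; omega, τ, .ite_false h.1 hb he, hq⟩
  | loop b P => exact h.elim

theorem le (h : Runs B P σ T Q) (hT : T ≤ T') : Runs B P σ T' Q :=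
  h.mono hT fun _ _ hQ => hQ

theorem skip (hT : 1 ≤ T) (h : Q σ) : Runs B .skip σ T Q :=
  (of_wp (P := .skip) h).le hT

theorem wp_seq (h : P.wp B (fun τ => Runs B P' τ T Q) σ) :
    Runs B (P ;; P') σ (P.maxCost + T) Q :=
  (of_wp h).seq fun _ _ hτ => hτ

theorem ite (hf : b.Fits B σ) (h : b.Holds σ → Runs B P σ T Q)
    (h' : ¬ b.Holds σ → Runs B P' σ T Q) : Runs B (.ite b P P') σ (b.cost + 1 + T) Q := by
  by_cases hb : b.Holds σ
  · obtain ⟨U, hU, τ, he, hq⟩ := h hb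
    exact ⟨_, by omega, τ, .ite_true hf hb he, hq⟩
  · obtain ⟨U, hU, τ, he, hq⟩ := h' hb
    exact ⟨_, by omega, τ, .ite_false hf hb he, hq⟩

/-- The loop rule: `I k τ` is an invariant, which includes that `k` further steps suffice. -/
theorem loop (I : ℕ → State → Prop)
    (hI : ∀ k τ, Frame P σ τ → I k τ → b.Fits B τ ∧
      (b.Holds τ → ∃ c, Runs B P τ c fun υ => ∃ k', b.cost + 1 + c + k' ≤ k ∧ I k' υ) ∧
      (¬ b.Holds τ → Q τ))
    {k : ℕ} (h : I k σ) : Runs B (.loop b P) σ (k + (b.cost + 1)) Q := by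
  suffices H : ∀ k τ, Frame P σ τ → I k τ → Runs B (.loop b P) τ (k + (b.cost + 1)) Q from
    H k σ (Frame.refl _ _) h
  intro k
  induction k using Nat.strong_induction_on with
  | _ k ih =>
    intro τ hF hτ
    obtain ⟨hf, ht, hq⟩ := hI k τ hF hτ
    by_cases hb : b.Holds τ
    · obtain ⟨c, U, hU, υ, he, k', hk, hυ⟩ := ht hb
      obtain ⟨U', hU', ρ, he', hq'⟩ := ih k' (by omega) υ (hF.trans he.frame) hυ
      exact ⟨_, by omega, ρ, .loop_true hf hb he he', hq'⟩
    · exact ⟨_, by omega, τ, .loop_false hf hb, hq hb⟩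

theorem loop_const (I : ℕ → State → Prop) (c : ℕ)
    (hI : ∀ k τ, Frame P σ τ → I k τ → b.Fits B τ ∧
      (b.Holds τ → Runs B P τ c fun υ => ∃ k', k' + 1 ≤ k ∧ I k' υ) ∧
      (¬ b.Holds τ → Q τ))
    {k : ℕ} (h : I k σ) :
    Runs B (.loop b P) σ (k * (b.cost + 1 + c) + (b.cost + 1)) Q := by
  refine loop (fun j τ => ∃ i, i * (b.cost + 1 + c) = j ∧ I i τ) ?_ ⟨k, rfl, h⟩
  rintro _ τ hF ⟨i, rfl, hi⟩
  obtain ⟨hf, ht, hq⟩ := hI i τ hF hi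
  refine ⟨hf, fun hb => ⟨c, (ht hb).mono le_rfl ?_⟩, hq⟩
  rintro υ - ⟨k', hk', h'⟩
  refine ⟨_, ?_, k', rfl, h'⟩
  calc b.cost + 1 + c + k' * (b.cost + 1 + c) = (k' + 1) * (b.cost + 1 + c) := by ring
    _ ≤ i * (b.cost + 1 + c) := Nat.mul_le_mul_right _ hk'

end Runs

namespace State

variable (σ : State) (x y a i v : ℕ) (r : ℝ)

@[simp] theorem setN_nreg : (σ.setN x v).nreg y = if y = x then v else σ.nreg y := by
  simp [setN, Function.update_apply]
@[simp] theorem setN_rreg : (σ.setN x v).rreg = σ.rreg := rfl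
@[simp] theorem setN_narr : (σ.setN x v).narr = σ.narr := rfl
@[simp] theorem setN_rarr : (σ.setN x v).rarr = σ.rarr := rfl
@[simp] theorem setR_nreg : (σ.setR x r).nreg = σ.nreg := rfl
@[simp] theorem setR_rreg : (σ.setR x r).rreg y = if y = x then r else σ.rreg y := by
  simp [setR, Function.update_apply]
@[simp] theorem setR_narr : (σ.setR x r).narr = σ.narr := rfl
@[simp] theorem setR_rarr : (σ.setR x r).rarr = σ.rarr := rfl
@[simp] theorem storeN_nreg : (σ.storeN a i v).nreg = σ.nreg := rfl
@[simp] theorem storeN_rreg : (σ.storeN a i v).rreg = σ.rreg := rfl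
@[simp] theorem storeN_narr : (σ.storeN a i v).narr y =
    if y = a then Function.update (σ.narr a) i v else σ.narr y := by
  simp [storeN, Function.update_apply]
@[simp] theorem storeN_rarr : (σ.storeN a i v).rarr = σ.rarr := rfl
@[simp] theorem storeR_nreg : (σ.storeR a i r).nreg = σ.nreg := rfl
@[simp] theorem storeR_rreg : (σ.storeR a i r).rreg = σ.rreg := rfl
@[simp] theorem storeR_narr : (σ.storeR a i r).narr = σ.narr := rfl
@[simp] theorem storeR_rarr : (σ.storeR a i r).rarr y =
    if y = a then Function.update (σ.rarr a) i r else σ.rarr y := by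
  simp [storeR, Function.update_apply]

end State

attribute [simp] NExpr.eval NExpr.Fits RExpr.eval RExpr.Fits BExpr.Holds BExpr.Fits Cmd.wp

theorem Frame.forBelow {x y v : ℕ} {P : Cmd} {e : NExpr} {σ τ : State}
    (h : Frame (P ;; .setN x e) (σ.setN x v) τ) : Frame (.forBelow x y P) σ τ := by
  refine ⟨fun z hz => ?_, fun a ha => h.narr a ?_, fun a ha => h.rarr a ?_⟩
  · simp only [Cmd.forBelow, Cmd.writesN, Bool.or_eq_false_iff, beq_eq_false_iff_ne] at hz
    rw [h.nreg z (by simp [Cmd.writesN, hz]), State.setN_nreg, if_neg hz.1]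
  · simpa only [Cmd.forBelow, Cmd.storesN, Bool.false_or] using ha
  · simpa only [Cmd.forBelow, Cmd.storesR, Bool.false_or] using ha

theorem Runs.forBelow {B x y c : ℕ} {P : Cmd} {σ : State} (I : ℕ → State → Prop) (hxy : y ≠ x)
    (hx : P.writesN x = false) (hy : P.writesN y = false) (hB : σ.nreg y < B)
    (h0 : I 0 (σ.setN x 0))
    (hI : ∀ i < σ.nreg y, ∀ τ, Frame (.forBelow x y P) σ τ → τ.nreg x = i → I i τ →
      Runs B P τ c fun υ => I (i + 1) (υ.setN x (i + 1))) :
    Runs B (.forBelow x y P) σ (σ.nreg y * (c + 10) + 10) (I (σ.nreg y)) := by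
  have hloop : Runs B (.loop (.not (.nle (.reg y) (.reg x)))
      (P ;; .setN x (.add (.reg x) (.lit 1)))) (σ.setN x 0) (σ.nreg y * (5 + (c + 4)) + 5)
      (I (σ.nreg y)) := by
    refine loop_const (fun k τ => τ.nreg x + k = σ.nreg y ∧ I (τ.nreg x) τ) (c + 4) ?_
      (k := σ.nreg y) ⟨by simp, by simpa using h0⟩
    rintro k τ hF ⟨hk, hτ⟩
    have hyτ : τ.nreg y = σ.nreg y := by
      rw [hF.nreg y (by simp [Cmd.writesN, hy, hxy]), State.setN_nreg, if_neg hxy]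
    refine ⟨by simp only [BExpr.Fits, NExpr.Fits]; omega, fun hb => ?_, fun hb => ?_⟩ <;>
      simp only [BExpr.Holds, NExpr.eval, hyτ, not_not] at hb
    · refine (hI _ (by omega) τ hF.forBelow rfl hτ).seq fun υ hυ hυI => Runs.of_wp ?_
      simp only [Cmd.wp, NExpr.Fits, NExpr.eval, hυ.nreg x hx]
      exact ⟨by omega, k - 1, by omega, by simp; omega, by simpa using hυI⟩
    · rwa [show σ.nreg y = τ.nreg x by omega]
  have hfit : 0 < B := by omega
  refine (wp_seq (P := .setN x (.lit 0)) ⟨hfit, hloop⟩).le ?_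
  simp only [Cmd.maxCost, NExpr.cost]
  nlinarith

-- Notations rather than definitions, so that `simp` decides equality of these addresses.
local notation "rNodes" => 0
local notation "rLinks" => 1
local notation "rStart" => 2
local notation "rVia" => 3
local notation "rEnd" => 4
local notation "rAnswer" => 5
local notation "rFirstLength" => 6
local notation "rSecondLength" => 7
local notation "rCount" => 8
local notation "rArity" => 9
local notation "rTarget" => 10
local notation "rNode" => 11
local notation "rNext" => 12
local notation "rPlayer" => 13
local notation "rPos" => 14
local notation "rChild" => 15
local notation "rWinner" => 16
local notation "rOut" => 17
local notation "rArc" => 18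
local notation "rArcs" => 19

local notation "aTail" => 0
local notation "aHead" => 1
local notation "aRoute" => 2
local notation "aRev" => 5
local notation "aNext" => 6
local notation "aLast" => 7
local notation "aCursor" => 8
local notation "aOpen" => 11
local notation "aQueued" => 12
local notation "aParent" => 13
local notation "aWin" => 14

local notation "rDist" => 0

local notation "aCap" => 0
local notation "aWeight" => 1
local notation "aReduced" => 2
local notation "aDist" => 3
local notation "aPot" => 4
local notation "aFlow" => 5

/-- A bound for the number of steps from a vertex to the root in a tournament of arity `d` between
`n` players. -/
def height (d n : ℕ) : ℕ :=
  Nat.log d n + 1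

/-- The key of a vertex in the priority queue, which is infinite for those not in the queue. -/
noncomputable def queueKey (σ : State) (v : ℕ) : WithTop ℝ :=
  if σ.narr aQueued v = 0 then ⊤ else (σ.rarr aDist v : WithTop ℝ)

/-- The memory holds the size `n` and the arity `d` of a priority queue, for which words below `B`
are large enough. -/
structure QueueMemory (B n d : ℕ) (σ : State) : Prop where
  nodes : σ.nreg rNodes = n
  arity : σ.nreg rArity = d
  two_le : 2 ≤ d
  lt : n + d * n + d + 2 < B
  queued_le : ∀ v < n, σ.narr aQueued v ≤ 1

theorem QueueMemory.of_frame {B n d : ℕ} {P : Cmd} {σ τ : State} (h : QueueMemory B n d σ)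
    (hF : Frame P σ τ) (hn : P.writesN rNodes = false) (hd : P.writesN rArity = false)
    (hq : P.storesN aQueued = false) : QueueMemory B n d τ :=
  ⟨(hF.nreg _ hn).trans h.nodes, (hF.nreg _ hd).trans h.arity, h.two_le, h.lt, by
    rw [hF.narr _ hq]; exact h.queued_le⟩

theorem queueKey_congr {σ τ : State} (hq : τ.narr aQueued = σ.narr aQueued)
    (hd : τ.rarr aDist = σ.rarr aDist) : queueKey τ = queueKey σ := by
  funext v
  simp only [queueKey, hq, hd]

/-- Tests whether the key of `x` in the priority queue is at most that of `y`. -/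
def keyLe (x y : NExpr) : BExpr :=
  .not (.and (.nle (.lit 1) (.read aQueued y))
    (.not (.and (.nle (.lit 1) (.read aQueued x)) (.rle (.read aDist x) (.read aDist y)))))

theorem keyLe_holds (σ : State) (x y : NExpr) :
    (keyLe x y).Holds σ ↔ queueKey σ (x.eval σ) ≤ queueKey σ (y.eval σ) := by
  simp only [keyLe, BExpr.Holds, NExpr.eval, RExpr.eval, queueKey, Nat.one_le_iff_ne_zero]
  split_ifs <;> simp [*]

theorem QueueMemory.keyLe_fits {B n d : ℕ} {σ : State} (h : QueueMemory B n d σ) {x y : NExpr}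
    (hx : x.Fits B σ) (hy : y.Fits B σ) (hxn : x.eval σ < n) (hyn : y.eval σ < n) :
    (keyLe x y).Fits B σ := by
  have hxq := h.queued_le _ hxn
  have hyq := h.queued_le _ hyn
  have hlt := h.lt
  simp only [keyLe, BExpr.Fits, NExpr.Fits, RExpr.Fits]
  refine ⟨⟨?_, hy, ?_⟩, ⟨?_, hx, ?_⟩, hx, hy⟩ <;> omega

/-- Runs `step` at the vertices of the tournament from that in register `rPos` up to the root. -/
def Cmd.climb (step : Cmd) : Cmd :=
  .loop (.nle (.lit 1) (.reg rPos)) (step ;; .setN rPos (.div (.reg rPos) (.reg rArity))) ;; step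

theorem Runs.climb {B n d x c : ℕ} {step : Cmd} {σ : State} (I : Set ℕ → (ℕ → ℕ) → Prop)
    (hq : QueueMemory B n d σ) (hP : step.writesN rPos = false)
    (hA : step.writesN rArity = false) (hx : x < n) (hpos : σ.nreg rPos = x)
    (h0 : I (treePath d x) (σ.narr aWin))
    (hI : ∀ y < n, ∀ τ, Frame step.climb σ τ → τ.nreg rPos = y → I (treePath d y) (τ.narr aWin) →
      Runs B step τ c fun υ => I (treePath d y \ {y}) (υ.narr aWin)) :
    Runs B step.climb σ ((height d n + 1) * (c + 10)) fun τ => I ∅ (τ.narr aWin) := by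
  have hlt := hq.lt
  have hd := hq.two_le
  have hframe : ∀ τ, Frame (step ;; .setN rPos (.div (.reg rPos) (.reg rArity))) σ τ →
      Frame step.climb σ τ := fun τ h => h.mono
    (by simp +contextual [Cmd.climb, Cmd.writesN])
    (by simp +contextual [Cmd.climb, Cmd.storesN]) (by simp +contextual [Cmd.climb, Cmd.storesR])
  have hloop : Runs B (.loop (.nle (.lit 1) (.reg rPos))
      (step ;; .setN rPos (.div (.reg rPos) (.reg rArity)))) σ (height d n * (4 + (c + 4)) + 4)
      fun τ => τ.nreg rPos = 0 ∧ I (treePath d 0) (τ.narr aWin) := by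
    refine loop_const (fun k τ => τ.nreg rPos < d ^ k ∧ τ.nreg rPos < n ∧
      I (treePath d (τ.nreg rPos)) (τ.narr aWin)) (c + 4) ?_ (k := height d n)
      ⟨hpos ▸ hx.trans (Nat.lt_pow_succ_log_self (by omega) n), hpos ▸ hx, hpos ▸ h0⟩
    rintro k τ hF ⟨hk, hn, hτ⟩
    refine ⟨by simp only [BExpr.Fits, NExpr.Fits]; omega, fun hb => ?_, fun hb => ?_⟩ <;>
      simp only [BExpr.Holds, NExpr.eval] at hb
    · obtain _ | k := k
      · simp only [pow_zero] at hk; omega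
      refine (hI _ hn τ (hframe τ hF) rfl hτ).seq fun υ hυ hυI => Runs.of_wp ?_
      rw [treePath_sdiff_self hd (by omega)] at hυI
      have hpos : υ.nreg rPos = τ.nreg rPos := hυ.nreg rPos hP
      have harity : υ.nreg rArity = d := by
        rw [hυ.nreg _ hA, (hframe τ hF).nreg _ (by simp [Cmd.climb, Cmd.writesN, hA]), hq.arity]
      simp only [Cmd.wp, NExpr.Fits, NExpr.eval, hpos, harity, State.setN_nreg, if_true]
      exact ⟨by omega, k, le_rfl, Nat.div_lt_of_lt_mul (pow_succ' d k ▸ hk),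
        (Nat.div_le_self _ _).trans_lt hn, hυI⟩
    · have hzero : τ.nreg rPos = 0 := by omega
      exact ⟨hzero, hzero ▸ hτ⟩
  refine (hloop.seq fun τ hF hτ => ?_).le (T := height d n * (4 + (c + 4)) + 4 + c) (by nlinarith)
  have hroot := hI 0 (by omega) τ (hF.mono (by simp +contextual [Cmd.climb, Cmd.writesN])
    (by simp +contextual [Cmd.climb, Cmd.storesN]) (by simp +contextual [Cmd.climb, Cmd.storesR]))
    hτ.1 hτ.2
  rwa [treePath_zero, Set.sdiff_self] at hroot

/-- The player `b` has least key among the player `x` and the winners at those children of `x` which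
are less than `c`. -/
structure IsLocalWinner {α : Type*} [LE α] (n d : ℕ) (κ : ℕ → α) (win : ℕ → ℕ) (x c b : ℕ) :
    Prop where
  lt : b < n
  mem : x ∈ treePath d b
  le_self : κ b ≤ κ x
  le_child : ∀ c' < n, c' < c → c' / d = x → κ b ≤ κ (win c')

namespace IsLocalWinner

variable {α : Type*} {n d x c b : ℕ} {κ : ℕ → α} {win : ℕ → ℕ} {X : Set ℕ}

theorem self [Preorder α] (hd : 2 ≤ d) (hx : x < n) : IsLocalWinner n d κ win x (d * x) x :=
  ⟨hx, self_mem_treePath d x, le_rfl, fun c' _ hlt hdiv => by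
    rw [Nat.div_eq_iff (by omega), mul_comm x d] at hdiv; omega⟩

open Classical in
theorem challenge [LinearOrder α] (h : IsLocalWinner n d κ win x c b)
    (hT : IsTournament n d κ win X) (hc : c < n) (hdiv : c / d = x) :
    IsLocalWinner n d κ win x (c + 1) (if κ (win c) ≤ κ b then win c else b) := by
  split_ifs with hle
  · refine ⟨hT.lt c hc, hdiv ▸ div_mem_treePath (hT.mem c hc), hle.trans h.le_self,
      fun c' hc' hlt hdiv' => ?_⟩
    rcases Nat.lt_succ_iff_lt_or_eq.1 hlt with hlt | rfl
    exacts [hle.trans (h.le_child c' hc' hlt hdiv'), le_rfl]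
  · refine ⟨h.lt, h.mem, h.le_self, fun c' hc' hlt hdiv' => ?_⟩
    rcases Nat.lt_succ_iff_lt_or_eq.1 hlt with hlt | rfl
    exacts [h.le_child c' hc' hlt hdiv', (not_le.1 hle).le]

end IsLocalWinner

/-- Enters the vertex in register `rPlayer` into the tournament at that in register `rPos`. -/
def bubbleStep : Cmd :=
  .ite (keyLe (.reg rPlayer) (.read aWin (.reg rPos)))
    (.storeN aWin (.reg rPos) (.reg rPlayer)) .skip

/-- Restores the tournament after the key of the vertex in register `rPlayer` has decreased. -/
def bubble : Cmd :=
  .setN rPos (.reg rPlayer) ;; bubbleStep.climb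

theorem bubbleStep_runs {B n d v x : ℕ} {X : Set ℕ} {σ : State} (hq : QueueMemory B n d σ)
    (hv : v < n) (hx : x < n) (hX : x ∈ X) (hplayer : σ.nreg rPlayer = v)
    (hpos : σ.nreg rPos = x) (hwin : σ.narr aWin x < n) :
    Runs B bubbleStep σ bubbleStep.maxCost fun τ => τ.narr aWin =
      Function.update (σ.narr aWin) x (enterTournament (queueKey σ) (σ.narr aWin) v X x) := by
  have hlt := hq.lt
  refine Runs.of_wp ?_
  simp only [bubbleStep, Cmd.wp, keyLe_holds, NExpr.eval, NExpr.Fits, State.storeN_narr, if_true,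
    hplayer, hpos, enterTournament, hX, true_and]
  refine ⟨hq.keyLe_fits (by simp; omega) (by simp [hpos]; omega) (by simpa [hplayer])
    (by simpa [hpos]), fun hle => ⟨by omega, by omega, by rw [if_pos hle]⟩, fun hle => ?_⟩
  rw [if_neg hle, Function.update_eq_self]

theorem bubble_runs {B n d v : ℕ} {σ : State} (hq : QueueMemory B n d σ) (hv : v < n)
    (hplayer : σ.nreg rPlayer = v) (hwin : ∀ x < n, σ.narr aWin x < n) :
    Runs B bubble σ (100 * (height d n + 1)) fun τ =>
      τ.narr aWin = enterTournament (queueKey σ) (σ.narr aWin) v (treePath d v) := by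
  have hlt := hq.lt
  have hclimb : Runs B bubbleStep.climb (σ.setN rPos v)
      ((height d n + 1) * (bubbleStep.maxCost + 10)) fun τ =>
      (∀ x < n, τ.narr aWin x < n) ∧ enterTournament (queueKey σ) (τ.narr aWin) v ∅ =
        enterTournament (queueKey σ) (σ.narr aWin) v (treePath d v) := by
    refine Runs.climb (fun X win => (∀ x < n, win x < n) ∧ enterTournament (queueKey σ) win v X =
      enterTournament (queueKey σ) (σ.narr aWin) v (treePath d v)) (x := v)
      ⟨by simp [hq.nodes], by simp [hq.arity], hq.two_le, hlt, hq.queued_le⟩ rfl rfl hv (by simp)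
      ⟨hwin, rfl⟩ fun y hy τ hF hpos ⟨hτ, hI⟩ => ?_
    have hkey : queueKey τ = queueKey σ :=
      queueKey_congr (hF.narr aQueued rfl) (hF.rarr aDist rfl)
    have hqτ : QueueMemory B n d τ := ⟨(hF.nreg _ rfl).trans hq.nodes,
      (hF.nreg _ rfl).trans hq.arity, hq.two_le, hlt, hF.narr aQueued rfl ▸ hq.queued_le⟩
    refine (bubbleStep_runs hqτ hv hy (self_mem_treePath d y)
      ((hF.nreg _ rfl).trans hplayer) hpos (hτ y hy)).mono le_rfl fun υ _ hυ => ?_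
    rw [hυ, hkey, enterTournament_update, ← hI]
    refine ⟨fun x hx => ?_, rfl⟩
    rcases eq_or_ne x y with rfl | e
    · rw [Function.update_self, enterTournament]
      split_ifs
      exacts [hv, hτ x hx]
    · rw [Function.update_of_ne e]
      exact hτ x hx
  have hset : (Cmd.setN rPos (.reg rPlayer)).wp B (fun τ => τ = σ.setN rPos v) σ := by
    simp [hplayer]; omega
  refine ((Runs.of_wp hset).seq fun τ _ hτ => hτ ▸ hclimb).mono ?_ fun τ _ hτ => ?_
  · simp only [bubbleStep, keyLe, Cmd.maxCost, BExpr.cost, NExpr.cost, RExpr.cost]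
    omega
  · rw [← hτ.2, enterTournament_empty]

/-- Compares the winner at the child in register `rChild` with the vertex in register `rWinner`, and
proceeds to the next child. -/
def challenge : Cmd :=
  .ite (keyLe (.read aWin (.reg rChild)) (.reg rWinner))
    (.setN rWinner (.read aWin (.reg rChild))) .skip ;;
  .setN rChild (.add (.reg rChild) (.lit 1))

/-- Runs `challenge` from the child in register `rChild` to the last child of the vertex in register
`rPos`. -/
def challengeAll : Cmd :=
  .loop (.and (.nle (.add (.reg rChild) (.lit 1))
      (.add (.mul (.reg rArity) (.reg rPos)) (.reg rArity)))
    (.nle (.add (.reg rChild) (.lit 1)) (.reg rNodes))) challenge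

/-- Computes the winner at the vertex in register `rPos` from those at its children. -/
def rebuildStep : Cmd :=
  .setN rWinner (.reg rPos) ;; .setN rChild (.mul (.reg rArity) (.reg rPos)) ;; challengeAll ;;
  .storeN aWin (.reg rPos) (.reg rWinner)

/-- Restores the tournament after the key of the vertex in register `rNode` has changed. -/
def rebuild : Cmd :=
  .setN rPos (.reg rNode) ;; rebuildStep.climb

theorem challenge_runs {B n d c b : ℕ} {σ : State} (hq : QueueMemory B n d σ) (hc : c < n)
    (hb : b < n) (hchild : σ.nreg rChild = c) (hwinner : σ.nreg rWinner = b)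
    (hwin : σ.narr aWin c < n) :
    Runs B challenge σ challenge.maxCost fun τ => τ.nreg rChild = c + 1 ∧ τ.nreg rWinner =
      if queueKey σ (σ.narr aWin c) ≤ queueKey σ b then σ.narr aWin c else b := by
  have hlt := hq.lt
  refine Runs.of_wp ?_
  simp only [challenge, Cmd.wp, keyLe_holds, NExpr.eval, NExpr.Fits, State.setN_nreg, hchild,
    hwinner]
  refine ⟨hq.keyLe_fits (by simp [hchild]; omega) (by simp [hwinner]; omega) (by simpa [hchild])
    (by simpa [hwinner]), fun hle => ⟨by omega, ⟨by simp; omega, by omega, by simp; omega⟩, ?_⟩,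
    fun hle => ⟨by omega, by simp [hle]⟩⟩
  simp [hle]

theorem challengeAll_runs {B n d x : ℕ} {X : Set ℕ} {σ : State} (hq : QueueMemory B n d σ)
    (hx : x < n) (hpos : σ.nreg rPos = x) (hchild : σ.nreg rChild = d * x)
    (hwinner : σ.nreg rWinner = x) (h : IsTournament n d (queueKey σ) (σ.narr aWin) X) :
    Runs B challengeAll σ (d * (16 + challenge.maxCost) + 16) fun τ =>
      ∃ c, (n ≤ c ∨ d * x + d ≤ c) ∧
        IsLocalWinner n d (queueKey σ) (σ.narr aWin) x c (τ.nreg rWinner) := by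
  have hlt := hq.lt
  have hd := hq.two_le
  have hdx : d * x ≤ d * n := Nat.mul_le_mul_left _ hx.le
  refine Runs.loop_const (fun k τ => τ.nreg rChild + k = d * x + d ∧ d * x ≤ τ.nreg rChild ∧
      IsLocalWinner n d (queueKey σ) (σ.narr aWin) x (τ.nreg rChild) (τ.nreg rWinner))
    challenge.maxCost ?_ (k := d) ⟨by rw [hchild], hchild.ge, ?_⟩
  swap
  · rw [hchild, hwinner]
    exact .self hd hx
  rintro k τ hF ⟨hk, hdc, hτ⟩
  have hqτ := hq.of_frame hF rfl rfl rfl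
  have hkey : queueKey τ = queueKey σ := queueKey_congr (hF.narr aQueued rfl) (hF.rarr aDist rfl)
  have hwin : τ.narr aWin = σ.narr aWin := hF.narr aWin rfl
  simp only [BExpr.Fits, BExpr.Holds, NExpr.Fits, NExpr.eval, hqτ.nodes, hqτ.arity,
    hF.nreg rPos rfl, hpos]
  refine ⟨by omega, fun hb => ?_, fun hb => ⟨τ.nreg rChild, by omega, hτ⟩⟩
  refine (challenge_runs hqτ hb.2 hτ.lt rfl rfl (hwin ▸ h.lt _ hb.2)).mono le_rfl
    fun υ _ hυ => ⟨k - 1, by omega, by omega, by omega, ?_⟩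
  rw [hυ.1, hυ.2, hkey, hwin]
  exact hτ.challenge h hb.2 (by rw [Nat.div_eq_iff (by omega), mul_comm x d]; omega)

theorem rebuildStep_runs {B n d x : ℕ} {X : Set ℕ} {σ : State} (hq : QueueMemory B n d σ)
    (hx : x < n) (hX : x / d ∈ X) (hpos : σ.nreg rPos = x)
    (h : IsTournament n d (queueKey σ) (σ.narr aWin) X) :
    Runs B rebuildStep σ (100 * (d + 1)) fun τ =>
      IsTournament n d (queueKey σ) (τ.narr aWin) (X \ {x}) := by
  have hlt := hq.lt
  have hd := hq.two_le
  have hdx : d * x ≤ d * n := Nat.mul_le_mul_left _ hx.le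
  have hchallenge : Runs B (challengeAll ;; .storeN aWin (.reg rPos) (.reg rWinner))
      ((σ.setN rWinner x).setN rChild (d * x)) (d * (16 + challenge.maxCost) + 16 + 3)
      fun τ => IsTournament n d (queueKey σ) (τ.narr aWin) (X \ {x}) := by
    refine (challengeAll_runs (σ := (σ.setN rWinner x).setN rChild (d * x))
      ⟨by simp [hq.nodes], by simp [hq.arity], hd, hlt, hq.queued_le⟩ hx (by simpa using hpos)
      (by simp) (by simp) h).seq ?_
    rintro τ hF ⟨c, hc, hτ⟩
    have hwin : τ.narr aWin = σ.narr aWin := hF.narr aWin rfl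
    have hposτ : τ.nreg rPos = x := (hF.nreg rPos rfl).trans (by simpa using hpos)
    have hτn := hτ.lt
    refine Runs.of_wp ?_
    simp only [Cmd.wp, NExpr.Fits, NExpr.eval, hposτ, State.storeN_narr, if_true, hwin]
    exact ⟨by omega, by omega, h.update hX hτ.lt hτ.mem hτ.le_self fun c' hc' hdiv =>
      hτ.le_child c' hc' (by rw [Nat.div_eq_iff (by omega), mul_comm x d] at hdiv; omega) hdiv⟩
  have hset : (Cmd.setN rWinner (.reg rPos)).wp B (fun τ => Runs B (.setN rChild
      (.mul (.reg rArity) (.reg rPos)) ;; challengeAll ;; .storeN aWin (.reg rPos) (.reg rWinner))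
      τ (4 + (d * (16 + challenge.maxCost) + 16 + 3))
      fun τ => IsTournament n d (queueKey σ) (τ.narr aWin) (X \ {x})) σ := by
    refine ⟨by simp [hpos]; omega, Runs.wp_seq ⟨?_, ?_⟩⟩
    · simp [hpos, hq.arity]; omega
    · simpa [hpos, hq.arity] using hchallenge
  refine (Runs.wp_seq hset).le ?_
  simp only [challenge, keyLe, Cmd.maxCost, BExpr.cost, NExpr.cost, RExpr.cost]
  omega

theorem rebuild_runs {B n d v : ℕ} {σ : State} (hq : QueueMemory B n d σ) (hv : v < n)
    (hnode : σ.nreg rNode = v)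
    (h : IsTournament n d (queueKey σ) (σ.narr aWin) (treePath d v)) :
    Runs B rebuild σ (200 * (d + 1) * (height d n + 1)) fun τ =>
      IsTournament n d (queueKey σ) (τ.narr aWin) ∅ := by
  have hlt := hq.lt
  have hclimb : Runs B rebuildStep.climb (σ.setN rPos v)
      ((height d n + 1) * (100 * (d + 1) + 10)) fun τ =>
      IsTournament n d (queueKey σ) (τ.narr aWin) ∅ := by
    refine Runs.climb (fun X win => IsTournament n d (queueKey σ) win X) (x := v)
      ⟨by simp [hq.nodes], by simp [hq.arity], hq.two_le, hlt, hq.queued_le⟩ rfl rfl hv (by simp)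
      h fun y hy τ hF hpos hI => ?_
    have hkey : queueKey τ = queueKey σ :=
      queueKey_congr (hF.narr aQueued rfl) (hF.rarr aDist rfl)
    have hqτ : QueueMemory B n d τ := ⟨(hF.nreg _ rfl).trans hq.nodes,
      (hF.nreg _ rfl).trans hq.arity, hq.two_le, hlt, hF.narr aQueued rfl ▸ hq.queued_le⟩
    exact hkey ▸ rebuildStep_runs hqτ hy (div_mem_treePath (self_mem_treePath d y)) hpos
      (hkey ▸ hI)
  have hset : (Cmd.setN rPos (.reg rNode)).wp B (fun τ => τ = σ.setN rPos v) σ := by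
    simp [hnode]; omega
  refine ((Runs.of_wp hset).seq fun τ _ hτ => hτ ▸ hclimb).le ?_
  simp only [Cmd.maxCost, NExpr.cost]
  nlinarith

/-- One more than the last arc before `k` with tail `v`, or `0` if there is none. The arcs with a
given tail form a linked list in this way. -/
def lastArc (tail : ℕ → ℕ) (v : ℕ) : ℕ → ℕ
  | 0 => 0
  | k + 1 => if tail k = v then k + 1 else lastArc tail v k

/-- The number of arcs before `p` with tail `v`. -/
def numArcs (tail : ℕ → ℕ) (v p : ℕ) : ℕ :=
  ((Finset.range p).filter fun a => tail a = v).card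

section lastArc

variable {tail : ℕ → ℕ} {v k p a : ℕ}

theorem lastArc_le (tail : ℕ → ℕ) (v k : ℕ) : lastArc tail v k ≤ k := by
  induction k with
  | zero => exact le_rfl
  | succ k ih => simp only [lastArc]; split_ifs <;> omega

theorem tail_of_lastArc_eq (h : lastArc tail v k = a + 1) : tail a = v := by
  induction k with
  | zero => simp [lastArc] at h
  | succ k ih =>
    simp only [lastArc] at h
    split_ifs at h with hk
    · obtain rfl : k = a := by omega
      exact hk
    · exact ih h

theorem tail_ne_of_lastArc_le (ha : a < k) (h : lastArc tail v k ≤ a) : tail a ≠ v := by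
  induction k with
  | zero => omega
  | succ k ih =>
    simp only [lastArc] at h
    split_ifs at h with hk
    · omega
    · rcases Nat.lt_succ_iff_lt_or_eq.1 ha with ha | rfl
      exacts [ih ha h, hk]

theorem numArcs_mono (tail : ℕ → ℕ) (v : ℕ) {p p' : ℕ} (h : p ≤ p') :
    numArcs tail v p ≤ numArcs tail v p' :=
  Finset.card_le_card (Finset.filter_subset_filter _ (Finset.range_subset_range.2 h))

theorem numArcs_lt_of_lastArc_eq (h : lastArc tail v k = a + 1) :
    numArcs tail v a < numArcs tail v k := by
  have hsucc : numArcs tail v (a + 1) = numArcs tail v a + 1 := by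
    simp [numArcs, Finset.range_add_one, Finset.filter_insert, tail_of_lastArc_eq h]
  have hmono := numArcs_mono tail v (h ▸ lastArc_le tail v k)
  omega

theorem sum_numArcs {n : ℕ} (h : ∀ a < k, tail a < n) :
    ∑ v ∈ Finset.range n, numArcs tail v k = k := by
  simpa [numArcs] using (Finset.card_eq_sum_card_fiberwise (s := Finset.range k)
    (t := Finset.range n) (f := tail) fun a ha => by simpa using h a (by simpa using ha)).symm

end lastArc

/-- Enters the vertex in register `rPlayer` into the priority queue, with the label in the registers
`rDist` and `rNext`. -/
def enqueue : Cmd :=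
  (.storeR aDist (.reg rPlayer) (.reg rDist) ;; .storeN aQueued (.reg rPlayer) (.lit 1) ;;
    .storeN aParent (.reg rPlayer) (.reg rNext)) ;; bubble

/-- Relaxes the open arc which precedes the number in register `rNext`, and whose tail is in
register `rNode`. -/
def relaxOpenArc : Cmd :=
  (.setN rPlayer (.read aHead (.sub (.reg rNext) (.lit 1))) ;;
    .setR rDist (.add (.read aDist (.reg rNode)) (.read aReduced (.sub (.reg rNext) (.lit 1))))) ;;
  .ite (.and (.nle (.lit 1) (.read aParent (.reg rPlayer)))
    (.rle (.read aDist (.reg rPlayer)) (.reg rDist))) .skip enqueue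

/-- Relaxes the arc which precedes the number in register `rNext`, and whose tail is in register
`rNode`, if it is open. -/
def relaxArc : Cmd :=
  .ite (.nle (.lit 1) (.read aOpen (.sub (.reg rNext) (.lit 1)))) relaxOpenArc .skip

/-- Relaxes the arc which precedes the number in register `rNext`, if it is open, and passes to the
preceding arc with the same tail. -/
def scanStep : Cmd :=
  relaxArc ;; .setN rNext (.read aNext (.sub (.reg rNext) (.lit 1)))

/-- Relaxes all arcs whose tail is in register `rNode`. -/
def scan : Cmd :=
  .setN rNext (.read aLast (.reg rNode)) ;;
  .loop (.nle (.lit 1) (.reg rNext)) scanStep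

/-- Settles the winner of the tournament. -/
def settle : Cmd :=
  (.setN rNode (.read aWin (.lit 0)) ;; .storeN aQueued (.reg rNode) (.lit 0)) ;; rebuild ;; scan

/-- Settles vertices until the priority queue is empty. -/
def settleAll : Cmd :=
  .loop (.nle (.lit 1) (.read aQueued (.read aWin (.lit 0)))) settle

/-- Empties the priority queue and erases the labels. -/
def clearQueue : Cmd :=
  .forBelow rCount rNodes (.storeN aQueued (.reg rCount) (.lit 0) ;;
    .storeN aParent (.reg rCount) (.lit 0) ;; .storeN aWin (.reg rCount) (.reg rCount))

/-- Enters the vertex in register `rVia` into the priority queue as the source of the search. -/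
def enqueueSource : Cmd :=
  (.setN rPlayer (.reg rVia) ;; .setR rDist .zero ;; .setN rNext (.add (.reg rArcs) (.lit 1))) ;;
  enqueue

/-- Dijkstra's algorithm from the vertex in register `rVia`, with the arcs marked in the array
`aOpen` and their lengths in the array `aReduced`. -/
def search : Cmd :=
  clearQueue ;; enqueueSource ;; settleAll

/-- The memory holds the input of Dijkstra's algorithm from `r` in the graph `G`, whose vertices are
less than `n` and whose arcs are less than `A`. -/
structure SearchInput (B n A r d : ℕ) (G : ArcGraph ℕ ℕ) (σ : State) : Prop where
  nodes : σ.nreg rNodes = n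
  source : σ.nreg rVia = r
  arity : σ.nreg rArity = d
  arcs : σ.nreg rArcs = A
  two_le : 2 ≤ d
  lt : n + d * n + d + 2 < B
  arcs_lt : A + 2 < B
  source_lt : r < n
  tail_eq : σ.narr aTail = G.tail
  head_eq : σ.narr aHead = G.head
  tail_lt : ∀ a < A, G.tail a < n
  head_lt : ∀ a < A, G.head a < n
  last_eq : ∀ v < n, σ.narr aLast v = lastArc G.tail v A
  next_eq : ∀ a < A, σ.narr aNext a = lastArc G.tail (G.tail a) a
  open_le : ∀ a < A, σ.narr aOpen a ≤ 1
  mem_arcs : ∀ a, a ∈ G.arcs ↔ a < A ∧ σ.narr aOpen a ≠ 0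
  length_eq : ∀ a ∈ G.arcs, σ.rarr aReduced a = G.length a
  length_nonneg : ∀ a ∈ G.arcs, 0 ≤ G.length a

/-- Whether the program leaves the input of the search as it is. -/
def Cmd.keepsSearchInput (P : Cmd) : Bool :=
  !P.writesN rNodes && !P.writesN rVia && !P.writesN rArity && !P.writesN rArcs &&
    !P.storesN aTail && !P.storesN aHead && !P.storesN aLast && !P.storesN aNext &&
    !P.storesN aOpen && !P.storesR aReduced

/-- The labels in the memory; the parent of a vertex is stored as one more than the number of an
arc, or as `0` if the vertex has not been reached. -/
def pathLabels (n : ℕ) (parent : ℕ → ℕ) (dist : ℕ → ℝ) : PathLabels ℕ ℕ where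
  reached := {v | v < n ∧ parent v ≠ 0}
  parent v := parent v - 1
  dist := dist

/-- The state in the course of Dijkstra's algorithm. -/
structure SearchState (n A r d : ℕ) (G : ArcGraph ℕ ℕ) (σ : State) (S : Finset ℕ) (D : Set ℕ)
    (rank : ℕ → ℕ) (μ : ℝ) : Prop where
  dijkstra : G.DijkstraInvariant r (pathLabels n (σ.narr aParent) (σ.rarr aDist)) S D rank μ
  tournament : IsTournament n d (queueKey σ) (σ.narr aWin) ∅
  queued_le : ∀ v < n, σ.narr aQueued v ≤ 1
  queued_iff : ∀ v < n, σ.narr aQueued v ≠ 0 ↔ σ.narr aParent v ≠ 0 ∧ v ∉ S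
  parent_le : ∀ v < n, σ.narr aParent v ≤ A + 1

/-- The memory holds a shortest path tree of `G` from `r`. -/
structure IsSearchResult (n A r : ℕ) (G : ArcGraph ℕ ℕ) (rank : ℕ → ℕ) (σ : State) : Prop where
  tree : G.IsShortestPathTree r (pathLabels n (σ.narr aParent) (σ.rarr aDist)) rank
  rank_lt : ∀ v < n, σ.narr aParent v ≠ 0 → rank v < n
  parent_le : ∀ v < n, σ.narr aParent v ≤ A + 1

section search

open Function

variable {B n A r d a u v : ℕ} {G : ArcGraph ℕ ℕ} {P : Cmd} {σ τ : State} {S : Finset ℕ}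
  {D : Set ℕ} {rank : ℕ → ℕ} {μ : ℝ}

theorem SearchInput.of_frame (h : SearchInput B n A r d G σ) (hF : Frame P σ τ)
    (hP : P.keepsSearchInput = true) : SearchInput B n A r d G τ := by
  simp only [Cmd.keepsSearchInput, Bool.and_eq_true, Bool.not_eq_true'] at hP
  obtain ⟨⟨⟨⟨⟨⟨⟨⟨⟨hn, hr⟩, hd⟩, hA⟩, ht⟩, hh⟩, hl⟩, hx⟩, ho⟩, hc⟩ := hP
  exact ⟨(hF.nreg _ hn).trans h.nodes, (hF.nreg _ hr).trans h.source, (hF.nreg _ hd).trans h.arity,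
    (hF.nreg _ hA).trans h.arcs, h.two_le, h.lt, h.arcs_lt, h.source_lt,
    (hF.narr _ ht).trans h.tail_eq, (hF.narr _ hh).trans h.head_eq, h.tail_lt, h.head_lt,
    hF.narr _ hl ▸ h.last_eq, hF.narr _ hx ▸ h.next_eq, hF.narr _ ho ▸ h.open_le,
    hF.narr _ ho ▸ h.mem_arcs, hF.rarr _ hc ▸ h.length_eq, h.length_nonneg⟩

theorem SearchInput.queueMemory (h : SearchInput B n A r d G σ)
    (hq : ∀ v < n, σ.narr aQueued v ≤ 1) : QueueMemory B n d σ :=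
  ⟨h.nodes, h.arity, h.two_le, h.lt, hq⟩

theorem SearchState.congr (h : SearchState n A r d G σ S D rank μ)
    (hq : τ.narr aQueued = σ.narr aQueued) (hp : τ.narr aParent = σ.narr aParent)
    (hw : τ.narr aWin = σ.narr aWin) (hd : τ.rarr aDist = σ.rarr aDist) :
    SearchState n A r d G τ S D rank μ :=
  ⟨hp ▸ hd ▸ h.dijkstra, hw ▸ queueKey_congr hq hd ▸ h.tournament, hq ▸ h.queued_le,
    hq ▸ hp ▸ h.queued_iff, hp ▸ h.parent_le⟩

theorem relax_pathLabels {parent : ℕ → ℕ} {dist : ℕ → ℝ} (hn : G.head a < n) :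
    G.relax (pathLabels n parent dist) a = pathLabels n (update parent (G.head a) (a + 1))
      (update dist (G.head a) (dist (G.tail a) + G.length a)) := by
  simp only [ArcGraph.relax, pathLabels, PathLabels.mk.injEq, and_true]
  constructor
  · ext v
    rcases eq_or_ne v (G.head a) with rfl | e
    · simpa
    · simp [e]
  · funext v
    rcases eq_or_ne v (G.head a) with rfl | e <;> simp [*]

theorem enqueue_runs (hq : QueueMemory B n d σ)
    (hT : IsTournament n d (queueKey σ) (σ.narr aWin) ∅) (hv : v < n)
    (hplayer : σ.nreg rPlayer = v) (hnext : σ.nreg rNext < B)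
    (hle : (σ.rreg rDist : WithTop ℝ) ≤ queueKey σ v) :
    Runs B enqueue σ (100 * (height d n + 1) + 9) fun τ =>
      τ.narr aQueued = update (σ.narr aQueued) v 1 ∧
      τ.narr aParent = update (σ.narr aParent) v (σ.nreg rNext) ∧
      τ.rarr aDist = update (σ.rarr aDist) v (σ.rreg rDist) ∧
      IsTournament n d (queueKey τ) (τ.narr aWin) ∅ := by
  have hlt := hq.lt
  set ρ := ((σ.storeR aDist v (σ.rreg rDist)).storeN aQueued v 1).storeN aParent v (σ.nreg rNext)
    with hρ
  have hqρ : QueueMemory B n d ρ := ⟨hq.nodes, hq.arity, hq.two_le, hlt, fun x hx => by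
    rcases eq_or_ne x v with rfl | e
    · simp [hρ]
    · simpa [hρ, e] using hq.queued_le x hx⟩
  have hkey : ∀ x ≠ v, queueKey ρ x = queueKey σ x := fun x hx => by simp [hρ, queueKey, hx]
  have hkey_le : queueKey ρ v ≤ queueKey σ v := by simpa [hρ, queueKey] using hle
  have hstore : (Cmd.storeR aDist (.reg rPlayer) (.reg rDist) ;;
      Cmd.storeN aQueued (.reg rPlayer) (.lit 1) ;;
      Cmd.storeN aParent (.reg rPlayer) (.reg rNext)).wp B (fun τ => τ = ρ) σ := by
    simp [hplayer, hρ]; omega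
  have hbubble : Runs B bubble ρ (100 * (height d n + 1)) fun τ =>
      τ.narr aQueued = update (σ.narr aQueued) v 1 ∧
      τ.narr aParent = update (σ.narr aParent) v (σ.nreg rNext) ∧
      τ.rarr aDist = update (σ.rarr aDist) v (σ.rreg rDist) ∧
      IsTournament n d (queueKey τ) (τ.narr aWin) ∅ := by
    refine (bubble_runs hqρ hv hplayer hT.lt).mono le_rfl fun τ hF hτ => ?_
    have hkeyτ : queueKey τ = queueKey ρ :=
      queueKey_congr (hF.narr aQueued rfl) (hF.rarr aDist rfl)
    refine ⟨by simp [hF.narr aQueued rfl, hρ], by simp [hF.narr aParent rfl, hρ],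
      by simp [hF.rarr aDist rfl, hρ], ?_⟩
    rw [hτ, hkeyτ]
    exact hT.of_key_decrease hv hkey hkey_le
  refine ((Runs.of_wp hstore).seq fun τ _ hτ => hτ ▸ hbubble).le ?_
  simp only [Cmd.maxCost, NExpr.cost, RExpr.cost]
  omega

theorem SearchState.scan_arc (h : SearchState n A r d G σ S D rank μ) (htail : G.tail a ∈ S)
    (hhead : a ∈ G.arcs → G.head a ∈ (pathLabels n (σ.narr aParent) (σ.rarr aDist)).reached)
    (hle : a ∈ G.arcs →
      σ.rarr aDist (G.head a) ≤ σ.rarr aDist (G.tail a) + G.length a) :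
    SearchState n A r d G σ S (insert a D) rank μ :=
  { h with dijkstra := h.dijkstra.scan htail hhead hle }

theorem SearchState.relax_arc (h : SearchState n A r d G σ S D rank μ)
    (hi : SearchInput B n A r d G σ) (ha : a ∈ G.arcs) (htail : G.tail a ∈ S)
    (hμ : σ.rarr aDist (G.tail a) = μ)
    (hbetter : σ.narr aParent (G.head a) ≠ 0 →
      σ.rarr aDist (G.tail a) + G.length a < σ.rarr aDist (G.head a))
    (hqueued : τ.narr aQueued = update (σ.narr aQueued) (G.head a) 1)
    (hparent : τ.narr aParent = update (σ.narr aParent) (G.head a) (a + 1))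
    (hdist : τ.rarr aDist =
      update (σ.rarr aDist) (G.head a) (σ.rarr aDist (G.tail a) + G.length a))
    (hT : IsTournament n d (queueKey τ) (τ.narr aWin) ∅) :
    SearchState n A r d G τ S (insert a D) rank μ := by
  have haA := ((hi.mem_arcs a).1 ha).1
  have hhead := hi.head_lt a haA
  have hlen := hi.length_nonneg a ha
  have hne : G.tail a ≠ G.head a := ne_of_mem_of_not_mem htail
    (h.dijkstra.head_notMem_settled hμ hlen fun hr => hbetter hr.2)
  have hstate : SearchState n A r d G τ S D rank μ := by
    refine ⟨?_, hT, fun v hv => ?_, fun v hv => ?_, fun v hv => ?_⟩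
    · rw [hparent, hdist, ← relax_pathLabels hhead]
      exact h.dijkstra.relax ha htail hμ hlen fun hr => hbetter hr.2
    all_goals rcases eq_or_ne v (G.head a) with rfl | e
    · simp [hqueued]
    · simpa [hqueued, e] using h.queued_le v hv
    · simpa [hqueued, hparent] using
        h.dijkstra.head_notMem_settled hμ hlen fun hr => hbetter hr.2
    · simpa [hqueued, hparent, e] using h.queued_iff v hv
    · simp [hparent]; omega
    · simpa [hparent, e] using h.parent_le v hv
  refine hstate.scan_arc htail (fun _ => ⟨hhead, by simp [hparent]⟩) fun _ => ?_
  simp [hdist, hne]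

theorem enqueue_head_runs (hi : SearchInput B n A r d G σ)
    (h : SearchState n A r d G σ S D rank μ) (ha : a ∈ G.arcs) (htail : G.tail a ∈ S)
    (hμ : σ.rarr aDist (G.tail a) = μ) (hplayer : σ.nreg rPlayer = G.head a)
    (hdist : σ.rreg rDist = σ.rarr aDist (G.tail a) + G.length a) (hnext : σ.nreg rNext = a + 1)
    (hbetter : σ.narr aParent (G.head a) ≠ 0 → σ.rreg rDist < σ.rarr aDist (G.head a)) :
    Runs B enqueue σ (100 * (height d n + 1) + 9) fun τ =>
      τ.rarr aDist (G.tail a) = μ ∧ SearchState n A r d G τ S (insert a D) rank μ := by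
  have haA := ((hi.mem_arcs a).1 ha).1
  have hAlt := hi.arcs_lt
  have hhead := hi.head_lt a haA
  have hkey : (σ.rreg rDist : WithTop ℝ) ≤ queueKey σ (G.head a) := by
    simp only [queueKey]
    split_ifs with hq
    · exact le_top
    · exact WithTop.coe_le_coe.2 (hbetter ((h.queued_iff _ hhead).1 hq).1).le
  rw [hdist] at hbetter
  have hne : G.tail a ≠ G.head a := ne_of_mem_of_not_mem htail <|
    h.dijkstra.head_notMem_settled hμ (hi.length_nonneg a ha) fun hr => hbetter hr.2
  refine (enqueue_runs (hi.queueMemory h.queued_le) h.tournament hhead hplayer (by omega)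
    hkey).mono le_rfl fun τ _ hτ => ?_
  obtain ⟨hq, hp, hd, hT⟩ := hτ
  rw [hnext] at hp
  rw [hdist] at hd
  exact ⟨by simp [hd, hne, hμ], h.relax_arc hi ha htail hμ hbetter hq hp hd hT⟩

theorem relaxOpenArc_runs (hi : SearchInput B n A r d G σ)
    (h : SearchState n A r d G σ S D rank μ) (ha : a ∈ G.arcs) (hnode : σ.nreg rNode = G.tail a)
    (hnext : σ.nreg rNext = a + 1) (htail : G.tail a ∈ S) (hμ : σ.rarr aDist (G.tail a) = μ) :
    Runs B relaxOpenArc σ (40 + 100 * (height d n + 1)) fun τ =>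
      τ.rarr aDist (G.tail a) = μ ∧ SearchState n A r d G τ S (insert a D) rank μ := by
  have hlt := hi.lt
  have hAlt := hi.arcs_lt
  have haA := ((hi.mem_arcs a).1 ha).1
  have hhead := hi.head_lt a haA
  have htail_lt := hi.tail_lt a haA
  have hparent := h.parent_le _ hhead
  set δ := σ.rarr aDist (G.tail a) + G.length a with hδ
  set ρ := (σ.setN rPlayer (G.head a)).setR rDist δ with hρ
  have hiρ : SearchInput B n A r d G ρ := { hi with }
  have hstate : SearchState n A r d G ρ S D rank μ := h.congr rfl rfl rfl rfl
  have hset : (Cmd.setN rPlayer (.read aHead (.sub (.reg rNext) (.lit 1))) ;;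
      Cmd.setR rDist (.add (.read aDist (.reg rNode))
        (.read aReduced (.sub (.reg rNext) (.lit 1))))).wp B (fun τ => τ = ρ) σ := by
    simp [hnext, hnode, hi.head_eq, hi.length_eq a ha, hρ, hδ]; omega
  have hfit : (BExpr.and (.nle (.lit 1) (.read aParent (.reg rPlayer)))
      (.rle (.read aDist (.reg rPlayer)) (.reg rDist))).Fits B ρ := by
    simp [hρ]; omega
  have hrelax : Runs B (.ite (.and (.nle (.lit 1) (.read aParent (.reg rPlayer)))
      (.rle (.read aDist (.reg rPlayer)) (.reg rDist))) .skip enqueue) ρ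
      (9 + 1 + (100 * (height d n + 1) + 9)) fun τ =>
        τ.rarr aDist (G.tail a) = μ ∧ SearchState n A r d G τ S (insert a D) rank μ := by
    refine Runs.ite hfit (fun hb => ?_) fun hb => ?_
    all_goals simp only [BExpr.Holds, NExpr.eval, RExpr.eval] at hb
    · have hscan := hstate.scan_arc (a := a) htail
        (fun _ => ⟨hhead, Nat.one_le_iff_ne_zero.1 hb.1⟩) fun _ => hb.2
      exact Runs.skip (by omega) ⟨hμ, hscan⟩
    · exact enqueue_head_runs hiρ hstate ha htail hμ rfl rfl hnext fun hp =>
        not_le.1 fun hle => hb ⟨Nat.one_le_iff_ne_zero.2 hp, hle⟩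
  refine ((Runs.of_wp hset).seq fun τ _ hτ => hτ ▸ hrelax).le ?_
  simp only [Cmd.maxCost, NExpr.cost, RExpr.cost]
  omega

theorem relaxArc_runs (hi : SearchInput B n A r d G σ) (h : SearchState n A r d G σ S D rank μ)
    (ha : a < A) (hnode : σ.nreg rNode = G.tail a) (hnext : σ.nreg rNext = a + 1)
    (htail : G.tail a ∈ S) (hμ : σ.rarr aDist (G.tail a) = μ) :
    Runs B relaxArc σ (150 * (height d n + 1)) fun τ =>
      τ.rarr aDist (G.tail a) = μ ∧ SearchState n A r d G τ S (insert a D) rank μ := by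
  have hAlt := hi.arcs_lt
  have hopen := hi.open_le a ha
  have hfit : (BExpr.nle (.lit 1) (.read aOpen (.sub (.reg rNext) (.lit 1)))).Fits B σ := by
    simp [hnext]; omega
  refine (Runs.ite hfit (T := 40 + 100 * (height d n + 1)) (fun hb => ?_) fun hb => ?_).le ?_
  · have hmem : a ∈ G.arcs := (hi.mem_arcs a).2 ⟨ha, by simp [hnext] at hb; omega⟩
    exact relaxOpenArc_runs hi h hmem hnode hnext htail hμ
  · have hmem : a ∉ G.arcs := fun hmem => hb <| by
      simpa [hnext, Nat.one_le_iff_ne_zero] using ((hi.mem_arcs a).1 hmem).2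
    have hskip := h.scan_arc htail (fun hmem' => absurd hmem' hmem) fun hmem' => absurd hmem' hmem
    exact Runs.skip (by omega) ⟨hμ, hskip⟩
  · simp only [BExpr.cost, NExpr.cost]
    omega

theorem SearchState.mono_scanned (h : SearchState n A r d G σ S D rank μ) {D' : Set ℕ}
    (hD : D' ⊆ D) : SearchState n A r d G σ S D' rank μ :=
  { h with dijkstra := h.dijkstra.mono_scanned hD }

/-- The arcs with tail in `S` except those before `p` with tail `u`. -/
def scannedArcs (G : ArcGraph ℕ ℕ) (A : ℕ) (S : Finset ℕ) (u p : ℕ) : Set ℕ :=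
  {a | a < A ∧ G.tail a ∈ S ∧ (G.tail a = u → p ≤ a)}

theorem scannedArcs_subset_of_lastArc_eq {p : ℕ} (h : lastArc G.tail u p = a + 1) :
    scannedArcs G A S u a ⊆ insert a (scannedArcs G A S u p) := by
  rintro b ⟨hb, hS, hp⟩
  refine or_iff_not_imp_left.2 fun hne => ⟨hb, hS, fun hu => not_lt.1 fun hlt => ?_⟩
  have := hp hu
  exact tail_ne_of_lastArc_le hlt (by omega) hu

theorem subset_scannedArcs_of_lastArc_eq_zero {p : ℕ} (h : lastArc G.tail u p = 0) :
    {a | a < A ∧ G.tail a ∈ S} ⊆ scannedArcs G A S u p := fun _ hb =>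
  ⟨hb.1, hb.2, fun hu => not_lt.1 fun hlt => tail_ne_of_lastArc_le hlt (by omega) hu⟩

theorem scanStep_runs {p : ℕ} (hi : SearchInput B n A r d G σ)
    (h : SearchState n A r d G σ S (scannedArcs G A S u p) rank μ) (hp : p ≤ A) (hu : u ∈ S)
    (hnode : σ.nreg rNode = u) (hnext : σ.nreg rNext = a + 1) (hlast : lastArc G.tail u p = a + 1)
    (hμ : σ.rarr aDist u = μ) :
    Runs B scanStep σ (150 * (height d n + 1) + 6) fun τ =>
      τ.nreg rNext = lastArc G.tail u a ∧ τ.rarr aDist u = μ ∧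
      SearchState n A r d G τ S (scannedArcs G A S u a) rank μ := by
  have hAlt := hi.arcs_lt
  have haA : a < A := by have := lastArc_le G.tail u p; omega
  have hle := lastArc_le G.tail u a
  have htail := tail_of_lastArc_eq hlast
  rw [← htail] at hu hnode hμ
  refine ((relaxArc_runs hi h haA hnode hnext hu hμ).seq fun τ hF hτ =>
    Runs.of_wp (Q := fun τ => τ.nreg rNext = lastArc G.tail u a ∧ τ.rarr aDist u = μ ∧
      SearchState n A r d G τ S (scannedArcs G A S u a) rank μ) ?_).le
    (by simp only [Cmd.maxCost, NExpr.cost]; omega)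
  have hnextτ := (hF.nreg rNext rfl).trans hnext
  have hread : τ.narr aNext a = lastArc G.tail u a :=
    htail ▸ (hi.of_frame hF rfl).next_eq a haA
  refine ⟨by simp [hnextτ]; omega, by simp [hnextτ, hread], htail ▸ hτ.1, ?_⟩
  exact (hτ.2.mono_scanned (scannedArcs_subset_of_lastArc_eq hlast)).congr rfl rfl rfl rfl

theorem scan_runs (hi : SearchInput B n A r d G σ)
    (h : SearchState n A r d G σ S (scannedArcs G A S u A) rank μ) (hu : u ∈ S) (hun : u < n)
    (hnode : σ.nreg rNode = u) (hμ : σ.rarr aDist u = μ) :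
    Runs B scan σ (numArcs G.tail u A * (200 * (height d n + 1)) + 10) fun τ =>
      SearchState n A r d G τ S {a | a < A ∧ G.tail a ∈ S} rank μ := by
  have hlt := hi.lt
  have hAlt := hi.arcs_lt
  have hlast := hi.last_eq u hun
  have hlast_le := lastArc_le G.tail u A
  set I : ℕ → State → Prop := fun k τ => ∃ p ≤ A, numArcs G.tail u p ≤ k ∧
    τ.nreg rNext = lastArc G.tail u p ∧ τ.rarr aDist u = μ ∧
    SearchState n A r d G τ S (scannedArcs G A S u p) rank μ
  have hset : (Cmd.setN rNext (.read aLast (.reg rNode))).wp B (I (numArcs G.tail u A)) σ := by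
    refine ⟨by simp [hnode]; omega, A, le_rfl, le_rfl, ?_, hμ, h.congr rfl rfl rfl rfl⟩
    simp [hnode, hlast]
  refine ((Runs.of_wp hset).seq fun τ hF hτ =>
    Runs.loop_const I (150 * (height d n + 1) + 6) ?_ hτ).le ?_
  · rintro k υ hFυ ⟨p, hp, hk, hnext, hμυ, hυ⟩
    have hple := lastArc_le G.tail u p
    refine ⟨by simp; omega, fun hb => ?_, fun hb => ?_⟩
    · obtain ⟨a, ha⟩ : ∃ a, lastArc G.tail u p = a + 1 :=
        Nat.exists_eq_add_one.2 <| by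
          simpa only [BExpr.Holds, NExpr.eval, hnext, Nat.one_le_iff_ne_zero, Nat.pos_iff_ne_zero]
            using hb
      have hnum := numArcs_lt_of_lastArc_eq ha
      refine (scanStep_runs ((hi.of_frame hF rfl).of_frame hFυ rfl) hυ hp hu
        ((hFυ.nreg _ rfl).trans ((hF.nreg _ rfl).trans hnode)) (hnext.trans ha) ha hμυ).mono
          le_rfl fun τ' _ hτ' => ⟨k - 1, by omega, a, by omega, by omega, hτ'⟩
    · have hzero : lastArc G.tail u p = 0 := by simpa [hnext] using hb
      exact hυ.mono_scanned (subset_scannedArcs_of_lastArc_eq_zero hzero)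
  · simp only [Cmd.maxCost, BExpr.cost, NExpr.cost]
    nlinarith

theorem SearchState.settle (h : SearchState n A r d G σ S D rank μ) (hu : u < n)
    (hwin : σ.narr aWin 0 = u) (hqueued : σ.narr aQueued u ≠ 0) (hd : 2 ≤ d)
    (hτqueued : τ.narr aQueued = update (σ.narr aQueued) u 0)
    (hτparent : τ.narr aParent = σ.narr aParent) (hτdist : τ.rarr aDist = σ.rarr aDist)
    (hτwin : IsTournament n d (queueKey τ) (τ.narr aWin) ∅) :
    SearchState n A r d G τ (insert u S) D (update rank u S.card) (σ.rarr aDist u) := by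
  obtain ⟨hreached, huS⟩ := (h.queued_iff u hu).1 hqueued
  have hmin : ∀ v ∈ (pathLabels n (σ.narr aParent) (σ.rarr aDist)).reached, v ∉ S →
      σ.rarr aDist u ≤ σ.rarr aDist v := fun v hv hvS => by
    have hle := h.tournament.root_le hd hv.1
    rw [hwin, queueKey, if_neg hqueued, queueKey,
      if_neg ((h.queued_iff v hv.1).2 ⟨hv.2, hvS⟩)] at hle
    exact WithTop.coe_le_coe.1 hle
  refine ⟨?_, hτwin, fun v hv => ?_, fun v hv => ?_, fun v hv => ?_⟩
  · rw [hτparent, hτdist]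
    exact h.dijkstra.settle ⟨hu, hreached⟩ huS hmin
  all_goals rcases eq_or_ne v u with rfl | e
  · simp [hτqueued]
  · simpa [hτqueued, e] using h.queued_le v hv
  · simp [hτqueued]
  · simpa [hτqueued, hτparent, e] using h.queued_iff v hv
  all_goals exact hτparent ▸ h.parent_le _ hv

theorem scannedArcs_insert_subset :
    scannedArcs G A (insert u S) u A ⊆ {a | a < A ∧ G.tail a ∈ S} := fun _ ⟨ha, hS, hle⟩ =>
  ⟨ha, (Finset.mem_insert.1 hS).resolve_left fun e => (hle e).not_gt ha⟩

theorem settle_runs (hi : SearchInput B n A r d G σ)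
    (h : SearchState n A r d G σ S {a | a < A ∧ G.tail a ∈ S} rank μ)
    (hwin : σ.narr aWin 0 = u) (hqueued : σ.narr aQueued u ≠ 0) :
    Runs B settle σ ((d + 1 + numArcs G.tail u A) * (200 * (height d n + 1)) + 20) fun τ =>
      SearchState n A r d G τ (insert u S) {a | a < A ∧ G.tail a ∈ insert u S}
        (update rank u S.card) (σ.rarr aDist u) := by
  have hlt := hi.lt
  have hu : u < n := hwin ▸ h.tournament.lt 0 (Nat.zero_lt_of_lt hi.source_lt)
  set ρ := (σ.setN rNode u).storeN aQueued u 0 with hρ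
  have hset : (Cmd.setN rNode (.read aWin (.lit 0)) ;;
      Cmd.storeN aQueued (.reg rNode) (.lit 0)).wp B (fun τ => τ = ρ) σ := by
    simp [hwin, hρ]; omega
  have hiρ : SearchInput B n A r d G ρ := { hi with }
  have hq : QueueMemory B n d ρ := hiρ.queueMemory fun v hv => by
    rcases eq_or_ne v u with rfl | e
    · simp [hρ]
    · simpa [hρ, e] using h.queued_le v hv
  have hT : IsTournament n d (queueKey ρ) (ρ.narr aWin) (treePath d u) :=
    h.tournament.of_key_eq_off fun x hx => by simp [hρ, queueKey, hx]
  have hscan : Runs B (rebuild ;; scan) ρ (200 * (d + 1) * (height d n + 1) +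
      (numArcs G.tail u A * (200 * (height d n + 1)) + 10)) fun τ =>
      SearchState n A r d G τ (insert u S) {a | a < A ∧ G.tail a ∈ insert u S}
        (update rank u S.card) (σ.rarr aDist u) := by
    refine (rebuild_runs hq hu (by simp [hρ]) hT).seq fun τ hF hτ => ?_
    have hkey : queueKey τ = queueKey ρ :=
      queueKey_congr (hF.narr aQueued rfl) (hF.rarr aDist rfl)
    have hsettled := h.settle (τ := τ) hu hwin hqueued hi.two_le
      (hF.narr aQueued rfl ▸ by simp [hρ]) (hF.narr aParent rfl) (hF.rarr aDist rfl) (hkey ▸ hτ)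
    refine scan_runs (hiρ.of_frame hF rfl)
      (hsettled.mono_scanned scannedArcs_insert_subset) (Finset.mem_insert_self u S) hu
      ((hF.nreg rNode rfl).trans (by simp [hρ])) ?_
    rw [hF.rarr aDist rfl]
    rfl
  refine ((Runs.of_wp hset).seq fun τ _ hτ => hτ ▸ hscan).le ?_
  simp only [Cmd.maxCost, NExpr.cost]
  nlinarith

theorem SearchState.isSearchResult (hi : SearchInput B n A r d G σ)
    (h : SearchState n A r d G σ S {a | a < A ∧ G.tail a ∈ S} rank μ)
    (hempty : σ.narr aQueued (σ.narr aWin 0) = 0) : IsSearchResult n A r G rank σ := by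
  have hmem : ∀ v < n, σ.narr aParent v ≠ 0 → v ∈ S := fun v hv hp => by
    by_contra hvS
    have hle := h.tournament.root_le hi.two_le hv
    rw [queueKey, if_pos hempty, queueKey, if_neg ((h.queued_iff v hv).2 ⟨hp, hvS⟩)] at hle
    exact WithTop.not_top_le_coe _ hle
  have hcard : S.card ≤ n := by
    simpa using Finset.card_le_card (t := Finset.range n) fun v hv =>
      Finset.mem_range.2 (h.dijkstra.settled_subset v hv).1
  exact ⟨h.dijkstra.isShortestPathTree (fun v hv => hmem v hv.1 hv.2) fun a ha hS =>
    ⟨((hi.mem_arcs a).1 ha).1, hS⟩, fun v hv hp =>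
    (h.dijkstra.rank_lt_card v (hmem v hv hp)).trans_le hcard, h.parent_le⟩

/-- A budget for settling the vertices outside `S` and scanning their arcs, in units of the
height of the tournament. -/
def searchWork (n d A : ℕ) (tail : ℕ → ℕ) (S : Finset ℕ) : ℕ :=
  ∑ v ∈ Finset.range n \ S, (d + 1 + numArcs tail v A)

theorem searchWork_empty {tail : ℕ → ℕ} (h : ∀ a < A, tail a < n) :
    searchWork n d A tail ∅ = n * (d + 1) + A := by
  simp [searchWork, Finset.sum_add_distrib, sum_numArcs h]

theorem searchWork_insert {tail : ℕ → ℕ} (hu : u < n) (huS : u ∉ S) :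
    d + 1 + numArcs tail u A + searchWork n d A tail (insert u S) = searchWork n d A tail S := by
  rw [searchWork, Finset.sdiff_insert]
  exact Finset.add_sum_erase _ (fun v => d + 1 + numArcs tail v A)
    (Finset.mem_sdiff.2 ⟨Finset.mem_range.2 hu, huS⟩)

theorem settleAll_runs (hi : SearchInput B n A r d G σ)
    (h : SearchState n A r d G σ ∅ ∅ rank μ) :
    Runs B settleAll σ ((n * (d + 1) + A) * (300 * (height d n + 1)) + 10) fun τ =>
      ∃ rank, IsSearchResult n A r G rank τ := by
  set work : Finset ℕ → ℕ := searchWork n d A G.tail with hwork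
  have hlt := hi.lt
  have hn := hi.source_lt
  refine (Runs.loop (fun k τ => ∃ S rank μ,
    SearchState n A r d G τ S {a | a < A ∧ G.tail a ∈ S} rank μ ∧
      work S * (300 * (height d n + 1)) ≤ k) ?_ (k := work ∅ * (300 * (height d n + 1)))
    ⟨∅, rank, μ, h.mono_scanned fun a ha => absurd ha.2 (Finset.notMem_empty _), le_rfl⟩).le ?_
  · rintro k τ hF ⟨S, rank, μ, hS, hk⟩
    have hu : τ.narr aWin 0 < n := hS.tournament.lt 0 (Nat.zero_lt_of_lt hn)
    have hq := hS.queued_le _ hu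
    have hiτ : SearchInput B n A r d G τ := hi.of_frame hF rfl
    refine ⟨by simp; omega, fun hb => ?_, fun hb => ⟨rank, hS.isSearchResult hiτ ?_⟩⟩
    · have hqueued : τ.narr aQueued (τ.narr aWin 0) ≠ 0 := Nat.one_le_iff_ne_zero.1 hb
      refine ⟨_, (settle_runs hiτ hS rfl hqueued).mono le_rfl
        fun υ _ hυ => ⟨_, ?_, _, _, _, hυ, le_rfl⟩⟩
      have hinsert := searchWork_insert (d := d) (A := A) (tail := G.tail) hu
        ((hS.queued_iff _ hu).1 hqueued).2
      rw [hwork, ← hinsert] at hk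
      simp only [BExpr.cost, NExpr.cost]
      nlinarith
    · simpa using hb
  · simp only [hwork, searchWork_empty hi.tail_lt, BExpr.cost, NExpr.cost]
    omega

theorem clearQueue_runs (hi : SearchInput B n A r d G σ) :
    Runs B clearQueue σ (n * 30 + 10) fun τ => ∀ v < n,
      τ.narr aQueued v = 0 ∧ τ.narr aParent v = 0 ∧ τ.narr aWin v = v := by
  have hlt := hi.lt
  have hn := hi.nodes
  refine (Runs.forBelow (c := 15) (fun i τ => ∀ v < i,
    τ.narr aQueued v = 0 ∧ τ.narr aParent v = 0 ∧ τ.narr aWin v = v) (by decide) rfl rfl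
    (by omega) (by simp) fun i hin τ _ hx hτ => ?_).mono (by omega) fun τ _ hτ => hn ▸ hτ
  refine (Runs.of_wp ?_).le (by simp [Cmd.maxCost, NExpr.cost])
  have hB : 0 < B := by omega
  have hiB : i < B := by omega
  simp only [Cmd.wp, NExpr.Fits, NExpr.eval, State.storeN_nreg, hx, hB, hiB, true_and]
  intro v hv
  rcases eq_or_ne v i with rfl | e
  · simp
  · simpa [e] using hτ v (by omega)

theorem enqueueSource_runs (hi : SearchInput B n A r d G σ)
    (h : ∀ v < n, σ.narr aQueued v = 0 ∧ σ.narr aParent v = 0 ∧ σ.narr aWin v = v) :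
    Runs B enqueueSource σ (150 * (height d n + 1)) fun τ =>
      SearchState n A r d G τ ∅ ∅ 0 0 := by
  have hlt := hi.lt
  have hAlt := hi.arcs_lt
  have hr := hi.source_lt
  set ρ := ((σ.setN rPlayer r).setR rDist 0).setN rNext (A + 1) with hρ
  have hset : (Cmd.setN rPlayer (.reg rVia) ;; Cmd.setR rDist .zero ;;
      Cmd.setN rNext (.add (.reg rArcs) (.lit 1))).wp B (fun τ => τ = ρ) σ := by
    simp [hi.source, hi.arcs, hρ]; omega
  have hkey : ∀ v < n, queueKey ρ v = ⊤ := fun v hv => by simp [queueKey, hρ, (h v hv).1]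
  have hT : IsTournament n d (queueKey ρ) (ρ.narr aWin) ∅ := by
    have hwin : ∀ v < n, ρ.narr aWin v = v := fun v hv => (h v hv).2.2
    refine ⟨fun v hv => (hwin v hv).symm ▸ hv, fun v hv => ?_, fun v hv _ => ?_, fun c hc _ => ?_⟩
    · rw [hwin v hv]
      exact self_mem_treePath d v
    · rw [hkey _ ((hwin v hv).symm ▸ hv), hkey v hv]
    · rw [hwin c hc, hkey c hc]
      exact le_top
  have henqueue : Runs B enqueue ρ (100 * (height d n + 1) + 9) fun τ =>
      SearchState n A r d G τ ∅ ∅ 0 0 := by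
    have hq : QueueMemory B n d ρ :=
      ⟨hi.nodes, hi.arity, hi.two_le, hlt, fun v hv => (h v hv).1.trans_le zero_le_one⟩
    refine (enqueue_runs hq hT hr rfl (by simp [hρ]; omega) (hkey r hr ▸ le_top)).mono le_rfl
      fun τ _ ⟨hqueued, hparent, hdist, hτ⟩ => ?_
    have hparentτ : τ.narr aParent = update (σ.narr aParent) r (A + 1) := hparent
    have hqueuedτ : τ.narr aQueued = update (σ.narr aQueued) r 1 := hqueued
    refine ⟨.initial ?_ (by simp [pathLabels, hdist, hρ]), hτ, fun v hv => ?_, fun v hv => ?_,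
      fun v hv => ?_⟩
    · refine Set.eq_singleton_iff_unique_mem.2 ⟨⟨hr, by simp [hparentτ]⟩, fun v hv => ?_⟩
      by_contra e
      exact hv.2 (by simp [hparentτ, e, (h v hv.1).2.1])
    all_goals
      obtain ⟨_, _, -⟩ := h v hv
      rcases eq_or_ne v r with rfl | e <;> simp [*]
  refine ((Runs.of_wp hset).seq fun τ _ hτ => hτ ▸ henqueue).le ?_
  simp only [Cmd.maxCost, NExpr.cost, RExpr.cost]
  omega

theorem search_runs (hi : SearchInput B n A r d G σ) :
    Runs B search σ ((n * (d + 1) + A + 1) * (500 * (height d n + 1))) fun τ =>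
      ∃ rank, IsSearchResult n A r G rank τ := by
  refine ((clearQueue_runs hi).seq fun τ hF hτ =>
    (enqueueSource_runs (hi.of_frame hF rfl) hτ).seq fun υ hF' hυ =>
    settleAll_runs ((hi.of_frame hF rfl).of_frame hF' rfl) hυ).le ?_
  have hn : n ≤ n * (d + 1) + A := by nlinarith
  have hmul : n * (d + 1) + A ≤ (n * (d + 1) + A) * (height d n + 1) :=
    Nat.le_mul_of_pos_right _ (Nat.succ_pos _)
  nlinarith

end search

def openArc (c : RExpr) : Cmd :=
  .storeN aOpen (.reg rCount) (.lit 1) ;; .storeR aReduced (.reg rCount) c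

def residualStep : Cmd :=
  .ite (.rle .one (.read aFlow (.read aRev (.reg rCount))))
    (openArc (.sub
      (.sub (.read aPot (.read aTail (.reg rCount))) (.read aPot (.read aHead (.reg rCount))))
      (.read aWeight (.reg rCount))))
    (.ite (.rle (.add (.read aFlow (.reg rCount)) .one) (.read aCap (.reg rCount)))
      (openArc (.add
        (.sub (.read aPot (.read aTail (.reg rCount))) (.read aPot (.read aHead (.reg rCount))))
        (.read aWeight (.reg rCount))))
      (.storeN aOpen (.reg rCount) (.lit 0)))

/-- Computes the residual network. -/
def residual : Cmd :=
  .forBelow rCount rArcs residualStep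

/-- Sends one unit of flow along a residual arc. -/
def pushArc : Cmd :=
  .ite (.rle .one (.read aFlow (.read aRev (.reg rArc))))
    (.storeR aFlow (.read aRev (.reg rArc))
      (.sub (.read aFlow (.read aRev (.reg rArc))) .one))
    (.storeR aFlow (.reg rArc) (.add (.read aFlow (.reg rArc)) .one))

def traceStep : Cmd :=
  .setN rArc (.sub (.read aParent (.reg rPlayer)) (.lit 1)) ;; pushArc ;;
  .setN rPlayer (.read aTail (.reg rArc))

/-- Sends one unit of flow along the path of the shortest path tree that ends in the target,
following it backwards. -/
def trace : Cmd :=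
  .setN rPlayer (.reg rTarget) ;;
  .loop (.not (.and (.nle (.reg rPlayer) (.reg rVia)) (.nle (.reg rVia) (.reg rPlayer)))) traceStep

def raisePotentialStep : Cmd :=
  .ite (.and (.nle (.lit 1) (.read aParent (.reg rCount)))
      (.rle (.read aDist (.reg rCount)) (.reg rDist)))
    (.storeR aPot (.reg rCount) (.add (.read aPot (.reg rCount)) (.read aDist (.reg rCount))))
    (.storeR aPot (.reg rCount) (.add (.read aPot (.reg rCount)) (.reg rDist)))

/-- Raises the potential by the distances, capped at that of the target. -/
def raisePotential : Cmd :=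
  .setR rDist (.read aDist (.reg rTarget)) ;;
  .forBelow rCount rNodes raisePotentialStep

/-- Computes the shortest paths of the residual network. -/
def findPaths : Cmd :=
  residual ;; search

/-- Sends one unit of flow along the shortest path to the target. -/
def augment : Cmd :=
  trace ;; raisePotential

/-- The memory holds the network `G` on the vertices below `n` with the arcs below `A`, and `w` is
the vertex from which paths are searched. -/
structure NetworkMemory (B n A w d : ℕ) (G : ArcNetwork ℕ ℕ) (σ : State) : Prop where
  nodes : σ.nreg rNodes = n
  via : σ.nreg rVia = w
  arity : σ.nreg rArity = d
  arcs : σ.nreg rArcs = A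
  two_le : 2 ≤ d
  lt : n + d * n + d + 2 < B
  arcs_lt : A + 2 < B
  via_lt : w < n
  arcs_eq : G.arcs = Finset.range A
  tail_eq : σ.narr aTail = G.tail
  head_eq : σ.narr aHead = G.head
  rev_eq : σ.narr aRev = G.rev
  cap_eq : σ.rarr aCap = G.cap
  weight_eq : σ.rarr aWeight = G.weight
  tail_lt : ∀ a < A, G.tail a < n
  last_eq : ∀ v < n, σ.narr aLast v = lastArc G.tail v A
  next_eq : ∀ a < A, σ.narr aNext a = lastArc G.tail (G.tail a) a

/-- The program does not write where `NetworkMemory` reads. -/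
def Cmd.keepsNetwork (P : Cmd) : Bool :=
  !P.writesN rNodes && !P.writesN rVia && !P.writesN rArity && !P.writesN rArcs &&
    !P.storesN aTail && !P.storesN aHead && !P.storesN aRev && !P.storesN aNext &&
    !P.storesN aLast && !P.storesR aCap && !P.storesR aWeight

/-- The memory holds the flow `g` and a potential that witnesses that it is of minimum cost. -/
structure FlowMemory (A : ℕ) (G : ArcNetwork ℕ ℕ) (g : ℕ → ℕ) (σ : State) : Prop where
  flow_eq : ∀ a < A, σ.rarr aFlow a = g a
  isFeasible : G.IsFeasible g
  isLinkOptimal : G.IsLinkOptimal (σ.rarr aPot) g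

/-- The memory holds the residual arc `a` of the flow `g`, or the fact that it is not one. -/
structure HoldsResidualArc (G : ArcNetwork ℕ ℕ) (π : ℕ → ℝ) (g : ℕ → ℕ) (a : ℕ) (σ : State) :
    Prop where
  open_le : σ.narr aOpen a ≤ 1
  open_iff : σ.narr aOpen a ≠ 0 ↔ G.HasResidual g a
  reduced_eq : G.HasResidual g a → σ.rarr aReduced a = G.reducedCost π g a

section Flow

open Function

variable {B n A w d a v x : ℕ} {G : ArcNetwork ℕ ℕ} {P : Cmd} {σ τ : State} {g : ℕ → ℕ}
  {π : ℕ → ℝ} {rank : ℕ → ℕ}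

theorem NetworkMemory.of_frame (h : NetworkMemory B n A w d G σ) (hF : Frame P σ τ)
    (hP : P.keepsNetwork = true) : NetworkMemory B n A w d G τ := by
  simp only [Cmd.keepsNetwork, Bool.and_eq_true, Bool.not_eq_true'] at hP
  obtain ⟨⟨⟨⟨⟨⟨⟨⟨⟨⟨hn, hw⟩, hd⟩, hA⟩, ht⟩, hh⟩, hr⟩, hx⟩, hl⟩, hc⟩, hwt⟩ := hP
  exact ⟨(hF.nreg _ hn).trans h.nodes, (hF.nreg _ hw).trans h.via, (hF.nreg _ hd).trans h.arity,
    (hF.nreg _ hA).trans h.arcs, h.two_le, h.lt, h.arcs_lt, h.via_lt, h.arcs_eq,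
    (hF.narr _ ht).trans h.tail_eq, (hF.narr _ hh).trans h.head_eq, (hF.narr _ hr).trans h.rev_eq,
    (hF.rarr _ hc).trans h.cap_eq, (hF.rarr _ hwt).trans h.weight_eq, h.tail_lt,
    hF.narr _ hl ▸ h.last_eq, hF.narr _ hx ▸ h.next_eq⟩

theorem NetworkMemory.mem_arcs (h : NetworkMemory B n A w d G σ) : a ∈ G.arcs ↔ a < A := by
  rw [h.arcs_eq, Finset.mem_range]

theorem NetworkMemory.rev_lt (h : NetworkMemory B n A w d G σ) (ha : a < A) : G.rev a < A :=
  h.mem_arcs.1 (G.rev_mem a (h.mem_arcs.2 ha))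

theorem NetworkMemory.head_lt (h : NetworkMemory B n A w d G σ) (ha : a < A) : G.head a < n :=
  G.tail_rev a (h.mem_arcs.2 ha) ▸ h.tail_lt _ (h.rev_lt ha)

theorem FlowMemory.congr (h : FlowMemory A G g σ) (hpot : τ.rarr aPot = σ.rarr aPot)
    (hflow : τ.rarr aFlow = σ.rarr aFlow) : FlowMemory A G g τ :=
  ⟨hflow ▸ h.flow_eq, h.isFeasible, hpot ▸ h.isLinkOptimal⟩

theorem HoldsResidualArc.congr (h : HoldsResidualArc G π g a σ)
    (hopen : τ.narr aOpen a = σ.narr aOpen a) (hreduced : τ.rarr aReduced a = σ.rarr aReduced a) :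
    HoldsResidualArc G π g a τ :=
  ⟨hopen ▸ h.open_le, hopen ▸ h.open_iff, hreduced ▸ h.reduced_eq⟩

theorem openArc_wp {c : RExpr} {Q : State → Prop} (ha : a + 1 < B) (hcount : σ.nreg rCount = a)
    (hfit : c.Fits B (σ.storeN aOpen a 1))
    (h : Q ((σ.storeN aOpen a 1).storeR aReduced a (c.eval (σ.storeN aOpen a 1)))) :
    (openArc c).wp B Q σ := by
  simp only [openArc, Cmd.wp, NExpr.Fits, NExpr.eval, State.storeN_nreg, hcount]
  exact ⟨by omega, by omega, by omega, hfit, h⟩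

theorem residualStep_runs (hN : NetworkMemory B n A w d G σ) (hflow : ∀ a < A, σ.rarr aFlow a = g a)
    (ha : a < A) (hcount : σ.nreg rCount = a) :
    Runs B residualStep σ 60 fun τ => HoldsResidualArc G (σ.rarr aPot) g a τ ∧
      ∀ b ≠ a, τ.narr aOpen b = σ.narr aOpen b ∧ τ.rarr aReduced b = σ.rarr aReduced b := by
  have hlt := hN.lt
  have hAlt := hN.arcs_lt
  have haB : a < B := by omega
  have htail : G.tail a < B := by have := hN.tail_lt a ha; omega
  have hhead : G.head a < B := by have := hN.head_lt ha; omega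
  have hrev := hN.rev_lt ha
  have hopen (hres : G.HasResidual g a) {c : ℝ} (hc : c = G.reducedCost (σ.rarr aPot) g a) :
      HoldsResidualArc G (σ.rarr aPot) g a ((σ.storeN aOpen a 1).storeR aReduced a c) ∧
        ∀ b ≠ a, ((σ.storeN aOpen a 1).storeR aReduced a c).narr aOpen b = σ.narr aOpen b ∧
          ((σ.storeN aOpen a 1).storeR aReduced a c).rarr aReduced b = σ.rarr aReduced b :=
    ⟨⟨by simp, by simp [hres], by simp [hc]⟩, fun b hb => by simp [hb]⟩
  refine (Runs.of_wp ?_).le (show Cmd.maxCost _ ≤ 60 by decide)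
  refine ⟨by simp [hcount, hN.rev_eq]; omega, fun hback => ?_, fun hback =>
    ⟨by simp [hcount]; omega, fun hforth => ?_, fun hforth => ?_⟩⟩
  all_goals
    simp only [BExpr.Holds, RExpr.eval, NExpr.eval, hcount, hN.rev_eq, hflow _ hrev,
      Nat.one_le_cast] at hback
  · have hred : G.reducedCost (σ.rarr aPot) g a =
        σ.rarr aPot (G.tail a) - σ.rarr aPot (G.head a) - G.weight a := by
      rw [ArcNetwork.reducedCost, if_pos hback]
      ring
    refine openArc_wp (by omega) hcount ?_ (hopen (.inl hback) ?_)
    · simp [hcount, hN.tail_eq, hN.head_eq, haB, htail, hhead]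
    · simp [hcount, hN.tail_eq, hN.head_eq, hN.weight_eq, hred]
  all_goals
    simp only [BExpr.Holds, RExpr.eval, NExpr.eval, hcount, hN.cap_eq, hflow a ha] at hforth
  · have hred : G.reducedCost (σ.rarr aPot) g a =
        σ.rarr aPot (G.tail a) - σ.rarr aPot (G.head a) + G.weight a := by
      rw [ArcNetwork.reducedCost, if_neg hback]
      ring
    refine openArc_wp (by omega) hcount ?_ (hopen (.inr hforth) ?_)
    · simp [hcount, hN.tail_eq, hN.head_eq, haB, htail, hhead]
    · simp [hcount, hN.tail_eq, hN.head_eq, hN.weight_eq, hred]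
  · have hres : ¬ G.HasResidual g a := not_or.2 ⟨hback, hforth⟩
    refine ⟨by simpa [hcount], by simp; omega, ⟨?_, ?_, ?_⟩, fun b hb => ?_⟩ <;> simp [*]
theorem residual_runs (hN : NetworkMemory B n A w d G σ) (hflow : ∀ a < A, σ.rarr aFlow a = g a) :
    Runs B residual σ (80 * A + 10) fun τ => ∀ a < A, HoldsResidualArc G (σ.rarr aPot) g a τ := by
  have hA := hN.arcs
  have hAlt := hN.arcs_lt
  refine (Runs.forBelow (c := 60) (fun i τ => ∀ a < i, HoldsResidualArc G (σ.rarr aPot) g a τ)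
    (by decide) rfl rfl (by omega) (by simp) fun i hi τ hF hx hτ => ?_).mono (by omega)
    fun τ _ hτ => hA ▸ hτ
  have hpot := hF.rarr aPot rfl
  refine (residualStep_runs (hN.of_frame hF rfl) (hF.rarr aFlow rfl ▸ hflow) (hA ▸ hi)
    hx).mono le_rfl fun υ _ ⟨hυi, hυ⟩ a ha => ?_
  rcases eq_or_ne a i with rfl | e
  · exact (hpot ▸ hυi).congr rfl rfl
  · exact (hτ a (by omega)).congr (hυ a e).1 (hυ a e).2

theorem NetworkMemory.searchInput (hN : NetworkMemory B n A w d G σ) (hg : G.IsFeasible g)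
    (hopt : G.IsLinkOptimal π g) (h : ∀ a < A, HoldsResidualArc G π g a σ) :
    SearchInput B n A w d (G.residual π g) σ :=
  { hN with
    source := hN.via
    source_lt := hN.via_lt
    head_lt := fun _ => hN.head_lt
    open_le := fun a ha => (h a ha).open_le
    mem_arcs := fun a => (and_congr_left' hN.mem_arcs).trans <|
      and_congr_right fun ha => (h a ha).open_iff.symm
    length_eq := fun a ha => (h a (hN.mem_arcs.1 ha.1)).reduced_eq ha.2
    length_nonneg := fun _ ha => hopt.reducedCost_nonneg hg ha.1 ha.2 }

theorem findPaths_runs (hN : NetworkMemory B n A w d G σ) (hg : FlowMemory A G g σ) :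
    Runs B findPaths σ ((n * (d + 1) + A + 1) * (600 * (height d n + 1))) fun τ =>
      ∃ rank, IsSearchResult n A w (G.residual (σ.rarr aPot) g) rank τ := by
  refine ((residual_runs hN hg.flow_eq).seq fun τ hF hτ =>
    search_runs ((hN.of_frame hF rfl).searchInput hg.isFeasible hg.isLinkOptimal hτ)).le ?_
  have hA : A ≤ n * (d + 1) + A := Nat.le_add_left _ _
  nlinarith

/-- The memory holds the labels `L` and an augmentation of `g` along the part from `v` on of the
path that `L` describes to `x`. -/
structure TraceState (n A : ℕ) (G : ArcNetwork ℕ ℕ) (π : ℕ → ℝ) (L : PathLabels ℕ ℕ)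
    (rank : ℕ → ℕ) (g : ℕ → ℕ) (x v : ℕ) (σ : State) : Prop where
  labels_eq : pathLabels n (σ.narr aParent) (σ.rarr aDist) = L
  player : σ.nreg rPlayer = v
  mem_reached : v ∈ L.reached
  dist_le : L.dist v ≤ L.dist x
  flow : ∃ g', (∀ a < A, σ.rarr aFlow a = g' a) ∧
    G.IsPartialAugmentation (ArcNetwork.raise π L (L.dist x)) rank g x v g'

theorem pushArc_runs (hN : NetworkMemory B n A w d G σ) (hflow : ∀ a < A, σ.rarr aFlow a = g a)
    (ha : a < A) (harc : σ.nreg rArc = a) :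
    Runs B pushArc σ 25 fun τ => ∀ b < A, τ.rarr aFlow b = G.push g a b := by
  have hAlt := hN.arcs_lt
  have hrev := hN.rev_lt ha
  have haB : a < B := by omega
  have hrevB : G.rev a < B := by omega
  refine (Runs.of_wp ?_).le (show Cmd.maxCost _ ≤ 25 by decide)
  refine ⟨by simp [harc, hN.rev_eq, haB, hrevB], fun hback => ?_, fun hback => ?_⟩
  all_goals
    simp only [BExpr.Holds, RExpr.eval, NExpr.eval, harc, hN.rev_eq, hflow _ hrev,
      Nat.one_le_cast] at hback
  · refine ⟨by simp [harc, haB, hN.rev_eq, hrevB], by simp [harc, haB, hN.rev_eq, hrevB],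
      fun b hb => ?_⟩
    rcases eq_or_ne b (G.rev a) with rfl | e
    · simp [ArcNetwork.push, harc, hN.rev_eq, hback, hflow _ hb]
    · simp [ArcNetwork.push, harc, hN.rev_eq, hback, hflow _ hb, e]
  · refine ⟨by simp [harc, haB], by simp [harc, haB], fun b hb => ?_⟩
    rcases eq_or_ne b a with rfl | e
    · simp [ArcNetwork.push, harc, hback, hflow _ hb]
    · simp [ArcNetwork.push, harc, hback, hflow _ hb, e]

theorem traceStep_runs {L : PathLabels ℕ ℕ} (hN : NetworkMemory B n A w d G σ)
    (hT : (G.residual π g).IsShortestPathTree w L rank) (hg : G.IsFeasible g)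
    (hopt : G.IsLinkOptimal π g) (h : TraceState n A G π L rank g x v σ) (hv : v ≠ w) :
    Runs B traceStep σ 40 (TraceState n A G π L rank g x (G.tail (L.parent v))) := by
  have hlt := hN.lt
  have hAlt := hN.arcs_lt
  obtain ⟨g', hflow, hg'⟩ := h.flow
  have hvL := h.mem_reached
  obtain ⟨harc, hres⟩ := hT.parent_mem v hvL hv
  have ha := hN.mem_arcs.1 harc
  have htailn := hN.tail_lt _ ha
  have hcost : 0 ≤ G.reducedCost π g (L.parent v) := hopt.reducedCost_nonneg hg harc hres
  have hdist : L.dist v = L.dist (G.tail (L.parent v)) + G.reducedCost π g (L.parent v) :=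
    hT.dist_eq v hvL hv
  have hvn : v < n := by rw [← h.labels_eq] at hvL; exact hvL.1
  have hparent : σ.narr aParent v = L.parent v + 1 := by
    have hne : σ.narr aParent v ≠ 0 := by rw [← h.labels_eq] at hvL; exact hvL.2
    rw [← h.labels_eq]
    exact (Nat.succ_pred hne).symm
  set ρ := σ.setN rArc (L.parent v) with hρ
  have hset : (Cmd.setN rArc (.sub (.read aParent (.reg rPlayer)) (.lit 1))).wp B
      (fun τ => τ = ρ) σ := by
    simp [h.player, hparent, hρ]; omega
  have hpush : Runs B (pushArc ;; .setN rPlayer (.read aTail (.reg rArc))) ρ (25 + 3)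
      (TraceState n A G π L rank g x (G.tail (L.parent v))) := by
    have hNρ : NetworkMemory B n A w d G ρ := { hN with }
    refine (pushArc_runs hNρ hflow ha rfl).seq fun τ hF hτ => Runs.of_wp ?_
    have htail : τ.narr aTail = G.tail := (hNρ.of_frame hF rfl).tail_eq
    have harcτ : τ.nreg rArc = L.parent v := hF.nreg rArc rfl
    have hlabels : pathLabels n (τ.narr aParent) (τ.rarr aDist) = L := by
      rw [hF.narr aParent rfl, hF.rarr aDist rfl]
      exact h.labels_eq
    refine ⟨by simp [htail, harcτ]; omega, hlabels, by simp [htail, harcτ],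
      hT.tail_mem v hvL hv, by linarith [h.dist_le], _, hτ,
      hg'.push_parent hT hcost hvL hv h.dist_le⟩
  refine ((Runs.of_wp hset).seq fun τ _ hτ => hτ ▸ hpush).le ?_
  simp only [Cmd.maxCost, NExpr.cost]
  omega

theorem trace_runs (hN : NetworkMemory B n A w d G σ)
    (hS : IsSearchResult n A w (G.residual (σ.rarr aPot) g) rank σ) (hg : FlowMemory A G g σ)
    (htarget : σ.nreg rTarget = x)
    (hx : x ∈ (pathLabels n (σ.narr aParent) (σ.rarr aDist)).reached) :
    Runs B trace σ (60 * n + 20)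
      (TraceState n A G (σ.rarr aPot) (pathLabels n (σ.narr aParent) (σ.rarr aDist)) rank g x
        w) := by
  have hlt := hN.lt
  have hw := hN.via_lt
  have hT := hS.tree
  have hrank : ∀ v ∈ (pathLabels n (σ.narr aParent) (σ.rarr aDist)).reached, v < n ∧ rank v < n :=
    fun v hv => ⟨hv.1, hS.rank_lt v hv.1 hv.2⟩
  set L := pathLabels n (σ.narr aParent) (σ.rarr aDist) with hL
  obtain ⟨hxn, hxrank⟩ := hrank x hx
  set I : ℕ → State → Prop := fun k τ => ∃ v, (v = w ∨ rank v < k) ∧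
    TraceState n A G (σ.rarr aPot) L rank g x v τ
  have hset : (Cmd.setN rPlayer (.reg rTarget)).wp B (I n) σ :=
    ⟨by simp [htarget]; omega, x, .inr hxrank, hL.symm, htarget, hx, le_rfl, g, hg.flow_eq,
      .refl hg.isFeasible (hT.isLinkOptimal_raise hg.isFeasible hg.isLinkOptimal _) rank x⟩
  refine ((Runs.of_wp hset).seq fun τ hF hτ => Runs.loop_const I 40 ?_ hτ).le ?_
  · rintro k υ hFυ ⟨v, hk, hυ⟩
    have hNυ := (hN.of_frame hF rfl).of_frame hFυ rfl
    have hv := (hrank v hυ.mem_reached).1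
    refine ⟨by simp [hυ.player, hNυ.via]; omega, fun hb => ?_, fun hb => ?_⟩
    all_goals simp only [BExpr.Holds, NExpr.eval, hυ.player, hNυ.via, not_not] at hb
    · have hvw : v ≠ w := fun e => hb ⟨e.le, e.ge⟩
      have hlt := hT.rank_lt v hυ.mem_reached hvw
      have hvk := hk.resolve_left hvw
      exact (traceStep_runs hNυ hT hg.isFeasible hg.isLinkOptimal hυ hvw).mono le_rfl
        fun φ _ hφ => ⟨k - 1, by omega, _, .inr (lt_of_lt_of_le hlt (by omega)), hφ⟩
    · exact hb.1.antisymm hb.2 ▸ hυ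
  · simp only [Cmd.maxCost, BExpr.cost, NExpr.cost]
    omega

theorem raisePotentialStep_runs (hN : NetworkMemory B n A w d G σ)
    (hparent : σ.narr aParent v ≤ A + 1) (hv : v < n) (hcount : σ.nreg rCount = v) :
    Runs B raisePotentialStep σ 25 fun τ => τ.rreg rDist = σ.rreg rDist ∧
      τ.rarr aPot = update (σ.rarr aPot) v (ArcNetwork.raise (σ.rarr aPot)
        (pathLabels n (σ.narr aParent) (σ.rarr aDist)) (σ.rreg rDist) v) := by
  have hlt := hN.lt
  have hAlt := hN.arcs_lt
  have hvB : v < B := by omega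
  refine (Runs.of_wp ?_).le (show Cmd.maxCost _ ≤ 25 by decide)
  refine ⟨by simp [hcount]; omega, fun hb => ?_, fun hb => ?_⟩
  all_goals
    simp only [BExpr.Holds, RExpr.eval, NExpr.eval, hcount, Nat.one_le_iff_ne_zero] at hb
    simp [ArcNetwork.raise, pathLabels, hcount, hvB, hv, hb]

theorem raisePotential_runs (hN : NetworkMemory B n A w d G σ)
    (hparent : ∀ v < n, σ.narr aParent v ≤ A + 1) (htarget : σ.nreg rTarget = x) (hx : x < n) :
    Runs B raisePotential σ (40 * n + 20) fun τ => ∀ v < n, τ.rarr aPot v =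
      ArcNetwork.raise (σ.rarr aPot) (pathLabels n (σ.narr aParent) (σ.rarr aDist))
        (σ.rarr aDist x) v := by
  have hn := hN.nodes
  have hlt := hN.lt
  set ρ := σ.setR rDist (σ.rarr aDist x) with hρ
  have hNρ : NetworkMemory B n A w d G ρ := { hN with }
  have hnρ : ρ.nreg rNodes = n := hn
  have hset : (Cmd.setR rDist (.read aDist (.reg rTarget))).wp B (fun τ => τ = ρ) σ := by
    simp [htarget, hρ]; omega
  set π := ArcNetwork.raise (σ.rarr aPot) (pathLabels n (σ.narr aParent) (σ.rarr aDist))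
    (σ.rarr aDist x) with hπ
  have hloop : Runs B (.forBelow rCount rNodes raisePotentialStep) ρ (n * (25 + 10) + 10)
      fun τ => ∀ v < n, τ.rarr aPot v = π v := by
    refine (Runs.forBelow (c := 25) (fun i τ => τ.rreg rDist = σ.rarr aDist x ∧
      ∀ v, τ.rarr aPot v = if v < i then π v else σ.rarr aPot v) (by decide) rfl rfl (by omega)
      (by simp [hρ]) fun i hi τ hF hcount ⟨hD, hτ⟩ => ?_).mono (by rw [hnρ])
      fun τ _ hτ v hv => by rw [hτ.2 v, if_pos (hnρ.symm ▸ hv)]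
    rw [hnρ] at hi
    refine (raisePotentialStep_runs (hNρ.of_frame hF rfl)
      (hF.narr aParent rfl ▸ hparent i hi) hi hcount).mono le_rfl fun υ _ hυ => ?_
    rw [hF.narr aParent rfl, hF.rarr aDist rfl, hD] at hυ
    refine ⟨hυ.1, fun v => ?_⟩
    have hpot : (υ.setN rCount (i + 1)).rarr aPot v = _ := congrFun hυ.2 v
    rw [hpot]
    rcases eq_or_ne v i with rfl | hvi
    · have hpotv : τ.rarr aPot v = σ.rarr aPot v := by rw [hτ v, if_neg (lt_irrefl v)]
      rw [Function.update_self, if_pos (Nat.lt_succ_self v), hπ, ArcNetwork.raise,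
        ArcNetwork.raise, hpotv]
      rfl
    · rw [Function.update_of_ne hvi, hτ v]
      simp only [show v < i + 1 ↔ v < i by omega]
  refine ((Runs.of_wp hset).seq fun τ _ hτ => hτ ▸ hloop).le ?_
  simp only [Cmd.maxCost, NExpr.cost, RExpr.cost]
  omega

theorem augment_runs (hN : NetworkMemory B n A w d G σ)
    (hS : IsSearchResult n A w (G.residual (σ.rarr aPot) g) rank σ) (hg : FlowMemory A G g σ)
    (htarget : σ.nreg rTarget = x)
    (hx : x ∈ (pathLabels n (σ.narr aParent) (σ.rarr aDist)).reached) :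
    Runs B augment σ (100 * n + 40) fun τ => ∃ g', FlowMemory A G g' τ ∧
      (∀ a < A, g' a ≤ g a + 1) ∧ ∀ φ, G.gain g' φ = G.gain g φ + (φ x - φ w) := by
  refine ((trace_runs hN hS hg htarget hx).seq fun τ hF hτ => (raisePotential_runs
    (hN.of_frame hF rfl) (hF.narr aParent rfl ▸ hS.parent_le)
    ((hF.nreg rTarget rfl).trans htarget) hx.1).mono le_rfl fun υ hFυ hυ => ?_).le (by omega)
  obtain ⟨g', hflow, hg'⟩ := hτ.flow
  refine ⟨g', ⟨hFυ.rarr aFlow rfl ▸ hflow, hg'.isFeasible, ?_⟩, fun a ha =>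
    hg'.le_add_one a (hN.mem_arcs.2 ha), hg'.gain_eq⟩
  rw [hF.rarr aPot rfl, hF.narr aParent rfl, hF.rarr aDist rfl] at hυ
  intro a ha y z hyz
  rw [hυ _ (hN.head_lt (hN.mem_arcs.1 ha)), hυ _ (hN.tail_lt _ (hN.mem_arcs.1 ha))]
  exact hg'.isLinkOptimal a ha y z hyz

end Flow

def resetCursors : Cmd :=
  .forBelow rCount rNodes (.storeN aCursor (.reg rCount) (.read aLast (.reg rCount)))

def takeArc (idx : NExpr) : Cmd :=
  .storeR aFlow idx (.sub (.read aFlow idx) .one) ;;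
  .setN rNode (.read aHead (.reg rArc)) ;;
  .setN rOut (.add (.reg rOut) (.lit 1)) ;;
  .storeN aRoute (.reg rOut) (.reg rNode)

def followStep (idx : NExpr) : Cmd :=
  .setN rArc (.sub (.read aCursor (.reg rNode)) (.lit 1)) ;;
  .ite (.rle .one (.read aFlow idx)) (takeArc idx)
    (.storeN aCursor (.reg rNode) (.read aNext (.reg rArc)))

/-- Follows the flow from a vertex as long as possible and appends the vertices to the output. The
flow on the current arc is read at the index `idx`. -/
def follow (idx : NExpr) : Cmd :=
  resetCursors ;;
  .storeN aRoute (.reg rOut) (.reg rNode) ;;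
  .loop (.nle (.lit 1) (.read aCursor (.reg rNode))) (followStep idx)

def writeFirst : Cmd :=
  .setN rNode (.reg rStart) ;; .setN rOut (.lit 0) ;;
  follow (.read aRev (.reg rArc)) ;;
  .setN rFirstLength (.reg rOut)

def writeSecond : Cmd :=
  follow (.reg rArc) ;;
  .setN rSecondLength (.sub (.reg rOut) (.reg rFirstLength)) ;; .setN rAnswer (.lit 1)

/-- Writes a route along the flow to the output: backwards from the start to the via vertex, then
forwards to the end. -/
def extract : Cmd :=
  writeFirst ;; writeSecond

/-- The expression `idx` computes `f a`, where `a` is the current arc. -/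
def Locates (B n A w d : ℕ) (G : ArcNetwork ℕ ℕ) (idx : NExpr) (f : ℕ → ℕ) : Prop :=
  ∀ σ, NetworkMemory B n A w d G σ → σ.nreg rArc < A →
    idx.Fits B σ ∧ idx.eval σ = f (σ.nreg rArc)

/-- The memory while `follow` is at `v`, having followed the arcs `l` from `x` and written their
vertices to the output from the index `k` on, where it was `r` before. The array of the flow holds
at `f a` what is left of the flow on the arc `a`, and of the arcs with tail `u` only those before
`p u` are still to be tried. -/
structure FollowState (n A : ℕ) (G : ArcNetwork ℕ ℕ) (f g : ℕ → ℕ) (x k : ℕ) (r : ℕ → ℕ)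
    (l : List ℕ) (v : ℕ) (g' p : ℕ → ℕ) (σ : State) : Prop where
  isTrail : G.IsTrail g x l v g'
  lt : v < n
  node : σ.nreg rNode = v
  out : σ.nreg rOut = k + l.length
  flow_eq : ∀ a < A, σ.rarr aFlow (f a) = g' a
  le : ∀ u < n, p u ≤ A
  cursor_eq : ∀ u < n, σ.narr aCursor u = lastArc G.tail u (p u)
  rest_eq_zero : ∀ a < A, p (G.tail a) ≤ a → g' a = 0
  route_eq : ∀ i ≤ l.length, σ.narr aRoute (k + i) = G.pathVertex x l i
  route_before : ∀ i < k, σ.narr aRoute i = r i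

/-- The loop of `follow` halts within `j` rounds: every round follows an arc or discards one. -/
def FollowWithin (n A : ℕ) (G : ArcNetwork ℕ ℕ) (f g : ℕ → ℕ) (x k : ℕ) (r : ℕ → ℕ) (j : ℕ)
    (σ : State) : Prop :=
  ∃ l v g' p, FollowState n A G f g x k r l v g' p σ ∧
    ∑ u ∈ Finset.range n, numArcs G.tail u (p u) + ∑ a ∈ G.arcs, g a ≤ j + l.length

section Follow

open Function

variable {B n A w d a v x t k j : ℕ} {G : ArcNetwork ℕ ℕ} {f g g' p r : ℕ → ℕ} {l : List ℕ}
  {idx : NExpr} {σ : State}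

theorem NetworkMemory.locates_arc : Locates B n A w d G (.reg rArc) id := fun σ hN ha => by
  have hlt := hN.arcs_lt
  exact ⟨show σ.nreg rArc < B by omega, rfl⟩

theorem NetworkMemory.locates_rev : Locates B n A w d G (.read aRev (.reg rArc)) G.rev :=
  fun σ hN ha => by
    have hlt := hN.arcs_lt
    have hrev := hN.rev_lt ha
    simp only [NExpr.Fits, NExpr.eval, hN.rev_eq, and_true]
    omega

theorem resetCursors_runs (hN : NetworkMemory B n A w d G σ) :
    Runs B resetCursors σ (14 * n + 10) fun τ =>
      ∀ u < n, τ.narr aCursor u = lastArc G.tail u A := by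
  have hn := hN.nodes
  have hlt := hN.lt
  have hAlt := hN.arcs_lt
  refine (Runs.forBelow (c := 4) (fun i τ => ∀ u < i, τ.narr aCursor u = lastArc G.tail u A)
    (by decide) rfl rfl (by omega) (by simp) fun i hi τ hF hcount hτ => ?_).mono
      (by omega) fun τ _ hτ u hu => hτ u (hn.symm ▸ hu)
  have hlast := (hN.of_frame hF rfl).last_eq i (by omega)
  have hle := lastArc_le G.tail i A
  refine Runs.of_wp (P := .storeN _ _ _)
    ⟨by simp; omega, by simp [hcount, hlast]; omega, fun u hu => ?_⟩
  rcases eq_or_ne u i with rfl | hui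
  · simp [hcount, hlast]
  · simpa [hcount, hui] using hτ u (by omega)

theorem FollowState.takeArc_runs (hN : NetworkMemory B n A w d G σ)
    (hidx : Locates B n A w d G idx f) (hf : Set.InjOn f G.arcs)
    (hB : k + ∑ a ∈ G.arcs, g a + 2 < B) (h : FollowState n A G f g x k r l v g' p σ)
    (ha : a < A) (harc : σ.nreg rArc = a) (htail : G.tail a = v) (hpos : 1 ≤ g' a) :
    Runs B (takeArc idx) σ (2 * idx.cost + 20)
      (FollowState n A G f g x k r (l ++ [a]) (G.head a) (update g' a (g' a - 1)) p) := by
  obtain ⟨hfits, heval⟩ := hidx σ hN (harc ▸ ha)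
  rw [harc] at heval
  have hlt := hN.lt
  have hAlt := hN.arcs_lt
  have hmem := hN.mem_arcs.2 ha
  have hhead := hN.head_lt ha
  have htrail := h.isTrail.concat hmem htail hpos
  have hlen := htrail.sum_rest_add_length
  have hout := h.out
  rw [List.length_append, List.length_singleton] at hlen
  refine (Runs.of_wp ?_).le (show _ ≤ 2 * idx.cost + 20 by
    simp only [takeArc, Cmd.maxCost, NExpr.cost, RExpr.cost]; omega)
  refine ⟨hfits, ⟨hfits, trivial⟩, by simp [harc, hN.head_eq]; omega, by simp; omega,
    by simp; omega, by simp [harc, hN.head_eq]; omega, htrail, hhead, ?_, ?_, fun b hb => ?_, h.le,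
    ?_, fun b hb hpb => ?_, fun i hi => ?_, fun i hi => ?_⟩
  · simp [harc, hN.head_eq]
  · simp [hout, add_assoc]
  · rcases eq_or_ne b a with rfl | e
    · simp [heval, h.flow_eq b hb, Nat.cast_sub hpos]
    · simp [heval, h.flow_eq b hb, e, hf.ne (hN.mem_arcs.2 hb) hmem e]
  · simpa using h.cursor_eq
  · rcases eq_or_ne b a with rfl | e
    · have := h.rest_eq_zero b hb hpb
      omega
    · simpa [e] using h.rest_eq_zero b hb hpb
  · rw [List.length_append, List.length_singleton] at hi
    rcases Nat.le_succ_iff.1 hi with hi | rfl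
    · simpa [hout, ArcNetwork.pathVertex_concat_of_le hi, show k + i ≠ k + l.length + 1 by omega]
        using h.route_eq i hi
    · simp [hout, harc, hN.head_eq, ArcNetwork.pathVertex_concat_length, add_assoc]
  · simpa [hout, show i ≠ k + l.length + 1 by omega] using h.route_before i hi

theorem FollowState.skipArc_runs (hN : NetworkMemory B n A w d G σ)
    (h : FollowState n A G f g x k r l v g' p σ) (harc : σ.nreg rArc = a)
    (hcursor : lastArc G.tail v (p v) = a + 1) (hzero : g' a = 0) :
    Runs B (.storeN aCursor (.reg rNode) (.read aNext (.reg rArc))) σ 10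
      (FollowState n A G f g x k r l v g' (update p v a)) := by
  have hlt := hN.lt
  have hAlt := hN.arcs_lt
  have hv := h.lt
  have hple := h.le v hv
  have hcle := lastArc_le G.tail v (p v)
  have hnext := hN.next_eq a (by omega)
  have hnle := lastArc_le G.tail v a
  have htail := tail_of_lastArc_eq hcursor
  rw [htail] at hnext
  refine (Runs.of_wp ?_).le (show _ ≤ 10 by decide)
  refine ⟨by simp [h.node]; omega, by simp [harc, hnext]; omega, h.isTrail, hv, h.node, h.out,
    h.flow_eq, fun u hu => ?_, fun u hu => ?_, fun b hb hpb => ?_, ?_, ?_⟩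
  · rcases eq_or_ne u v with rfl | e
    · simp; omega
    · simpa [e] using h.le u hu
  · rcases eq_or_ne u v with rfl | e
    · simp [h.node, harc, hnext]
    · simpa [h.node, e] using h.cursor_eq u hu
  · rcases eq_or_ne (G.tail b) v with e | e
    · rw [e, update_self] at hpb
      rcases hpb.eq_or_lt with rfl | hlt
      · exact hzero
      refine h.rest_eq_zero b hb (not_lt.1 fun hbp => ?_)
      exact tail_ne_of_lastArc_le (e ▸ hbp) (by omega) e
    · exact h.rest_eq_zero b hb (by simpa [e] using hpb)
  · simpa using h.route_eq
  · simpa using h.route_before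

theorem FollowState.followStep_runs (hN : NetworkMemory B n A w d G σ)
    (hidx : Locates B n A w d G idx f) (hf : Set.InjOn f G.arcs)
    (hB : k + ∑ a ∈ G.arcs, g a + 2 < B) (h : FollowState n A G f g x k r l v g' p σ)
    (hcursor : lastArc G.tail v (p v) = a + 1) :
    Runs B (followStep idx) σ (3 * idx.cost + 35) fun τ =>
      FollowState n A G f g x k r (l ++ [a]) (G.head a) (update g' a (g' a - 1)) p τ ∨
      FollowState n A G f g x k r l v g' (update p v a) τ := by
  have hlt := hN.lt
  have hAlt := hN.arcs_lt
  have hv := h.lt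
  have hple := h.le v hv
  have hcle := lastArc_le G.tail v (p v)
  have ha : a < A := by omega
  have hread := h.cursor_eq v hv
  set ρ := σ.setN rArc a with hρ
  have hNρ : NetworkMemory B n A w d G ρ := { hN with }
  have hρF : FollowState n A G f g x k r l v g' p ρ := { h with }
  have hset : (Cmd.setN rArc (.sub (.read aCursor (.reg rNode)) (.lit 1))).wp B
      (fun τ => τ = ρ) σ := by
    simp [h.node, hread, hcursor, hρ]; omega
  obtain ⟨hfits, heval⟩ := hidx ρ hNρ ha
  have hflow : ρ.rarr aFlow (idx.eval ρ) = g' a := heval ▸ h.flow_eq a ha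
  have hbranch : Runs B (.ite (.rle .one (.read aFlow idx)) (takeArc idx)
      (.storeN aCursor (.reg rNode) (.read aNext (.reg rArc)))) ρ
      ((BExpr.rle .one (.read aFlow idx)).cost + 1 + (2 * idx.cost + 20)) fun τ =>
      FollowState n A G f g x k r (l ++ [a]) (G.head a) (update g' a (g' a - 1)) p τ ∨
      FollowState n A G f g x k r l v g' (update p v a) τ := by
    refine Runs.ite ⟨trivial, hfits⟩ (fun hb => ?_) fun hb => ?_
    all_goals simp only [BExpr.Holds, RExpr.eval, hflow, Nat.one_le_cast] at hb
    · exact (hρF.takeArc_runs hNρ hidx hf hB ha rfl (tail_of_lastArc_eq hcursor) hb).mono le_rfl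
        fun τ _ hτ => .inl hτ
    · exact (hρF.skipArc_runs (a := a) hNρ rfl hcursor (by omega)).mono (by omega)
        fun τ _ hτ => .inr hτ
  refine ((Runs.of_wp hset).seq fun τ _ hτ => hτ ▸ hbranch).le ?_
  simp only [Cmd.maxCost, BExpr.cost, NExpr.cost, RExpr.cost]
  omega

theorem FollowState.followStep_runs_within (hN : NetworkMemory B n A w d G σ)
    (hidx : Locates B n A w d G idx f) (hf : Set.InjOn f G.arcs)
    (hB : k + ∑ a ∈ G.arcs, g a + 2 < B) (h : FollowState n A G f g x k r l v g' p σ)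
    (hcursor : σ.narr aCursor v ≠ 0)
    (hj : ∑ u ∈ Finset.range n, numArcs G.tail u (p u) + ∑ a ∈ G.arcs, g a ≤ j + l.length) :
    Runs B (followStep idx) σ (3 * idx.cost + 35) fun τ =>
      ∃ j', j' + 1 ≤ j ∧ FollowWithin n A G f g x k r j' τ := by
  obtain ⟨a, ha⟩ := Nat.exists_eq_succ_of_ne_zero hcursor
  rw [h.cursor_eq v h.lt] at ha
  have hnum := numArcs_lt_of_lastArc_eq ha
  have hlen := h.isTrail.sum_rest_add_length
  have hsplit := Finset.add_sum_erase _ (fun u => numArcs G.tail u (p u)) (Finset.mem_range.2 h.lt)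
  refine (h.followStep_runs hN hidx hf hB ha).mono le_rfl fun τ _ hτ => ⟨j - 1, by omega, ?_⟩
  rcases hτ with hτ | hτ
  · refine ⟨_, _, _, _, hτ, ?_⟩
    rw [List.length_append, List.length_singleton]
    omega
  · refine ⟨_, _, _, _, hτ, ?_⟩
    have hsplit' := Finset.add_sum_erase _ (fun u => numArcs G.tail u (update p v a u))
      (Finset.mem_range.2 h.lt)
    have herase : ∑ u ∈ (Finset.range n).erase v, numArcs G.tail u (update p v a u) =
        ∑ u ∈ (Finset.range n).erase v, numArcs G.tail u (p u) :=
      Finset.sum_congr rfl fun u hu => by rw [update_of_ne (Finset.ne_of_mem_erase hu)]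
    simp only [update_self] at hsplit'
    omega

theorem follow_runs (hN : NetworkMemory B n A w d G σ) (hidx : Locates B n A w d G idx f)
    (hf : Set.InjOn f G.arcs) (hB : k + ∑ a ∈ G.arcs, g a + 2 < B)
    (hg : ∀ a < A, σ.rarr aFlow (f a) = g a) (hx : x < n) (hnode : σ.nreg rNode = x)
    (hout : σ.nreg rOut = k) :
    Runs B (follow idx) σ
      ((A + ∑ a ∈ G.arcs, g a) * (3 * idx.cost + 40) + 14 * n + 20) fun τ =>
      ∃ l v g' p, FollowState n A G f g x k (σ.narr aRoute) l v g' p τ ∧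
        ∀ a ∈ G.arcs, G.tail a = v → g' a = 0 := by
  have hlt := hN.lt
  have hAlt := hN.arcs_lt
  have hstart : ∀ τ, Frame resetCursors σ τ → (∀ u < n, τ.narr aCursor u = lastArc G.tail u A) →
      (Cmd.storeN aRoute (.reg rOut) (.reg rNode)).wp B
        (FollowWithin n A G f g x k (σ.narr aRoute) (A + ∑ a ∈ G.arcs, g a)) τ := by
    intro τ hF hτ
    have hnodeτ : τ.nreg rNode = x := (hF.nreg rNode rfl).trans hnode
    have houtτ : τ.nreg rOut = k := (hF.nreg rOut rfl).trans hout
    refine ⟨by simp; omega, by simp; omega, [], x, g, fun _ => A, ⟨.nil g x, hx, hnodeτ, houtτ,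
      hF.rarr aFlow rfl ▸ hg, fun _ _ => le_rfl, hτ, fun a ha h => absurd h ha.not_ge,
      fun i hi => ?_, fun i hi => ?_⟩, by simp [sum_numArcs hN.tail_lt]⟩
    · obtain rfl : i = 0 := by simpa using hi
      simp [houtτ, hnodeτ, ArcNetwork.pathVertex]
    · simp [houtτ, hi.ne, hF.narr aRoute rfl]
  refine ((resetCursors_runs hN).seq fun τ hF hτ => (Runs.of_wp (hstart τ hF hτ)).seq
    fun υ hFυ hυ => Runs.loop_const _ (3 * idx.cost + 35) ?_ hυ).le ?_
  · rintro j φ hFφ ⟨l, v, g', p, hφ, hj⟩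
    have hNφ := ((hN.of_frame hF rfl).of_frame hFυ rfl).of_frame hFφ rfl
    have hread := hφ.cursor_eq v hφ.lt
    have hlast := lastArc_le G.tail v (p v)
    have hle := hφ.le v hφ.lt
    have hv := hφ.lt
    refine ⟨by simp [hφ.node, hread]; omega, fun hb => ?_, fun hb => ?_⟩
    all_goals simp only [BExpr.Holds, NExpr.eval, hφ.node, Nat.one_le_iff_ne_zero] at hb
    · exact hφ.followStep_runs_within hNφ hidx hf hB hb hj
    · refine ⟨l, v, g', p, hφ, fun a ha htail => hφ.rest_eq_zero a (hN.mem_arcs.1 ha) ?_⟩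
      refine not_lt.1 fun hlt => tail_ne_of_lastArc_le (htail ▸ hlt) ?_ htail
      omega
  · simp only [Cmd.maxCost, BExpr.cost, NExpr.cost]
    nlinarith

/-- The memory after the first segment of the route, which follows the arcs `l`, was written to the
output; `g'` is left of the reversed flow. -/
structure FirstSegment (A : ℕ) (G : ArcNetwork ℕ ℕ) (g : ℕ → ℕ) (x w : ℕ) (l : List ℕ)
    (g' : ℕ → ℕ) (σ : State) : Prop where
  isTrail : G.IsTrail (g ∘ G.rev) x l w g'
  node : σ.nreg rNode = w
  out : σ.nreg rOut = l.length
  firstLength : σ.nreg rFirstLength = l.length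
  flow_eq : ∀ a < A, σ.rarr aFlow a = g' (G.rev a)
  route_eq : ∀ i ≤ l.length, σ.narr aRoute i = G.pathVertex x l i

theorem writeFirst_runs (hN : NetworkMemory B n A w d G σ) (hflow : ∀ a < A, σ.rarr aFlow a = g a)
    (hgain : ∀ φ, G.gain g φ = (φ x - φ w) + (φ t - φ w)) (hsum : ∑ a ∈ G.arcs, g a ≤ 2 * A)
    (hB : 2 * A + 2 < B) (hx : x < n) (hstart : σ.nreg rStart = x) :
    Runs B writeFirst σ (140 * A + 14 * n + 40) fun τ => ∃ l g', FirstSegment A G g x w l g' τ := by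
  have hlt := hN.lt
  have hrev : Set.InjOn G.rev G.arcs :=
    Set.LeftInvOn.injOn (f₁' := G.rev) fun a ha => G.rev_rev a ha
  have hsum' : ∑ a ∈ G.arcs, (g ∘ G.rev) a ≤ 2 * A := (G.sum_comp_rev g).trans_le hsum
  set ρ := (σ.setN rNode x).setN rOut 0 with hρ
  have hNρ : NetworkMemory B n A w d G ρ := { hN with }
  have hset : (Cmd.setN rNode (.reg rStart)).wp B (fun τ => τ = σ.setN rNode x) σ := by
    simp [hstart]; omega
  have hset' : (Cmd.setN rOut (.lit 0)).wp B (fun τ => τ = ρ) (σ.setN rNode x) := by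
    simp [hρ]; omega
  have hfollow := follow_runs (k := 0) (g := g ∘ G.rev) hNρ NetworkMemory.locates_rev hrev
    (by omega) (fun a ha => hflow _ (hN.rev_lt ha)) hx rfl rfl
  have hrest := hfollow.seq (P' := .setN rFirstLength (.reg rOut)) (T' := 2)
    (Q' := fun τ => ∃ l g', FirstSegment A G g x w l g' τ)
    fun υ _ ⟨l, v, g', p, hυ, hstuck⟩ => Runs.of_wp ?_
  · refine ((Runs.of_wp hset).seq fun τ _ hτ => hτ ▸ (Runs.of_wp hset').seq fun τ _ hτ =>
      hτ ▸ hrest).le ?_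
    simp only [Cmd.maxCost, NExpr.cost]
    nlinarith
  · have hv := hυ.isTrail.eq_of_stuck_of_comp_rev hgain hstuck
    have hlen := hυ.isTrail.sum_rest_add_length
    have hout := hυ.out
    refine ⟨by simp only [NExpr.Fits]; omega, l, g', hv ▸ hυ.isTrail, hv ▸ hυ.node, ?_, ?_,
      fun a ha => ?_, fun i hi => by simpa using hυ.route_eq i hi⟩
    · simpa using hout
    · simpa using hout
    · simpa [G.rev_rev a (hN.mem_arcs.2 ha)] using hυ.flow_eq _ (hN.rev_lt ha)

theorem FirstSegment.reportsRoute {N : Network (Fin n)} {s u t : Fin n} {l' : List ℕ}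
    {g'' : ℕ → ℕ} {τ : State} {R : Route N s u t} (h : FirstSegment A G g s u l g' σ)
    (hτ : FollowState n A G f (g' ∘ G.rev) u l.length (σ.narr aRoute) l' t g'' p τ)
    (hfirst : τ.nreg rFirstLength = l.length) (hl : G.Traces Fin.valEmbedding l R.first)
    (hl' : G.Traces Fin.valEmbedding l' R.second) :
    ReportsRoute ((τ.setN rSecondLength l'.length).setN rAnswer 1) R := by
  have hlen := hl.length_eq
  have hlen' := hl'.length_eq
  refine ⟨by simp, by simp [hfirst, hlen], by simp [hlen'], fun i hi => ?_, fun i hi => ?_⟩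
  · rw [hlen] at hi
    rcases hi.lt_or_eq with hi | rfl
    · simpa [hτ.route_before i hi, h.route_eq i hi.le] using (hl.getVert_eq i hi.le).symm
    · have hvia : τ.narr aRoute l.length = u := hτ.route_eq 0 (Nat.zero_le _)
      have hget : R.first.getVert l.length = u := hlen ▸ R.first.getVert_length
      simp [hvia, hget]
  · rw [hlen'] at hi
    simpa [hlen, hτ.route_eq i hi] using (hl'.getVert_eq i hi).symm

theorem writeSecond_runs {N : Network (Fin n)} {s u t : Fin n} {π : ℕ → ℝ}
    (hN : NetworkMemory B n A u d G σ) (hG : G.Represents N Fin.valEmbedding)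
    (hopt : G.IsLinkOptimal π g) (hcap : G.IsFeasible g)
    (hgain : ∀ φ, G.gain g φ = (φ s - φ u) + (φ t - φ u)) (hsum : ∑ a ∈ G.arcs, g a ≤ 2 * A)
    (hB : 2 * A + 2 < B) (h : FirstSegment A G g s u l g' σ) :
    Runs B writeSecond σ (140 * A + 14 * n + 40) (SolvesShortestRoute N s u t) := by
  have hlen := h.isTrail.sum_rest_add_length
  have hsum' : l.length + ∑ a ∈ G.arcs, (g' ∘ G.rev) a ≤ 2 * A := by
    have hrev := G.sum_comp_rev g
    have hrev' := G.sum_comp_rev g'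
    simp only [Function.comp_apply] at hlen ⊢
    omega
  have hfollow := follow_runs (k := l.length) (g := g' ∘ G.rev) hN NetworkMemory.locates_arc
    (Set.injOn_id _) (by omega) h.flow_eq u.isLt h.node h.out
  refine (hfollow.seq fun υ hF ⟨l', v, g'', p, hυ, hstuck⟩ => Runs.of_wp ?_).le ?_
  · obtain rfl : v = t := h.isTrail.eq_of_stuck_of_rest hgain hυ.isTrail hstuck
    have hlen' := hυ.isTrail.sum_rest_add_length
    have hfirst : υ.nreg rFirstLength = l.length := (hF.nreg _ rfl).trans h.firstLength
    obtain ⟨R, hR, hl, hl'⟩ := Route.exists_isShortest_of_isTrail hG hopt hcap hgain h.isTrail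
      hυ.isTrail
    have hreport := h.reportsRoute hυ hfirst hl hl'
    refine ⟨by simp [hυ.out, hfirst]; omega, by simp; omega, .inl ⟨R, hR, ?_⟩⟩
    simpa [hυ.out, hfirst] using hreport
  · simp only [Cmd.maxCost, NExpr.cost]
    nlinarith

theorem extract_runs {N : Network (Fin n)} {s u t : Fin n}
    (hN : NetworkMemory B n A u d G σ) (hG : G.Represents N Fin.valEmbedding)
    (hg : FlowMemory A G g σ) (hgain : ∀ φ, G.gain g φ = (φ s - φ u) + (φ t - φ u))
    (hle : ∀ a < A, g a ≤ 2) (hB : 2 * A + 2 < B) (hstart : σ.nreg rStart = s) :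
    Runs B extract σ (280 * A + 28 * n + 80) (SolvesShortestRoute N s u t) := by
  have hsum : ∑ a ∈ G.arcs, g a ≤ 2 * A := by
    rw [hN.arcs_eq]
    exact (Finset.sum_le_card_nsmul _ _ 2 fun a ha => hle a (Finset.mem_range.1 ha)).trans
      (by simp [mul_comm])
  exact ((writeFirst_runs hN hg.flow_eq hgain hsum hB s.isLt hstart).seq
    fun τ hF ⟨l, g', hτ⟩ => writeSecond_runs (hN.of_frame hF rfl) hG hg.isLinkOptimal
      hg.isFeasible hgain hsum hB hτ).le (by omega)

end Follow

def reverseLink : Cmd :=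
  .storeN aTail (.add (.reg rLinks) (.reg rCount)) (.read aHead (.reg rCount)) ;;
  .storeN aHead (.add (.reg rLinks) (.reg rCount)) (.read aTail (.reg rCount)) ;;
  .storeN aRev (.reg rCount) (.add (.reg rLinks) (.reg rCount)) ;;
  .storeN aRev (.add (.reg rLinks) (.reg rCount)) (.reg rCount) ;;
  .storeR aCap (.add (.reg rLinks) (.reg rCount)) (.read aCap (.reg rCount)) ;;
  .storeR aWeight (.add (.reg rLinks) (.reg rCount)) (.read aWeight (.reg rCount))

/-- Creates the arcs: the links themselves, followed by their reversals. -/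
def makeArcs : Cmd :=
  .forBelow rCount rLinks reverseLink

/-- Creates the linked lists of the arcs with the same tail. -/
def makeLists : Cmd :=
  .forBelow rCount rArcs
    (.storeN aNext (.reg rCount) (.read aLast (.read aTail (.reg rCount))) ;;
    .storeN aLast (.read aTail (.reg rCount)) (.add (.reg rCount) (.lit 1)))

def setSizes : Cmd :=
  .setN rArity (.add (.div (.reg rLinks) (.reg rNodes)) (.lit 2)) ;;
  .setN rArcs (.add (.reg rLinks) (.reg rLinks))

/-- Prepares the memory for the search. -/
def setup : Cmd :=
  setSizes ;; makeArcs ;; makeLists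

/-- Sends a unit of flow to the target along a path that has been found and executes `P`, or leaves
the answer that there is no route. -/
def augmentOrFail (P : Cmd) : Cmd :=
  .ite (.nle (.lit 1) (.read aParent (.reg rTarget))) (augment ;; P) .skip

/-- Sends a unit of flow from the via vertex to the one in register `x`, if possible, and then
executes `P`. -/
def sendUnit (x : ℕ) (P : Cmd) : Cmd :=
  .setN rTarget (.reg x) ;; findPaths ;; augmentOrFail P

/-- Solves the shortest waypoint routing problem. -/
def shortestRoute : Cmd :=
  setup ;; sendUnit rStart (sendUnit rEnd extract)

/-- The memory holds a link of `N` from `u` to `v` at the index `a`. -/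
structure HoldsLink {n : ℕ} (N : Network (Fin n)) (a : ℕ) (u v : Fin n) (σ : State) : Prop where
  tail_eq : σ.narr aTail a = u
  head_eq : σ.narr aHead a = v
  cap_eq : σ.rarr aCap a = N.cap s(u, v)
  weight_eq : σ.rarr aWeight a = N.weight s(u, v)

/-- The memory holds the `j`-th link at the index `j` and its reversal at the index `m + j`, for the
first `i` links. -/
structure HoldsArcs {n m : ℕ} (N : Network (Fin n)) (ends : Fin m → Fin n × Fin n) (i : ℕ)
    (σ : State) : Prop where
  link : ∀ j : Fin m, HoldsLink N j (ends j).1 (ends j).2 σ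
  link_add : ∀ j : Fin m, j < i → HoldsLink N (m + j) (ends j).2 (ends j).1 σ
  rev_eq : ∀ j : Fin m, j < i → σ.narr aRev j = m + j
  rev_add_eq : ∀ j : Fin m, j < i → σ.narr aRev (m + j) = j

section Arcs

variable {B n m i : ℕ} {N : Network (Fin n)} {ends : Fin m → Fin n × Fin n} {σ τ : State}

theorem HoldsArcs.congr (h : HoldsArcs N ends i σ) (htail : τ.narr aTail = σ.narr aTail)
    (hhead : τ.narr aHead = σ.narr aHead) (hrev : τ.narr aRev = σ.narr aRev)
    (hcap : τ.rarr aCap = σ.rarr aCap) (hweight : τ.rarr aWeight = σ.rarr aWeight) :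
    HoldsArcs N ends i τ := by
  have hlink : ∀ {a u v}, HoldsLink N a u v σ → HoldsLink N a u v τ := fun h =>
    ⟨htail ▸ h.tail_eq, hhead ▸ h.head_eq, hcap ▸ h.cap_eq, hweight ▸ h.weight_eq⟩
  exact ⟨fun j => hlink (h.link j), fun j hj => hlink (h.link_add j hj), hrev ▸ h.rev_eq,
    hrev ▸ h.rev_add_eq⟩

theorem reverseLink_runs {u v : Fin n} (h : HoldsLink N i u v σ) (hi : i < m)
    (hlinks : σ.nreg rLinks = m) (hcount : σ.nreg rCount = i) (hB : n + 2 * m + 2 < B) :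
    Runs B reverseLink σ 35 fun τ => HoldsLink N (m + i) v u τ ∧
      (∀ j x y, j ≠ m + i → HoldsLink N j x y σ → HoldsLink N j x y τ) ∧
      τ.narr aRev = Function.update (Function.update (σ.narr aRev) i (m + i)) (m + i) i := by
  obtain ⟨htail, hhead, hcap, hweight⟩ := h
  have hread : Function.update (σ.narr aTail) (m + i) (v : ℕ) i = u := by
    rw [Function.update_of_ne (by omega), htail]
  have hswap : s(u, v) = s(v, u) := Sym2.eq_swap
  set ρ := (((((σ.storeN aTail (m + i) v).storeN aHead (m + i) u).storeN aRev i (m + i)).storeN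
    aRev (m + i) i).storeR aCap (m + i) (N.cap s(u, v))).storeR aWeight (m + i) (N.weight s(u, v))
    with hρ
  have hset : reverseLink.wp B (fun τ => τ = ρ) σ := by
    simp [reverseLink, hlinks, hcount, hread, hhead, hcap, hweight, hρ]
    omega
  refine (Runs.of_wp hset).mono (by decide) fun τ _ hτ => hτ ▸ ⟨⟨by simp [ρ], by simp [ρ],
    by simp [ρ, hswap], by simp [ρ, hswap]⟩, fun j x y hj h => ⟨?_, ?_, ?_, ?_⟩, by simp [ρ]⟩
  · simpa [ρ, hj] using h.tail_eq
  · simpa [ρ, hj] using h.head_eq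
  · simpa [ρ, hj] using h.cap_eq
  · simpa [ρ, hj] using h.weight_eq

theorem HoldsArcs.of_reverseLink (h : HoldsArcs N ends i σ) (hi : i < m)
    (hnew : HoldsLink N (m + i) (ends ⟨i, hi⟩).2 (ends ⟨i, hi⟩).1 τ)
    (hold : ∀ j x y, j ≠ m + i → HoldsLink N j x y σ → HoldsLink N j x y τ)
    (hrev : τ.narr aRev = Function.update (Function.update (σ.narr aRev) i (m + i)) (m + i) i) :
    HoldsArcs N ends (i + 1) τ := by
  have hcases : ∀ j : Fin m, j < i + 1 → j < i ∨ j = ⟨i, hi⟩ := fun j hj =>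
    (Nat.lt_succ_iff_lt_or_eq.1 hj).imp_right Fin.ext
  refine ⟨fun j => hold _ _ _ (by omega) (h.link j), fun j hj => ?_, fun j hj => ?_,
    fun j hj => ?_⟩ <;> obtain hj | rfl := hcases j hj
  · exact hold _ _ _ (by omega) (h.link_add j hj)
  · exact hnew
  · have h₁ : (j : ℕ) ≠ m + i := by omega
    rw [hrev, Function.update_of_ne h₁, Function.update_of_ne hj.ne, h.rev_eq j hj]
  · have h₁ : i ≠ m + i := by omega
    rw [hrev, Function.update_of_ne h₁, Function.update_self]
  · have h₁ : m + (j : ℕ) ≠ m + i := by omega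
    have h₂ : m + (j : ℕ) ≠ i := by omega
    rw [hrev, Function.update_of_ne h₁, Function.update_of_ne h₂, h.rev_add_eq j hj]
  · rw [hrev, Function.update_self]

theorem makeArcs_runs (h : HoldsArcs N ends 0 σ) (hlinks : σ.nreg rLinks = m)
    (hB : n + 2 * m + 2 < B) :
    Runs B makeArcs σ (45 * m + 10) (HoldsArcs N ends m) := by
  refine (Runs.forBelow (c := 35) (HoldsArcs N ends) (by decide) rfl rfl (by omega)
    ?_ fun i hi τ hF hcount hτ => ?_).mono (by omega) fun τ _ hτ => hlinks ▸ hτ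
  · exact h.congr rfl rfl rfl rfl rfl
  · exact (reverseLink_runs (hτ.link ⟨i, hlinks ▸ hi⟩) (hlinks ▸ hi)
      ((hF.nreg _ rfl).trans hlinks) hcount hB).mono le_rfl fun υ _ ⟨hnew, hold, hrev⟩ =>
        (hτ.of_reverseLink _ hnew hold hrev).congr rfl rfl rfl rfl rfl

theorem makeLists_runs {A : ℕ} {tail : ℕ → ℕ} (harcs : σ.nreg rArcs = A) (hB : n + A + 2 < B)
    (htail : σ.narr aTail = tail) (htail_lt : ∀ a < A, tail a < n)
    (hzero : ∀ v < n, σ.narr aLast v = 0) :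
    Runs B makeLists σ (30 * A + 10) fun τ => (∀ v < n, τ.narr aLast v = lastArc tail v A) ∧
      ∀ a < A, τ.narr aNext a = lastArc tail (tail a) a := by
  subst harcs
  refine (Runs.forBelow (c := 15) (fun i τ => (∀ v < n, τ.narr aLast v = lastArc tail v i) ∧
    ∀ a < i, τ.narr aNext a = lastArc tail (tail a) a) (by decide) rfl rfl (by omega)
    (by simpa [lastArc] using hzero) fun i hi τ hF hcount ⟨hlast, hnext⟩ => ?_).le (by omega)
  have htailτ : τ.narr aTail i = tail i := by rw [hF.narr aTail rfl, htail]
  have hread := hlast _ (htail_lt i hi)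
  have hle := lastArc_le tail (tail i) i
  have hlt := htail_lt i hi
  refine (Runs.of_wp ?_).le (show _ ≤ 15 by decide)
  refine ⟨by simp; omega, by simp [hcount, htailτ, hread]; omega,
    by simp [hcount, htailτ]; omega, by simp [hcount]; omega, fun v hv => ?_, fun a ha => ?_⟩
  · rcases eq_or_ne v (tail i) with rfl | e
    · simp [hcount, htailτ, lastArc]
    · simpa [hcount, htailτ, e, e.symm, lastArc] using hlast v hv
  · rcases Nat.lt_succ_iff_lt_or_eq.1 ha with ha | rfl
    · simpa [hcount, ha.ne] using hnext a ha
    · simp [hcount, htailτ, hread]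

theorem HoldsArcs.exists_links (h : HoldsArcs N ends m σ) {a : ℕ} (ha : a < 2 * m) :
    ∃ (j : Fin m) (b : ℕ) (u v : Fin n), (a = j ∧ b = m + j ∨ a = m + j ∧ b = j) ∧
      s(u, v) = s((ends j).1, (ends j).2) ∧ HoldsLink N a u v σ ∧ HoldsLink N b v u σ ∧
      σ.narr aRev a = b ∧ σ.narr aRev b = a := by
  rcases lt_or_ge a m with hlt | hle
  · exact ⟨⟨a, hlt⟩, m + a, _, _, .inl ⟨rfl, rfl⟩, rfl, h.link ⟨a, hlt⟩, h.link_add ⟨a, hlt⟩ hlt,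
      h.rev_eq ⟨a, hlt⟩ hlt, h.rev_add_eq ⟨a, hlt⟩ hlt⟩
  · obtain ⟨j, rfl⟩ := Nat.exists_eq_add_of_le hle
    have hj : j < m := by omega
    exact ⟨⟨j, hj⟩, j, _, _, .inr ⟨rfl, rfl⟩, Sym2.eq_swap, h.link_add ⟨j, hj⟩ hj, h.link ⟨j, hj⟩,
      h.rev_add_eq ⟨j, hj⟩ hj, h.rev_eq ⟨j, hj⟩ hj⟩

theorem HoldsArcs.tail_lt (h : HoldsArcs N ends m σ) {a : ℕ} (ha : a < 2 * m) :
    σ.narr aTail a < n := by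
  obtain ⟨_, _, u, _, -, -, ha, -⟩ := h.exists_links ha
  exact ha.tail_eq ▸ u.isLt

/-- The network that the memory holds. -/
def HoldsArcs.network (h : HoldsArcs N ends m σ) : ArcNetwork ℕ ℕ where
  arcs := Finset.range (2 * m)
  tail := σ.narr aTail
  head := σ.narr aHead
  rev := σ.narr aRev
  cap := σ.rarr aCap
  weight := σ.rarr aWeight
  rev_mem a ha := by
    obtain ⟨j, b, _, _, hab, -, -, -, hb, -⟩ := h.exists_links (Finset.mem_range.1 ha)
    rw [hb, Finset.mem_range]
    omega
  rev_rev a ha := by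
    obtain ⟨_, b, _, _, -, -, -, -, hb, ha⟩ := h.exists_links (Finset.mem_range.1 ha)
    rw [hb, ha]
  rev_ne a ha := by
    obtain ⟨j, b, _, _, hab, -, -, -, hb, -⟩ := h.exists_links (Finset.mem_range.1 ha)
    rw [hb]
    omega
  tail_rev a ha := by
    obtain ⟨_, b, _, _, -, -, ha, hb, e, -⟩ := h.exists_links (Finset.mem_range.1 ha)
    rw [e, hb.tail_eq, ha.head_eq]
  cap_rev a ha := by
    obtain ⟨_, b, _, _, -, -, ha, hb, e, -⟩ := h.exists_links (Finset.mem_range.1 ha)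
    rw [e, hb.cap_eq, ha.cap_eq, Sym2.eq_swap]
  weight_rev a ha := by
    obtain ⟨_, b, _, _, -, -, ha, hb, e, -⟩ := h.exists_links (Finset.mem_range.1 ha)
    rw [e, hb.weight_eq, ha.weight_eq, Sym2.eq_swap]
  weight_nonneg a ha := by
    obtain ⟨_, _, _, _, -, -, ha, -⟩ := h.exists_links (Finset.mem_range.1 ha)
    exact ha.weight_eq ▸ NNReal.coe_nonneg _

theorem HoldsArcs.represents (h : HoldsArcs N ends m σ) (hl : IsLinkList N ends) :
    h.network.Represents N Fin.valEmbedding where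
  exists_adj a ha := by
    obtain ⟨j, b, u, v, -, e, ha, -⟩ := h.exists_links (Finset.mem_range.1 ha)
    exact ⟨u, v, ha.tail_eq, ha.head_eq, hl.adj_of_eq e, ha.cap_eq, ha.weight_eq⟩
  exists_arc u v huv := by
    obtain ⟨j, hj⟩ : s(u, v) ∈ Set.range fun i => s((ends i).1, (ends i).2) := hl.range_eq ▸ huv
    rcases Sym2.eq_iff.1 hj with ⟨rfl, rfl⟩ | ⟨rfl, rfl⟩
    · exact ⟨j, Finset.mem_range.2 (by omega), (h.link j).tail_eq, (h.link j).head_eq⟩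
    · exact ⟨m + j, Finset.mem_range.2 (by omega), (h.link_add j j.2).tail_eq,
        (h.link_add j j.2).head_eq⟩
  eq_of_ends a ha b hb htail hhead := by
    obtain ⟨j, a', u, v, haj, e, ha, ha', -⟩ := h.exists_links (Finset.mem_range.1 ha)
    obtain ⟨k, b', x, y, hbk, e', hb, -⟩ := h.exists_links (Finset.mem_range.1 hb)
    obtain rfl : u = x := Fin.ext (ha.tail_eq.symm.trans (htail.trans hb.tail_eq))
    obtain rfl : v = y := Fin.ext (ha.head_eq.symm.trans (hhead.trans hb.head_eq))
    obtain rfl : j = k := hl.injective (e.symm.trans e')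
    have hne : b ≠ a' := by
      rintro rfl
      exact (hl.adj_of_eq e).ne (Fin.ext (hb.tail_eq.symm.trans ha'.tail_eq))
    omega

end Arcs

/-- The memory holds the instance of the shortest waypoint routing problem, and no answer yet. -/
structure InstanceMemory (B n A d : ℕ) (G : ArcNetwork ℕ ℕ) (N : Network (Fin n)) (s u t : Fin n)
    (σ : State) : Prop where
  network : NetworkMemory B n A u d G σ
  represents : G.Represents N Fin.valEmbedding
  start_eq : σ.nreg rStart = s
  end_eq : σ.nreg rEnd = t
  answer_eq : σ.nreg rAnswer = 0
  lt : 2 * A + 2 < B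

/-- The program does not write where `InstanceMemory` reads. -/
def Cmd.keepsInstance (P : Cmd) : Bool :=
  P.keepsNetwork && !P.writesN rStart && !P.writesN rEnd && !P.writesN rAnswer

section Algorithm

variable {B n m A d T x : ℕ} {G : ArcNetwork ℕ ℕ} {N : Network (Fin n)} {s u t y : Fin n}
  {ends : Fin m → Fin n × Fin n} {P : Cmd} {σ τ : State} {g : ℕ → ℕ}

theorem InstanceMemory.of_frame (h : InstanceMemory B n A d G N s u t σ) (hF : Frame P σ τ)
    (hP : P.keepsInstance = true) : InstanceMemory B n A d G N s u t τ := by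
  simp only [Cmd.keepsInstance, Bool.and_eq_true, Bool.not_eq_true'] at hP
  obtain ⟨⟨⟨hnet, hs⟩, ht⟩, ha⟩ := hP
  exact ⟨h.network.of_frame hF hnet, h.represents, (hF.nreg _ hs).trans h.start_eq,
    (hF.nreg _ ht).trans h.end_eq, (hF.nreg _ ha).trans h.answer_eq, h.lt⟩

theorem not_exists_feasible_of_unreached {L : PathLabels ℕ ℕ} {π : ℕ → ℝ} {rank : ℕ → ℕ}
    (hG : G.Represents N Fin.valEmbedding)
    (hL : (G.residual π g).IsShortestPathTree u L rank) (hy : (y : ℕ) ∉ L.reached)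
    (hcut : ∀ φ : ℕ → ℝ, (∀ v, 0 ≤ φ v) → φ u = 0 → 0 < φ y → G.gain g φ < φ s + φ t) :
    ¬ ∃ R : Route N s u t, R.Feasible := by
  refine Route.not_exists_feasible_of_closed hG (fun a ha hres htail => ?_) hL.root_mem
    (hcut _ (fun v => Set.indicator_nonneg (fun _ _ => zero_le_one) v) ?_ ?_)
  · exact hL.head_mem a ⟨ha, hres⟩ htail
  · exact Set.indicator_of_notMem (not_not.2 hL.root_mem) _
  · rw [Set.indicator_of_mem hy]
    exact zero_lt_one

theorem augmentOrFail_runs {rank : ℕ → ℕ} (h : InstanceMemory B n A d G N s u t σ)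
    (hg : FlowMemory A G g σ) (hS : IsSearchResult n A u (G.residual (σ.rarr aPot) g) rank σ)
    (htarget : σ.nreg rTarget = y)
    (hcut : ∀ φ : ℕ → ℝ, (∀ v, 0 ≤ φ v) → φ u = 0 → 0 < φ y → G.gain g φ < φ s + φ t)
    (hP : ∀ τ g', InstanceMemory B n A d G N s u t τ → FlowMemory A G g' τ →
      (∀ a < A, g' a ≤ g a + 1) → (∀ φ, G.gain g' φ = G.gain g φ + (φ y - φ u)) →
      Runs B P τ T (SolvesShortestRoute N s u t)) :
    Runs B (augmentOrFail P) σ (100 * n + T + 50) (SolvesShortestRoute N s u t) := by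
  have hy := y.isLt
  have hn := h.network.lt
  refine (Runs.ite (T := 100 * n + 40 + T) ?_ (fun hb => ?_) fun hb => ?_).le ?_
  · have hparent := hS.parent_le y hy
    have hA := h.lt
    simp [htarget]
    omega
  · simp only [BExpr.Holds, NExpr.eval, htarget, Nat.one_le_iff_ne_zero] at hb
    exact (augment_runs h.network hS hg htarget ⟨hy, hb⟩).seq fun τ hF ⟨g', hg', hle, hgain⟩ =>
      hP τ g' (h.of_frame hF rfl) hg' hle hgain
  · simp only [BExpr.Holds, NExpr.eval, htarget, Nat.one_le_iff_ne_zero] at hb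
    exact .skip (by omega) (.inr ⟨not_exists_feasible_of_unreached h.represents hS.tree
      (fun hy => hb hy.2) hcut, h.answer_eq⟩)
  · simp only [BExpr.cost, NExpr.cost]
    omega

theorem sendUnit_runs (h : InstanceMemory B n A d G N s u t σ) (hg : FlowMemory A G g σ)
    (hreg : σ.nreg x = y)
    (hcut : ∀ φ : ℕ → ℝ, (∀ v, 0 ≤ φ v) → φ u = 0 → 0 < φ y → G.gain g φ < φ s + φ t)
    (hP : ∀ τ g', InstanceMemory B n A d G N s u t τ → FlowMemory A G g' τ →
      (∀ a < A, g' a ≤ g a + 1) → (∀ φ, G.gain g' φ = G.gain g φ + (φ y - φ u)) →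
      Runs B P τ T (SolvesShortestRoute N s u t)) :
    Runs B (sendUnit x P) σ ((n * (d + 1) + A + 1) * (600 * (height d n + 1)) + 100 * n + T + 60)
      (SolvesShortestRoute N s u t) := by
  have hset : (Cmd.setN rTarget (.reg x)).wp B (fun τ => τ = σ.setN rTarget y) σ := by
    have hn := h.network.lt
    simp [hreg]
    omega
  refine ((Runs.of_wp hset).seq fun τ hF hτ => ?_).le (T := 2 + ((n * (d + 1) + A + 1) *
    (600 * (height d n + 1)) + (100 * n + T + 50))) (by omega)
  have hI := h.of_frame hF rfl
  have hgτ := hg.congr (hF.rarr aPot rfl) (hF.rarr aFlow rfl)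
  refine (findPaths_runs hI.network hgτ).seq fun υ hFυ ⟨rank, hS⟩ => ?_
  rw [← hFυ.rarr aPot rfl] at hS
  exact augmentOrFail_runs (hI.of_frame hFυ rfl) (hgτ.congr (hFυ.rarr aPot rfl)
    (hFυ.rarr aFlow rfl)) hS (by rw [hFυ.nreg rTarget rfl, hτ]; simp) hcut hP

theorem sendUnits_runs (h : InstanceMemory B n A d G N s u t σ) (hg : FlowMemory A G 0 σ) :
    Runs B (sendUnit rStart (sendUnit rEnd extract)) σ
      (2 * ((n * (d + 1) + A + 1) * (600 * (height d n + 1))) + 228 * n + 280 * A + 200)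
      (SolvesShortestRoute N s u t) := by
  refine (sendUnit_runs h hg h.start_eq (fun φ hφ _ hs => ?_) fun τ g hτ hgτ hle hgain =>
    sendUnit_runs hτ hgτ hτ.end_eq (fun φ _ hu ht => ?_) fun υ g' hυ hgυ hle' hgain' =>
      extract_runs hυ.network hυ.represents hgυ (fun φ => ?_) (fun a ha => ?_) hυ.lt
        hυ.start_eq).le (by omega)
  · simpa using add_pos_of_pos_of_nonneg hs (hφ t)
  · simpa [hgain, hu] using ht
  · simp [hgain', hgain]
  · exact (hle' a ha).trans (Nat.succ_le_succ (hle a ha))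

/-- The memory holds the arcs of `N` and the linked lists of the arcs with the same tail. -/
structure HoldsLists (N : Network (Fin n)) (ends : Fin m → Fin n × Fin n) (σ : State) : Prop where
  arity_eq : σ.nreg rArity = m / n + 2
  arcs_eq : σ.nreg rArcs = 2 * m
  holdsArcs : HoldsArcs N ends m σ
  last_eq : ∀ v < n, σ.narr aLast v = lastArc (σ.narr aTail) v (2 * m)
  next_eq : ∀ a < 2 * m, σ.narr aNext a = lastArc (σ.narr aTail) (σ.narr aTail a) a

theorem holdsArcs_inputState : HoldsArcs N ends 0 (inputState N ends s u t) where
  link j := ⟨by simp [inputState], by simp [inputState], by simp [inputState], by simp [inputState]⟩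
  link_add _ h := absurd h (Nat.not_lt_zero _)
  rev_eq _ h := absurd h (Nat.not_lt_zero _)
  rev_add_eq _ h := absurd h (Nat.not_lt_zero _)

theorem setup_runs (hB : 8 * m + 3 * n + 6 < B) :
    Runs B setup (inputState N ends s u t) (200 * m + 50) (HoldsLists N ends) := by
  set σ := inputState N ends s u t with hσ
  have hdiv : m / n ≤ m := Nat.div_le_self m n
  have hset : setSizes.wp B
      (fun τ => τ = (σ.setN rArity (m / n + 2)).setN rArcs (2 * m)) σ := by
    simp [setSizes, hσ, inputState, two_mul]
    omega
  refine ((Runs.of_wp hset).seq fun τ hF hτ => (makeArcs_runs (holdsArcs_inputState.congr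
    (hF.narr aTail rfl) (hF.narr aHead rfl) (hF.narr aRev rfl) (hF.rarr aCap rfl)
    (hF.rarr aWeight rfl)) ((hF.nreg rLinks rfl).trans rfl) (by omega)).seq fun υ hFυ hυ =>
    (makeLists_runs (n := n) (A := 2 * m) ?_ (by omega) rfl (fun a => hυ.tail_lt) ?_).mono le_rfl
      fun ρ hFρ ⟨hlast, hnext⟩ => ?_).le ?_
  · rw [hFυ.nreg rArcs rfl, hτ]
    simp
  · intro v _
    rw [hFυ.narr aLast rfl, hτ]
    simp [hσ, inputState]
  · simp only [setSizes, Cmd.maxCost, NExpr.cost]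
    omega
  · rw [← hFρ.narr aTail rfl] at hlast hnext
    refine ⟨?_, ?_, hυ.congr (hFρ.narr aTail rfl) (hFρ.narr aHead rfl) (hFρ.narr aRev rfl)
      (hFρ.rarr aCap rfl) (hFρ.rarr aWeight rfl), hlast, hnext⟩
    · rw [hFρ.nreg rArity rfl, hFυ.nreg rArity rfl, hτ]
      simp
    · rw [hFρ.nreg rArcs rfl, hFυ.nreg rArcs rfl, hτ]
      simp

theorem HoldsLists.instanceMemory (h : HoldsLists N ends τ) (hl : IsLinkList N ends)
    (hF : Frame setup (inputState N ends s u t) τ) (hB : 8 * m + 3 * n + 6 < B) :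
    InstanceMemory B n (2 * m) (m / n + 2) h.holdsArcs.network N s u t τ where
  network :=
    { nodes := hF.nreg rNodes rfl
      via := hF.nreg rVia rfl
      arity := h.arity_eq
      arcs := h.arcs_eq
      two_le := Nat.le_add_left _ _
      lt := by
        have hdiv : m / n ≤ m := Nat.div_le_self m n
        have hmul : m / n * n ≤ m := Nat.div_mul_le_self m n
        rw [add_mul]
        omega
      arcs_lt := by omega
      via_lt := u.isLt
      arcs_eq := rfl
      tail_eq := rfl
      head_eq := rfl
      rev_eq := rfl
      cap_eq := rfl
      weight_eq := rfl
      tail_lt := fun _ => h.holdsArcs.tail_lt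
      last_eq := h.last_eq
      next_eq := h.next_eq }
  represents := h.holdsArcs.represents hl
  start_eq := hF.nreg rStart rfl
  end_eq := hF.nreg rEnd rfl
  answer_eq := hF.nreg rAnswer rfl
  lt := by omega

theorem HoldsArcs.flowMemory_zero (h : HoldsArcs N ends m τ) (hl : IsLinkList N ends)
    (hF : Frame setup (inputState N ends s u t) τ) : FlowMemory (2 * m) h.network 0 τ where
  flow_eq a _ := by simp [hF.rarr aFlow rfl, inputState]
  isFeasible := (h.represents hl).isFeasible_zero
  isLinkOptimal := by
    have hpot : τ.rarr aPot = 0 := by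
      funext v
      simp [hF.rarr aPot rfl, inputState]
    exact hpot ▸ h.network.isLinkOptimal_zero

theorem shortestRoute_runs (hl : IsLinkList N ends) :
    Runs ((n + m + 2) ^ 4) shortestRoute (inputState N ends s u t)
      (10000 * ((n + m) * (Nat.log (m / n + 2) n + 2))) (SolvesShortestRoute N s u t) := by
  have hB : 8 * m + 3 * n + 6 < (n + m + 2) ^ 4 := by
    have hn := Fin.pos s
    have hpow : 3 ^ 3 * (n + m + 2) ≤ (n + m + 2) ^ 3 * (n + m + 2) :=
      Nat.mul_le_mul_right _ (Nat.pow_le_pow_left (by omega) 3)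
    rw [pow_succ]
    omega
  refine ((setup_runs hB).seq fun τ hF hτ => sendUnits_runs (hτ.instanceMemory hl hF hB)
    (hτ.holdsArcs.flowMemory_zero hl hF)).le ?_
  have hn := Fin.pos s
  have hdiv : (m / n) * n ≤ m := Nat.div_mul_le_self m n
  rw [height]
  generalize Nat.log (m / n + 2) n = H
  have hwork : n * (m / n + 2 + 1) + 2 * m + 1 ≤ 4 * (n + m) := by linarith
  have hmul := Nat.mul_le_mul_right (600 * (H + 1 + 1)) hwork
  nlinarith [Nat.zero_le (n * H), Nat.zero_le (m * H)]

end Algorithm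

end RAM

/-- One program solves the shortest waypoint routing problem with a single waypoint on every
undirected network with `n` nodes and `m` links, on words of `O(log (n + m))` bits, within
`O(m log_{1 + m / n} n)` steps (the logarithm being defined for `m ≥ 1`). -/
theorem theorem1 :
    ∃ (P : RAM.Cmd) (K : ℕ) (C : ℝ),
      ∀ (n m : ℕ) (N : Network (Fin n)) (ends : Fin m → Fin n × Fin n) (_ : IsLinkList N ends)
        (s w t : Fin n),
        ∃ (T : ℕ) (σ : RAM.State),
          RAM.Exec ((n + m + 2) ^ K) P (inputState N ends s w t) T σ ∧
          SolvesShortestRoute N s w t σ ∧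
          (1 ≤ m → (T : ℝ) ≤ C * (m * Real.logb (1 + m / n) n)) := by
  refine ⟨RAM.shortestRoute, 4, 120000, fun n m N ends hl s w t => ?_⟩
  obtain ⟨T, hT, σ, hexec, hσ⟩ := RAM.shortestRoute_runs (s := s) (u := w) (t := t) hl
  refine ⟨T, σ, hexec, hσ, fun hm => ?_⟩
  calc (T : ℝ) ≤ 10000 * ((n + m) * (Nat.log (m / n + 2) n + 2) : ℕ) := by exact_mod_cast hT
    _ ≤ 10000 * (12 * (m * Real.logb (1 + m / n) n)) :=
        mul_le_mul_of_nonneg_left (add_mul_natLog_add_two_le (hl.two_le hm) hm hl.le_mul_self)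
          (by norm_num)
    _ = 120000 * (m * Real.logb (1 + m / n) n) := by ring
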